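/- Let $\mu>0$, $\theta_0>0$, $r>0$, let $V(\theta):=\frac12-\frac12\sqrt{1+\theta^2}$, and set $t_0:=\frac1{2\mu r}\sqrt{1-V'(\theta_0)^2}$. There exist functions $\psi,\theta\colon[0,+\infty)\to[0,+\infty)$, depending only on $\mu$, $\theta_0$ and $r$, with $\psi(t)=0$ and $\theta(t)=\theta_0$ for $0\le t\le t_0$, and $$\psi(t)=t-\frac1{2\mu r}\sqrt{1-V'(\theta(t))^2}\qquad\text{for } t>t_0,$$ such that the following holds. Let $d\ge2$, let $\Omega\subset\mathbb R^d$ be a bounded connected open set with Lipschitz boundary, let $\kappa>0$, and let $\xi_0$ be a $d\times d$ matrix with $\operatorname{tr}\xi_0=0$ whose symmetric part $\xi_0^s$ satisfies $|\xi_0^s|=r$. Write $\mathbb M_{sym}$ and $\mathbb M_D$ for the symmetric and the trace-free symmetric $d\times d$ matrices, $\sigma_D$ for the orthogonal projection of $\sigma\in\mathbb M_{sym}$ on $\mathbb M_D$, and set $$\mathbb C\xi:=2\mu\xi_D+\kappa(\operatorname{tr}\xi)I,\qquad K:=\{(\sigma,\zeta)\in\mathbb M_D\times\mathbb R:|\sigma|^2+\zeta^2\le1\},\qquad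 w(t,x):=t\xi_0x .$$ For $\varepsilon>0$, a solution of the $\varepsilon$-regularized problem with initial datum $(0,0,0,\theta_0)$ is a quadruple $(u_\varepsilon,e_\varepsilon,p_\varepsilon,z_\varepsilon)$ of functions of class $H^1_{loc}$ on $[0,+\infty)$ with values in $H^1(\Omega;\mathbb R^d)$, $L^2(\Omega;\mathbb M_{sym})$, $L^2(\Omega;\mathbb M_D)$, $L^2(\Omega)$, equal to $(0,0,0,\theta_0)$ at $t=0$, such that for every $t>0$ one has $Eu_\varepsilon(t)=e_\varepsilon(t)+p_\varepsilon(t)$ a.e. in $\Omega$, $u_\varepsilon(t)=w(t)$ on $\partial\Omega$ in the sense of traces, $\operatorname{div}(\mathbb Ce_\varepsilon(t))=0$ in $\Omega$, and for a.e. $t>0$, a.e. in $\Omega$, $$(\dot p_\varepsilon,\dot z_\varepsilon)=\tfrac1\varepsilon\big((\sigma,\zeta)-P_K(\sigma,\zeta)\big),\qquad (\sigma,\zeta)=\big((\mathbb Ce_\varepsilon)_D,-V'(z_\varepsilon)\big),$$ where $P_K$ is the projection on $K$. An approximable quasistatic evolution is a triple $(u,e,\nu)$, where $u\in L^\infty_{loc}([0,+\infty);BD(\Omega))$,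 $e\in L^\infty_{loc}([0,+\infty);L^2(\Omega;\mathbb M_{sym}))$, and $\nu=(\nu_{t_1\dots t_m})$ is a compatible system of generalized Young measures on $\overline\Omega$ with values in $\mathbb M_D\times\mathbb R$ and time set $[0,+\infty)$, all three weakly$^*$ left-continuous, for which there are $\varepsilon_k>0$, $\varepsilon_k\to0$, and a set $\Theta\subset[0,+\infty)$ containing $0$ and with Lebesgue null complement in $[0,+\infty)$, such that the solutions of the $\varepsilon_k$-regularized problems satisfy $u_{\varepsilon_k}(t)\rightharpoonup u(t)$ weakly$^*$ in $BD(\Omega)$ and $e_{\varepsilon_k}(t)\rightharpoonup e(t)$ weakly in $L^2$ for every $t\in\Theta$, and $$\delta_{((p_{\varepsilon_k}(t_1),z_{\varepsilon_k}(t_1)),\dots,(p_{\varepsilon_k}(t_m),z_{\varepsilon_k}(t_m)))}\rightharpoonup\nu_{t_1\dots t_m}$$ weakly$^*$ for all $t_1<\dots<t_m$ in $\Theta$. Here $\delta_q$ denotes the generalized Young measure associated with a bounded measure $q$ on $\overline\Omega$, and integrable functions are identified with their measures. Then every approximable quasistatic evolution $(u,e,\nu)$ is spatially regular: there are $p\in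 L^\infty_{loc}([0,+\infty);M_b(\overline\Omega;\mathbb M_D))$ and $z\in L^\infty_{loc}([0,+\infty);L^1(\Omega))$ such that $\nu_{t_1\dots t_m}=\delta_{((p(t_1),z(t_1)),\dots,(p(t_m),z(t_m)))}$ for all $0\le t_1<\dots<t_m$. Moreover, for every $t\ge0$, $$u(t,x)=t\xi_0x,\qquad e(t,x)=(t-\psi(t))\xi_0^s,\qquad p(t,x)=\psi(t)\xi_0^s,\qquad z(t,x)=\theta(t).$$ -/

import Mathlib

open MeasureTheory Filter Topology Set

noncomputable section

namespace Softening

/-! ### Matrices -/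

/-- Points of `ℝ^d`. -/
abbrev Pt (d : ℕ) : Type := EuclideanSpace ℝ (Fin d)

/-- The space of all `d × d` matrices with the Euclidean (Frobenius) scalar product;
the entry in row `i` and column `j` of `A` is `A (i, j)`. -/
abbrev Mat (d : ℕ) : Type := EuclideanSpace ℝ (Fin d × Fin d)

/-- The trace of a matrix. -/
def tr {d : ℕ} (A : Mat d) : ℝ := ∑ i, A (i, i)

/-- The space of symmetric matrices. -/
def symMat (d : ℕ) : Submodule ℝ (Mat d) where
  carrier := {A | ∀ i j, A (i, j) = A (j, i)}
  add_mem' := by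
    intro A B hA hB i j
    simp [hA i j, hB i j]
  zero_mem' := by
    intro i j
    simp
  smul_mem' := by
    intro c A hA i j
    simp [hA i j]

/-- The space of trace-free symmetric matrices. -/
def devMat (d : ℕ) : Submodule ℝ (Mat d) where
  carrier := {A | A ∈ symMat d ∧ tr A = 0}
  add_mem' := by
    rintro A B ⟨hA, hA'⟩ ⟨hB, hB'⟩
    refine ⟨add_mem hA hB, ?_⟩
    simp only [tr] at *
    simp [Finset.sum_add_distrib, hA', hB']
  zero_mem' := ⟨zero_mem _, by simp [tr]⟩
  smul_mem' := by
    rintro c A ⟨hA, hA'⟩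
    refine ⟨Submodule.smul_mem _ c hA, ?_⟩
    simp only [tr] at *
    simp [← Finset.mul_sum, hA']

/-- The inclusion of the trace-free symmetric matrices into the symmetric matrices. -/
def devToSym {d : ℕ} (A : devMat d) : symMat d := ⟨A, A.2.1⟩

/-- The identity matrix. -/
def idMat (d : ℕ) : symMat d :=
  ⟨WithLp.toLp 2 (fun ij => if ij.1 = ij.2 then 1 else 0), by
    intro i j
    simp [eq_comm]⟩

/-- The symmetric part of a matrix. -/
def symPart {d : ℕ} (A : Mat d) : symMat d :=
  ⟨WithLp.toLp 2 (fun ij => (A (ij.1, ij.2) + A (ij.2, ij.1)) / 2), by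
    intro i j
    simp [add_comm]⟩

/-- The deviator: the orthogonal projection onto the trace-free symmetric matrices. -/
def dev {d : ℕ} (A : symMat d) : devMat d := (devMat d).orthogonalProjectionOnto (A : Mat d)

/-- The product of a matrix and a vector. -/
def mulPt {d : ℕ} (A : Mat d) (x : Pt d) : Pt d := WithLp.toLp 2 (fun i => ∑ j, A (i, j) * x j)

/-- The isotropic elasticity tensor `ξ ↦ 2 μ ξ_D + κ (tr ξ) I`. -/
def isotropicTensor (d : ℕ) (μ κ : ℝ) (ξ : symMat d) : symMat d :=
  (2 * μ) • devToSym (dev ξ) + (κ * tr (ξ : Mat d)) • idMat d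

/-- The space of pairs (trace-free symmetric matrix, real number),
with the product Hilbert structure. -/
abbrev DevR (d : ℕ) : Type := WithLp 2 (devMat d × ℝ)

/-! ### The reference configuration -/

/-- The boundary of `Ω` is Lipschitz: near each boundary point, `Ω` is the region strictly above
the graph of a Lipschitz function defined on a hyperplane `ν^⊥`. -/
def HasLipschitzBoundary {d : ℕ} (Ω : Set (Pt d)) : Prop :=
  ∀ x ∈ frontier Ω, ∃ ν : Pt d, ‖ν‖ = 1 ∧ ∃ g : (Submodule.span ℝ {ν})ᗮ → ℝ,
    (∃ L, LipschitzWith L g) ∧ ∃ U : Set (Pt d), IsOpen U ∧ x ∈ U ∧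
      ∀ y ∈ U, y ∈ Ω ↔ g ((Submodule.span ℝ {ν})ᗮ.orthogonalProjectionOnto y) < inner ℝ ν y

/-- Bounded connected open sets with Lipschitz boundary. -/
structure IsLipschitzDomain {d : ℕ} (Ω : Set (Pt d)) : Prop where
  isOpen : IsOpen Ω
  isConnected : IsConnected Ω
  isBounded : Bornology.IsBounded Ω
  lipschitz : HasLipschitzBoundary Ω

/-- Lebesgue measure on `Ω`. -/
abbrev volOn {d : ℕ} (Ω : Set (Pt d)) : Measure (Pt d) := volume.restrict Ω

/-- Lebesgue measure of `Ω`, as a measure on the closure of `Ω`. -/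
def leb {d : ℕ} (Ω : Set (Pt d)) : Measure (closure Ω) :=
  Measure.comap (Subtype.val : closure Ω → Pt d) (volOn Ω)

/-! ### Sobolev functions -/

/-- Smooth functions with compact support in `Ω`. -/
structure IsTest {d : ℕ} {F : Type*} [NormedAddCommGroup F] [NormedSpace ℝ F]
    (Ω : Set (Pt d)) (φ : Pt d → F) : Prop where
  smooth : ContDiff ℝ ((⊤ : ℕ∞) : WithTop ℕ∞) φ
  compact : HasCompactSupport φ
  support : tsupport φ ⊆ Ω

/-- The row-wise divergence `(div φ)_i = ∑_j ∂_j φ_{ij}` of a matrix field. -/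
def matDiv {d : ℕ} (φ : Pt d → Mat d) (x : Pt d) : Pt d :=
  WithLp.toLp 2 (fun i => ∑ j, fderiv ℝ φ x (EuclideanSpace.single j 1) (i, j))

/-- The Jacobian matrix `(∇φ)_{ij} = ∂_j φ_i` of a vector field. -/
def jacobian {d : ℕ} (φ : Pt d → Pt d) (x : Pt d) : Mat d :=
  WithLp.toLp 2 (fun ij => fderiv ℝ φ x (EuclideanSpace.single ij.2 1) ij.1)

/-- The matrix field `G` is the weak gradient of the vector field `u` in `Ω`. -/
def IsWeakGrad {d : ℕ} (Ω : Set (Pt d)) (u : Pt d → Pt d) (G : Pt d → Mat d) : Prop :=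
  ∀ φ : Pt d → Mat d, IsTest Ω φ →
    ∫ x in Ω, inner ℝ (u x) (matDiv φ x) = - ∫ x in Ω, inner ℝ (G x) (φ x)

/-- The space `L²(Ω; ℝ^d) × L²(Ω; ℝ^{d × d})`, with the product Hilbert structure. -/
abbrev L2Pair {d : ℕ} (Ω : Set (Pt d)) : Type :=
  WithLp 2 (Lp (Pt d) 2 (volOn Ω) × Lp (Mat d) 2 (volOn Ω))

theorem IsTest.memLp {d : ℕ} {F : Type*} [NormedAddCommGroup F] [NormedSpace ℝ F]
    {Ω : Set (Pt d)} {φ : Pt d → F} (h : IsTest Ω φ) : MemLp φ 2 (volOn Ω) :=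
  (h.smooth.continuous.memLp_of_hasCompactSupport h.compact (μ := volume)).restrict Ω

theorem IsTest.memLp_matDiv {d : ℕ} {Ω : Set (Pt d)} {φ : Pt d → Mat d} (h : IsTest Ω φ) :
    MemLp (matDiv φ) 2 (volOn Ω) := by
  have hc : Continuous (fderiv ℝ φ) := h.smooth.continuous_fderiv (by simp)
  have h1 : Continuous (matDiv φ) := by
    unfold matDiv
    fun_prop
  have h2 : HasCompactSupport (matDiv φ) := by
    refine (h.compact.fderiv ℝ).mono' ?_
    refine Set.Subset.trans ?_ subset_closure
    intro x hx
    contrapose! hx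
    have h0 : fderiv ℝ φ x = 0 := by simpa using hx
    simp only [Function.mem_support, not_not]
    ext i
    simp [matDiv, h0]
  exact (h1.memLp_of_hasCompactSupport h2 (μ := volume)).restrict Ω

theorem isWeakGrad_iff {d : ℕ} {Ω : Set (Pt d)} (v : L2Pair Ω) :
    IsWeakGrad Ω v.fst v.snd ↔ ∀ (φ : Pt d → Mat d) (h : IsTest Ω φ),
      inner ℝ v.fst (h.memLp_matDiv.toLp _) + inner ℝ v.snd (h.memLp.toLp _) = 0 := by
  have key : ∀ (φ : Pt d → Mat d) (h : IsTest Ω φ),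
      inner ℝ v.fst (h.memLp_matDiv.toLp _) + inner ℝ v.snd (h.memLp.toLp _) =
      (∫ x in Ω, inner ℝ (v.fst x) (matDiv φ x)) + ∫ x in Ω, inner ℝ (v.snd x) (φ x) := by
    intro φ h
    rw [L2.inner_def, L2.inner_def]
    congr 1
    · refine integral_congr_ae ?_
      filter_upwards [h.memLp_matDiv.coeFn_toLp] with x hx
      rw [hx]
    · refine integral_congr_ae ?_
      filter_upwards [h.memLp.coeFn_toLp] with x hx
      rw [hx]
  refine forall₂_congr fun φ h => ?_
  rw [key φ h]
  exact eq_neg_iff_add_eq_zero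

/-- The Sobolev space `H¹(Ω; ℝ^d)`. An element `v` consists of a function `v.1.fst` and its weak
gradient `v.1.snd`, so that the induced norm is the usual one. -/
def H1 {d : ℕ} (Ω : Set (Pt d)) : Submodule ℝ (L2Pair Ω) where
  carrier := {v | IsWeakGrad Ω v.fst v.snd}
  add_mem' := by
    intro v w hv hw
    simp only [mem_ofPred_eq, isWeakGrad_iff] at *
    intro φ h
    have e1 := hv φ h
    have e2 := hw φ h
    simp only [WithLp.add_fst, WithLp.add_snd, inner_add_left]
    linarith
  zero_mem' := by
    simp only [mem_ofPred_eq, isWeakGrad_iff]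
    intro φ h
    simp
  smul_mem' := by
    intro c v hv
    simp only [mem_ofPred_eq, isWeakGrad_iff] at *
    intro φ h
    have e1 := hv φ h
    simp only [WithLp.smul_fst, WithLp.smul_snd, inner_smul_left]
    rw [← mul_add, e1, mul_zero]

theorem isClosed_H1 {d : ℕ} (Ω : Set (Pt d)) : IsClosed (H1 Ω : Set (L2Pair Ω)) := by
  have : (H1 Ω : Set (L2Pair Ω)) = ⋂ (φ : Pt d → Mat d) (h : IsTest Ω φ),
      {v : L2Pair Ω | inner ℝ v.fst (h.memLp_matDiv.toLp _) +
        inner ℝ v.snd (h.memLp.toLp _) = 0} := by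
    ext v
    simp only [mem_iInter, mem_ofPred_eq]
    exact isWeakGrad_iff v
  rw [this]
  refine isClosed_iInter fun φ => isClosed_iInter fun h => ?_
  refine isClosed_eq ?_ continuous_const
  have c1 : Continuous fun v : L2Pair Ω => v.fst := WithLp.continuous_fst 2 _ _
  have c2 : Continuous fun v : L2Pair Ω => v.snd := WithLp.continuous_snd 2 _ _
  exact (c1.inner continuous_const).add (c2.inner continuous_const)

instance {d : ℕ} (Ω : Set (Pt d)) : CompleteSpace (H1 Ω) :=
  (isClosed_H1 Ω).completeSpace_coe

/-- The strain `Eu`, that is, the symmetric part of the gradient. -/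
def strain {d : ℕ} {Ω : Set (Pt d)} (u : H1 Ω) (x : Pt d) : symMat d := symPart (u.1.snd x)

/-- `v` vanishes on `∂Ω` in the sense of traces: `v` belongs to `H¹₀(Ω; ℝ^d)`, that is, it is the
limit in `H¹` of smooth functions with compact support in `Ω`. -/
def VanishesOnBoundary {d : ℕ} {Ω : Set (Pt d)} (v : H1 Ω) : Prop :=
  ∃ φ : ℕ → Pt d → Pt d, (∀ k, IsTest Ω (φ k)) ∧
    Tendsto (fun k => eLpNorm (fun x => v.1.fst x - φ k x) 2 (volOn Ω)) atTop (𝓝 0) ∧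
    Tendsto (fun k => eLpNorm (fun x => v.1.snd x - jacobian (φ k) x) 2 (volOn Ω)) atTop (𝓝 0)

/-- `f` belongs to `H¹_loc([0, ∞); X)` with derivative `f'`: the function `f'` belongs to
`L²(0, T; X)` for every `T`, and `f` is its (continuous) primitive. -/
def HasH1LocDeriv {X : Type*} [NormedAddCommGroup X] [NormedSpace ℝ X] [CompleteSpace X]
    (f f' : ℝ → X) : Prop :=
  (∀ T > 0, MemLp f' 2 (volume.restrict (Icc 0 T))) ∧
    ∀ t, 0 ≤ t → f t = f 0 + ∫ s in (0 : ℝ)..t, f' s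

/-! ### The regularized evolution -/

/-- The projection of `q` onto the closed convex set `K`. -/
def projK {d : ℕ} (K : Set (DevR d)) (q : DevR d) : DevR d :=
  Classical.epsilon fun r => r ∈ K ∧ ∀ s ∈ K, ‖q - r‖ ≤ ‖q - s‖

/-- `N_K^ε (q) = (q - P_K q) / ε`. -/
def flowMap {d : ℕ} (K : Set (DevR d)) (ε : ℝ) (q : DevR d) : DevR d := ε⁻¹ • (q - projK K q)

/-- `div σ = 0` in `Ω`, and the normal trace `[σ n]` vanishes on the complement of the Dirichlet
part of the boundary. Here the Dirichlet part is the whole of `∂Ω`, and the second condition is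
`⟨div σ, v⟩ + ⟨σ, Ev⟩ = 0` for every `v` in `H¹` that vanishes on `∂Ω`. -/
def IsEquilibrated {d : ℕ} (Ω : Set (Pt d)) (σ : Pt d → symMat d) : Prop :=
  (∀ φ : Pt d → Pt d, IsTest Ω φ → ∫ x in Ω, inner ℝ (σ x : Mat d) (jacobian φ x) = 0) ∧
    ∀ v : H1 Ω, VanishesOnBoundary v → ∫ x in Ω, inner ℝ (σ x) (strain v x) = 0

/-- Solutions of the `ε`-regularized evolution problem with elasticity tensor `El`, constraint
set `K`, softening potential `V`, boundary datum `w` on `∂Ω`, and initial condition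
`(u₀, e₀, p₀, z₀)`. -/
structure IsRegularizedSolution {d : ℕ} (Ω : Set (Pt d)) (El : symMat d → symMat d)
    (K : Set (DevR d)) (V : ℝ → ℝ) (ε : ℝ) (w : ℝ → H1 Ω)
    (u₀ : H1 Ω) (e₀ : Lp (symMat d) 2 (volOn Ω)) (p₀ : Lp (devMat d) 2 (volOn Ω))
    (z₀ : Lp ℝ 2 (volOn Ω))
    (u : ℝ → H1 Ω) (e : ℝ → Lp (symMat d) 2 (volOn Ω)) (p : ℝ → Lp (devMat d) 2 (volOn Ω))
    (z : ℝ → Lp ℝ 2 (volOn Ω)) : Prop where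
  regular_u : ∃ u', HasH1LocDeriv u u'
  regular_e : ∃ e', HasH1LocDeriv e e'
  initial : u 0 = u₀ ∧ e 0 = e₀ ∧ p 0 = p₀ ∧ z 0 = z₀
  additive : ∀ t, 0 < t → ∀ᵐ x ∂(volOn Ω), strain (u t) x = e t x + devToSym (p t x)
  boundary : ∀ t, 0 < t → VanishesOnBoundary (u t - w t)
  equilibrium : ∀ t, 0 < t → IsEquilibrated Ω (fun x => El (e t x))
  /-- Regularity of `p` and `z`, and the regularized flow rule. -/
  flow : ∃ p' z', HasH1LocDeriv p p' ∧ HasH1LocDeriv z z' ∧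
    ∀ᵐ t ∂(volume.restrict (Ioi (0 : ℝ))), ∀ᵐ x ∂(volOn Ω),
      (WithLp.toLp 2 (p' t x, z' t x) : DevR d) =
        flowMap K ε (WithLp.toLp 2 (dev (El (e t x)), - deriv V (z t x)))

/-! ### Functions with bounded deformation -/

/-- The space `BD(Ω)`: integrable functions whose distributional strain is a bounded measure. The
measure is determined by the function. -/
structure BD {d : ℕ} (Ω : Set (Pt d)) where
  toLp : Lp (Pt d) 1 (volOn Ω)
  strainMeasure : VectorMeasure Ω (symMat d)
  isStrain : ∀ φ : Pt d → symMat d, IsTest Ω φ →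
    ∫ x in Ω, inner ℝ (toLp x) (matDiv (fun y => (φ y : Mat d)) x) =
      - strainMeasure.integral (fun x : Ω => φ x) (innerSL ℝ)

/-- Weak* convergence in `BD(Ω)`, for sequences or along countably generated filters: weak
convergence of the functions in `L¹` and weak* convergence of the strains as measures. -/
def BD.WeakStarTendsto {d : ℕ} {Ω : Set (Pt d)} {ι : Type*} (v : ι → BD Ω) (l : Filter ι)
    (u : BD Ω) : Prop :=
  (∀ g : Pt d → Pt d, MemLp g ⊤ (volOn Ω) →
    Tendsto (fun i => ∫ x in Ω, inner ℝ ((v i).toLp x) (g x)) l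
      (𝓝 (∫ x in Ω, inner ℝ (u.toLp x) (g x)))) ∧
  ∀ φ : ZeroAtInftyContinuousMap Ω (symMat d),
    Tendsto (fun i => (v i).strainMeasure.integral φ (innerSL ℝ)) l
      (𝓝 (u.strainMeasure.integral φ (innerSL ℝ)))

/-- `L^∞_loc([0, ∞); BD(Ω))`: weak* measurable and locally essentially bounded. -/
def BD.LinftyLoc {d : ℕ} {Ω : Set (Pt d)} (u : ℝ → BD Ω) : Prop :=
  (∀ g : Pt d → Pt d, MemLp g ⊤ (volOn Ω) →
    AEMeasurable (fun t => ∫ x in Ω, inner ℝ ((u t).toLp x) (g x)) (volume.restrict (Ici 0))) ∧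
  (∀ φ : ZeroAtInftyContinuousMap Ω (symMat d),
    AEMeasurable (fun t => (u t).strainMeasure.integral φ (innerSL ℝ))
      (volume.restrict (Ici 0))) ∧
  ∀ T > 0, ∃ C : ℝ, ∀ᵐ t ∂(volume.restrict (Icc 0 T)),
    ENNReal.ofReal ‖(u t).toLp‖ + (u t).strainMeasure.variation univ ≤ ENNReal.ofReal C

/-- `L^∞_loc([0, ∞); M_b(X; F))`: weak* measurable and locally essentially bounded. -/
def MeasureLinftyLoc {X F : Type*} [TopologicalSpace X] [MeasurableSpace X] [NormedAddCommGroup F]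
    [InnerProductSpace ℝ F] (p : ℝ → VectorMeasure X F) : Prop :=
  (∀ φ : C(X, F), AEMeasurable (fun t => (p t).integral φ (innerSL ℝ))
    (volume.restrict (Ici 0))) ∧
  ∀ T > 0, ∃ C : ℝ, ∀ᵐ t ∂(volume.restrict (Icc 0 T)),
    (p t).variation univ ≤ ENNReal.ofReal C

/-! ### Generalized Young measures -/

/-- Continuous functions `f (x, ξ, η)` on `closure Ω × F × ℝ` that are positively homogeneous of
degree one in `(ξ, η)`. -/
def Chom {d : ℕ} (Ω : Set (Pt d)) (F : Type*) [NormedAddCommGroup F] [NormedSpace ℝ F] :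
    Submodule ℝ C(closure Ω × F × ℝ, ℝ) where
  carrier := {f | ∀ x ξ η (c : ℝ), 0 ≤ c → f (x, c • ξ, c * η) = c * f (x, ξ, η)}
  add_mem' := by
    intro f g hf hg x ξ η c hc
    simp [hf x ξ η c hc, hg x ξ η c hc, mul_add]
  zero_mem' := by
    intro x ξ η c hc
    simp
  smul_mem' := by
    intro a f hf x ξ η c hc
    simp [hf x ξ η c hc, mul_left_comm]

/-- Generalized Young measures on the closure of `Ω` with values in `F`: the bounded linear
functionals on `Chom Ω F` with the positivity, support and projection properties. (The choice of
the norm of `F × ℝ` in `bounded` does not matter, as `F` is finite dimensional.) -/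
structure GY {d : ℕ} (Ω : Set (Pt d)) (F : Type*) [NormedAddCommGroup F] [NormedSpace ℝ F] where
  toFun : Chom Ω F →ₗ[ℝ] ℝ
  bounded : ∃ C : ℝ, ∀ (f : Chom Ω F) (a : ℝ),
    (∀ x ξ η, ‖((ξ, η) : F × ℝ)‖ = 1 → |f.1 (x, ξ, η)| ≤ a) → |toFun f| ≤ C * a
  nonneg : ∀ f : Chom Ω F, (∀ y, 0 ≤ f.1 y) → 0 ≤ toFun f
  support : ∀ f : Chom Ω F, (∀ x ξ η, 0 ≤ η → f.1 (x, ξ, η) = 0) → toFun f = 0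
  projection : ∀ (f : Chom Ω F) (φ : C(closure Ω, ℝ)),
    (∀ x ξ η, f.1 (x, ξ, η) = φ x * η) → toFun f = ∫ x, φ x ∂(leb Ω)

/-- Finite increasing sequences of times in `[0, ∞)`. -/
def IsTimes {m : ℕ} (t : Fin m → ℝ) : Prop := StrictMono t ∧ ∀ i, 0 ≤ t i

/-- Compatible systems of generalized Young measures with time set `[0, ∞)`. Only the values
at sequences `t` with `IsTimes t` are relevant. -/
structure SGY {d : ℕ} (Ω : Set (Pt d)) (F : Type*) [NormedAddCommGroup F]
    [NormedSpace ℝ F] where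
  at_times : ∀ {m : ℕ}, (Fin m → ℝ) → GY Ω (Fin m → F)
  compat : ∀ {n m : ℕ} (s : Fin n → ℝ) (t : Fin m → ℝ) (j : Fin n → Fin m),
    IsTimes s → IsTimes t → (∀ i, s i = t (j i)) →
    ∀ (f : Chom Ω (Fin n → F)) (g : Chom Ω (Fin m → F)),
      (∀ x ξ η, g.1 (x, ξ, η) = f.1 (x, fun i => ξ (j i), η)) →
      (at_times s).toFun f = (at_times t).toFun g

/-- Weak* left-continuity of a system of generalized Young measures. -/
def SGY.LeftContinuous {d : ℕ} {Ω : Set (Pt d)} {F : Type*} [NormedAddCommGroup F]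
    [NormedSpace ℝ F] (ν : SGY Ω F) : Prop :=
  ∀ {m : ℕ} (t : Fin m → ℝ), IsTimes t → ∀ f : Chom Ω (Fin m → F),
    Tendsto (fun s : Fin m → ℝ => (ν.at_times s).toFun f)
      (𝓝[{s | IsTimes s ∧ ∀ i, s i ≤ t i}] t) (𝓝 ((ν.at_times t).toFun f))

/-- The value at `f` of the generalized Young measure associated with a measure `q`, where `h` and
`k` are the densities of `q` and of Lebesgue measure with respect to `lam`. -/
def deltaPairing {d : ℕ} {Ω : Set (Pt d)} {F : Type*} [NormedAddCommGroup F] [NormedSpace ℝ F]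
    (lam : Measure (closure Ω)) (h : closure Ω → F) (k : closure Ω → ℝ) (f : Chom Ω F) : ℝ :=
  ∫ x, f.1 (x, h x, k x) ∂lam

/-- `ν` is the generalized Young measure `δ_q` associated with the measure `q`. The integral does
not depend on the choice of the reference measure `lam`. -/
def IsDelta {d : ℕ} {Ω : Set (Pt d)} {F : Type*} [NormedAddCommGroup F] [NormedSpace ℝ F]
    (ν : GY Ω F) (q : VectorMeasure (closure Ω) F) : Prop :=
  ∃ (lam : Measure (closure Ω)) (h : closure Ω → F) (k : closure Ω → ℝ),
    IsFiniteMeasure lam ∧ Integrable h lam ∧ Measurable k ∧ (∀ x, 0 ≤ k x) ∧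
    lam.withDensityᵥ h = q ∧ lam.withDensity (fun x => ENNReal.ofReal (k x)) = leb Ω ∧
    ∀ f : Chom Ω F, ν.toFun f = deltaPairing lam h k f

/-- The system `ν` is associated with the functions `p` and `z`, with
`p ∈ L^∞_loc([0, ∞); M_b)` and `z ∈ L^∞_loc([0, ∞); L¹)`: the property that makes an approximable
quasistatic evolution spatially regular. -/
structure IsSpatiallyRegular {d : ℕ} {Ω : Set (Pt d)} (ν : SGY Ω (DevR d))
    (p : ℝ → VectorMeasure (closure Ω) (devMat d)) (z : ℝ → Lp ℝ 1 (volOn Ω)) : Prop where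
  bounded_p : MeasureLinftyLoc p
  bounded_z : ∀ T > 0, MemLp z ⊤ (volume.restrict (Icc 0 T))
  delta : ∀ {m : ℕ} (t : Fin m → ℝ), IsTimes t →
    ∃ q : VectorMeasure (closure Ω) (Fin m → DevR d),
      (∀ B, MeasurableSet B → ∀ i,
        q B i = WithLp.toLp 2 (p (t i) B, ∫ x in B, z (t i) (x : Pt d) ∂(leb Ω))) ∧
      IsDelta (ν.at_times t) q

/-! ### Approximable quasistatic evolutions -/

/-- Approximable quasistatic evolutions `(u, e, ν)` with elasticity tensor `El`, constraint
set `K`, softening potential `V`, boundary datum `w` on `∂Ω`, and initial condition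
`(u₀, e₀, p₀, z₀)`. -/
structure IsApproximableEvolution {d : ℕ} (Ω : Set (Pt d)) (El : symMat d → symMat d)
    (K : Set (DevR d)) (V : ℝ → ℝ) (w : ℝ → H1 Ω)
    (u₀ : H1 Ω) (e₀ : Lp (symMat d) 2 (volOn Ω)) (p₀ : Lp (devMat d) 2 (volOn Ω))
    (z₀ : Lp ℝ 2 (volOn Ω))
    (u : ℝ → BD Ω) (e : ℝ → Lp (symMat d) 2 (volOn Ω)) (ν : SGY Ω (DevR d)) : Prop where
  bounded_u : BD.LinftyLoc u
  bounded_e : ∀ T > 0, MemLp e ⊤ (volume.restrict (Icc 0 T))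
  left_u : ∀ t, 0 ≤ t → BD.WeakStarTendsto u (𝓝[Icc 0 t] t) (u t)
  left_e : ∀ t, 0 ≤ t → ∀ g : Lp (symMat d) 2 (volOn Ω),
    Tendsto (fun s => inner ℝ (e s) g) (𝓝[Icc 0 t] t) (𝓝 (inner ℝ (e t) g))
  left_ν : ν.LeftContinuous
  approx : ∃ (ε : ℕ → ℝ) (Θ : Set ℝ) (uε : ℕ → ℝ → H1 Ω)
    (eε : ℕ → ℝ → Lp (symMat d) 2 (volOn Ω)) (pε : ℕ → ℝ → Lp (devMat d) 2 (volOn Ω))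
    (zε : ℕ → ℝ → Lp ℝ 2 (volOn Ω)),
    (∀ k, 0 < ε k) ∧ Tendsto ε atTop (𝓝 0) ∧
    Θ ⊆ Ici 0 ∧ 0 ∈ Θ ∧ volume (Ici 0 \ Θ) = 0 ∧
    (∀ k, IsRegularizedSolution Ω El K V (ε k) w u₀ e₀ p₀ z₀ (uε k) (eε k) (pε k) (zε k)) ∧
    -- weak* convergence in `BD`, where `U k` is `uε k t` regarded as an element of `BD`
    (∀ t ∈ Θ, ∃ U : ℕ → BD Ω,
      (∀ k, (U k).toLp =ᵐ[volOn Ω] (uε k t).1.fst) ∧ BD.WeakStarTendsto U atTop (u t)) ∧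
    (∀ t ∈ Θ, ∀ g : Lp (symMat d) 2 (volOn Ω),
      Tendsto (fun k => inner ℝ (eε k t) g) atTop (𝓝 (inner ℝ (e t) g))) ∧
    ∀ {m : ℕ} (t : Fin m → ℝ), IsTimes t → (∀ i, t i ∈ Θ) → ∀ f : Chom Ω (Fin m → DevR d),
      Tendsto (fun k => deltaPairing (leb Ω)
          (fun x i => WithLp.toLp 2 (pε k (t i) (x : Pt d), zε k (t i) (x : Pt d)))
          (fun _ => 1) f) atTop
        (𝓝 ((ν.at_times t).toFun f))

/-! ### The data of the example -/

/-- The closed unit ball, as the constraint set. -/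
def unitBall (d : ℕ) : Set (DevR d) := {q | ‖q.fst‖ ^ 2 + q.snd ^ 2 ≤ 1}

/-- The softening potential `V(θ) = 1/2 - (1/2) √(1 + θ²)`. -/
def softV (θ : ℝ) : ℝ := 1 / 2 - 1 / 2 * √(1 + θ ^ 2)

/-- The function `(2 μ r)⁻¹ √(1 - V'(θ)²)`, where `r` is the norm of the symmetric strain rate. -/
def elasticLimit (μ r θ : ℝ) : ℝ := 1 / (2 * μ * r) * √(1 - deriv softV θ ^ 2)

end Softening

end

open Softening MeasureTheory

/-!
All solutions of the regularized problems are explicit. With boundary datum `t ξ₀ x`, whose strain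
rate is spatially constant, the regularized problem has the homogeneous solution
`e = s ξ₀ˢ`, `p = (t - s) ξ₀ˢ`, `z = θ`, where `(s, θ)` solves a system of two ordinary differential
equations (`IsHomogeneous`, `exists_isHomogeneous`). It is the only solution: the difference of two
stresses is orthogonal to the strains of the functions that vanish on the boundary, so that the
elastic strains differ by no more than the plastic strains do (`energy_estimate`); the
regularized flow rule is Lipschitz, and Grönwall's lemma in `L²` gives
`IsRegularizedSolution.eq_homogeneous`.

The rest concerns the system for `(s, θ)` as `ε → 0`. In its two equations the factor `1 / ε`
multiplies `-2 μ s N` and `N (-V'(θ))` with the same function `N` of `(s, θ)`. It cancels in the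
equation for `y = s E(θ)`, where `E` solves `E' = (2 μ / (-V')) E`, and there remains `y' = E(θ)`
(`decay`, `IsHomogeneous.isSlowFast`). The system is thus slow–fast: `θ` moves, and only upwards,
while `y` exceeds `Y(θ) = E(θ) G(θ)`, where `G` is `elasticLimit`. The curve `Y` need not be
monotone, and `θ` may jump. The limit is found by using the slow variable in place of time. When `y`
reaches the level `η`, the variable `θ` cannot have passed the first point `firstHit η` at which `Y`
reaches `η`, and it cannot be much below `firstHit η` either, because the activated motion is fast.
Since `dt = dy / E(θ)`, the time at which the limit reaches `x` is
`clock x = ∫₀ˣ dη / E(firstHit η)`, and the limit `y` is the inverse of `clock`, with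
`θ = firstHit y`. Left-continuity and the relation `Y(θ) = y` come from the definition of `firstHit`
(`IsCriticalCurve.exists_limit`).

At each time the approximating `p` and `z` are constant in space, and the generalized Young measure
of a constant depends continuously on it (`continuous_deltaPairing_const`). This gives the limit at
almost all times, and left-continuity extends it to all times
(`IsApproximableEvolution.eq_homogeneous_limit`).
-/

noncomputable section

namespace Softening

/-! ### A slow variable driving a fast one through a critical curve -/

/-- The data of a slow–fast system `y' = E θ`, `ε θ' = k θ y` issuing from `y = 0`, `θ = θ₀`, in
which `θ` can only move while `y` is above the critical curve `y = Y θ`. The last field bounds the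
speed `E θ` linearly by the slow variable on the curve, which prevents blow-up. -/
structure IsCriticalCurve (θ₀ : ℝ) (E Y : ℝ → ℝ) : Prop where
  mono : Monotone E
  cont : Continuous E
  init : E θ₀ = 1
  top : Tendsto E atTop atTop
  cont_curve : Continuous Y
  bound : ∃ c > 0, ∀ θ, c * E θ ≤ Y θ

/-- The first value `θ ≥ θ₀` at which the critical curve reaches the level `η`. -/
def firstHit (θ₀ : ℝ) (Y : ℝ → ℝ) (η : ℝ) : ℝ := sInf {θ | θ₀ ≤ θ ∧ η ≤ Y θ}

/-- The time the limit evolution needs to bring the slow variable from `0` to `x`. -/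
def clock (θ₀ : ℝ) (E Y : ℝ → ℝ) (x : ℝ) : ℝ := ∫ η in (0 : ℝ)..x, (E (firstHit θ₀ Y η))⁻¹

namespace IsCriticalCurve

variable {θ₀ : ℝ} {E Y : ℝ → ℝ}

theorem one_le (h : IsCriticalCurve θ₀ E Y) {θ : ℝ} (hθ : θ₀ ≤ θ) : 1 ≤ E θ :=
  h.init ▸ h.mono hθ

theorem firstHit_mem (h : IsCriticalCurve θ₀ E Y) (η : ℝ) :
    θ₀ ≤ firstHit θ₀ Y η ∧ η ≤ Y (firstHit θ₀ Y η) := by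
  have hc : IsClosed {θ | θ₀ ≤ θ ∧ η ≤ Y θ} :=
    (isClosed_le continuous_const continuous_id).inter
      (isClosed_le continuous_const h.cont_curve)
  have hne : {θ | θ₀ ≤ θ ∧ η ≤ Y θ}.Nonempty := by
    obtain ⟨c, hc, hb⟩ := h.bound
    obtain ⟨θ, h1, h2⟩ := ((eventually_ge_atTop θ₀).and
      (h.top.eventually_ge_atTop (η / c))).exists
    refine ⟨θ, h1, le_trans ?_ (hb θ)⟩
    rw [div_le_iff₀ hc] at h2
    linarith
  exact hc.csInf_mem hne ⟨θ₀, fun x hx => hx.1⟩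

theorem firstHit_le (_h : IsCriticalCurve θ₀ E Y) {η θ : ℝ} (h1 : θ₀ ≤ θ) (h2 : η ≤ Y θ) :
    firstHit θ₀ Y η ≤ θ :=
  csInf_le ⟨θ₀, fun _ hx => hx.1⟩ ⟨h1, h2⟩

theorem lt_of_lt_firstHit (h : IsCriticalCurve θ₀ E Y) {η θ : ℝ} (h1 : θ₀ ≤ θ)
    (h2 : θ < firstHit θ₀ Y η) : Y θ < η := by
  by_contra! h3
  exact absurd (h.firstHit_le h1 h3) (not_le.2 h2)

theorem firstHit_mono (h : IsCriticalCurve θ₀ E Y) : Monotone (firstHit θ₀ Y) := fun _ b hab =>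
  h.firstHit_le (h.firstHit_mem b).1 (hab.trans (h.firstHit_mem b).2)

theorem firstHit_eq_init (h : IsCriticalCurve θ₀ E Y) {η : ℝ} (hη : η ≤ Y θ₀) :
    firstHit θ₀ Y η = θ₀ :=
  le_antisymm (h.firstHit_le le_rfl hη) (h.firstHit_mem η).1

theorem curve_firstHit (h : IsCriticalCurve θ₀ E Y) {η : ℝ} (hη : Y θ₀ < η) :
    Y (firstHit θ₀ Y η) = η := by
  refine le_antisymm ?_ (h.firstHit_mem η).2
  have hlt : θ₀ < firstHit θ₀ Y η := by
    refine lt_of_le_of_ne (h.firstHit_mem η).1 fun he => ?_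
    have := (h.firstHit_mem η).2
    rw [← he] at this
    linarith
  have ht : Tendsto Y (𝓝[<] (firstHit θ₀ Y η)) (𝓝 (Y (firstHit θ₀ Y η))) :=
    h.cont_curve.continuousAt.tendsto.mono_left nhdsWithin_le_nhds
  refine le_of_tendsto ht ?_
  filter_upwards [Ioo_mem_nhdsLT hlt] with θ hθ
  exact (h.lt_of_lt_firstHit hθ.1.le hθ.2).le

/-- The first hitting value is left-continuous in the level. -/
theorem exists_lt_firstHit (h : IsCriticalCurve θ₀ E Y) {η a : ℝ} (ha : a < firstHit θ₀ Y η) :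
    ∃ b < η, ∀ x, b ≤ x → a < firstHit θ₀ Y x := by
  rcases lt_or_ge a θ₀ with h0 | h0
  · exact ⟨η - 1, by linarith, fun x _ => h0.trans_le (h.firstHit_mem x).1⟩
  -- on the compact interval `[θ₀, a]` the curve stays strictly below the level `η`
  obtain ⟨m, hm, hmax⟩ := isCompact_Icc.exists_isMaxOn (nonempty_Icc.2 h0)
    (h.cont_curve.continuousOn (s := Icc θ₀ a))
  have h1 : Y m < η := h.lt_of_lt_firstHit hm.1 (hm.2.trans_lt ha)
  refine ⟨(Y m + η) / 2, by linarith, fun x hx => ?_⟩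
  by_contra! h2
  have h3 := (h.firstHit_mem x).2
  have h4 := hmax (show firstHit θ₀ Y x ∈ Icc θ₀ a from ⟨(h.firstHit_mem x).1, h2⟩)
  simp only [mem_ofPred_eq] at h4
  linarith

theorem one_le_speed (h : IsCriticalCurve θ₀ E Y) (η : ℝ) : 1 ≤ E (firstHit θ₀ Y η) :=
  h.one_le (h.firstHit_mem η).1

theorem speed_mono (h : IsCriticalCurve θ₀ E Y) : Monotone fun η => E (firstHit θ₀ Y η) :=
  h.mono.comp h.firstHit_mono

theorem exists_speed_le (h : IsCriticalCurve θ₀ E Y) :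
    ∃ C > 0, ∀ η, 0 ≤ η → E (firstHit θ₀ Y η) ≤ 1 + C * η := by
  obtain ⟨c, hc, hb⟩ := h.bound
  refine ⟨c⁻¹, inv_pos.2 hc, fun η hη => ?_⟩
  rcases le_or_gt η (Y θ₀) with h1 | h1
  · rw [h.firstHit_eq_init h1, h.init]
    have : 0 ≤ c⁻¹ * η := by positivity
    linarith
  · have h2 := hb (firstHit θ₀ Y η)
    rw [h.curve_firstHit h1] at h2
    have h3 : E (firstHit θ₀ Y η) ≤ c⁻¹ * η := by
      rw [inv_mul_eq_div, le_div_iff₀ hc]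
      linarith
    linarith

theorem antitone_inv_speed (h : IsCriticalCurve θ₀ E Y) :
    Antitone fun η => (E (firstHit θ₀ Y η))⁻¹ := fun a b hab =>
  inv_anti₀ (by linarith [h.one_le_speed a]) (h.speed_mono hab)

theorem clock_sub (h : IsCriticalCurve θ₀ E Y) (a b : ℝ) :
    clock θ₀ E Y b - clock θ₀ E Y a = ∫ η in a..b, (E (firstHit θ₀ Y η))⁻¹ :=
  intervalIntegral.integral_interval_sub_left
    h.antitone_inv_speed.intervalIntegrable h.antitone_inv_speed.intervalIntegrable

theorem clock_sub_le (h : IsCriticalCurve θ₀ E Y) {a b : ℝ} (hab : a ≤ b) :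
    clock θ₀ E Y b - clock θ₀ E Y a ≤ b - a := by
  rw [h.clock_sub]
  have := intervalIntegral.integral_mono_on hab h.antitone_inv_speed.intervalIntegrable
    (intervalIntegrable_const (μ := volume) (c := (1 : ℝ)))
    (fun x _ => inv_le_one_of_one_le₀ (h.one_le_speed x))
  simpa using this

theorem le_clock_sub (h : IsCriticalCurve θ₀ E Y) {a b : ℝ} (hab : a ≤ b) :
    (b - a) * (E (firstHit θ₀ Y b))⁻¹ ≤ clock θ₀ E Y b - clock θ₀ E Y a := by
  rw [h.clock_sub]
  have := intervalIntegral.integral_mono_on hab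
    (intervalIntegrable_const (μ := volume) (c := (E (firstHit θ₀ Y b))⁻¹))
    h.antitone_inv_speed.intervalIntegrable
    (fun x hx => h.antitone_inv_speed hx.2)
  simpa using this

theorem clock_strictMono (h : IsCriticalCurve θ₀ E Y) : StrictMono (clock θ₀ E Y) := by
  intro a b hab
  have h1 := h.le_clock_sub hab.le
  have h2 : 0 < (b - a) * (E (firstHit θ₀ Y b))⁻¹ :=
    mul_pos (by linarith) (inv_pos.2 (by linarith [h.one_le_speed b]))
  linarith

theorem clock_zero : clock θ₀ E Y 0 = 0 := by simp [clock]

theorem clock_continuous (h : IsCriticalCurve θ₀ E Y) : Continuous (clock θ₀ E Y) :=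
  intervalIntegral.continuous_primitive
    (fun _ _ => h.antitone_inv_speed.intervalIntegrable) 0

/-- The limit slow variable does not blow up in finite time, because its speed grows at most
linearly. -/
theorem exists_clock_ge (h : IsCriticalCurve θ₀ E Y) (t : ℝ) : ∃ x, 0 ≤ x ∧ t ≤ clock θ₀ E Y x := by
  obtain ⟨C, hC, hb⟩ := h.exists_speed_le
  have step : ∀ x, 1 ≤ x → clock θ₀ E Y x + (1 + 2 * C)⁻¹ ≤ clock θ₀ E Y (2 * x) := by
    intro x hx
    have h1 := h.le_clock_sub (show x ≤ 2 * x by linarith)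
    have h2 : (1 + 2 * C)⁻¹ ≤ (2 * x - x) * (E (firstHit θ₀ Y (2 * x)))⁻¹ := by
      have h3 := hb (2 * x) (by linarith)
      have h4 := h.one_le_speed (2 * x)
      rw [← div_eq_mul_inv, inv_eq_one_div, div_le_div_iff₀ (by positivity) (by linarith)]
      nlinarith
    linarith
  have iter : ∀ n : ℕ, n * (1 + 2 * C)⁻¹ ≤ clock θ₀ E Y (2 ^ n) := by
    intro n
    induction n with
    | zero =>
      have := h.clock_strictMono (show (0 : ℝ) < 1 by norm_num)
      rw [clock_zero] at this
      simpa using this.le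
    | succ n ih =>
      have := step (2 ^ n) (one_le_pow₀ (by norm_num))
      rw [pow_succ, mul_comm _ (2 : ℝ)]
      push_cast
      linarith
  obtain ⟨n, hn⟩ := exists_nat_ge (t * (1 + 2 * C))
  refine ⟨2 ^ n, by positivity, le_trans ?_ (iter n)⟩
  rwa [← div_eq_mul_inv, le_div_iff₀ (by positivity)]

theorem exists_clock_eq (h : IsCriticalCurve θ₀ E Y) {t : ℝ} (ht : 0 ≤ t) :
    ∃ x, 0 ≤ x ∧ clock θ₀ E Y x = t := by
  obtain ⟨b, hb, hbt⟩ := h.exists_clock_ge t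
  obtain ⟨x, hx, he⟩ := intermediate_value_Icc hb h.clock_continuous.continuousOn
    (show t ∈ Icc _ _ from ⟨by rw [clock_zero]; exact ht, hbt⟩)
  exact ⟨x, hx.1, he⟩

/-- If `y' ≤ E (firstHit (y - c))`, the clock runs no faster than time along `y - c`. -/
theorem clock_comp_le (h : IsCriticalCurve θ₀ E Y) {y y' : ℝ → ℝ} {a b c : ℝ} (hab : a ≤ b)
    (hy : ∀ t ∈ Icc a b, HasDerivWithinAt y (y' t) (Icc a b) t)
    (hpos : ∀ t ∈ Icc a b, 0 ≤ y' t) (hm : StrictMonoOn y (Icc a b))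
    (hle : ∀ t ∈ Icc a b, y' t ≤ E (firstHit θ₀ Y (y t - c))) :
    clock θ₀ E Y (y b - c) - clock θ₀ E Y (y a - c) ≤ b - a := by
  have hc : ContinuousOn y (Icc a b) := fun t ht => (hy t ht).continuousWithinAt
  have him : y '' Icc a b = Icc (y a) (y b) := by
    refine Subset.antisymm ?_ (intermediate_value_Icc hab hc)
    rintro _ ⟨t, ht, rfl⟩
    exact ⟨hm.monotoneOn (left_mem_Icc.2 hab) ht ht.1, hm.monotoneOn ht (right_mem_Icc.2 hab) ht.2⟩
  have hyab : y a ≤ y b := hm.monotoneOn (left_mem_Icc.2 hab) (right_mem_Icc.2 hab) hab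
  have h1 := integral_image_eq_integral_abs_deriv_smul measurableSet_Icc hy hm.injOn
    (fun x => (E (firstHit θ₀ Y (x - c)))⁻¹)
  rw [h.clock_sub, ← intervalIntegral.integral_comp_sub_right
    (fun x => (E (firstHit θ₀ Y x))⁻¹) c, intervalIntegral.integral_of_le hyab,
    ← integral_Icc_eq_integral_Ioc, ← him, h1]
  have h2 := norm_setIntegral_le_of_norm_le_const (μ := volume) (s := Icc a b) (C := 1)
    (f := fun x => |y' x| • (E (firstHit θ₀ Y (y x - c)))⁻¹) (by simp) (by
      intro t ht
      have h3 := h.one_le_speed (y t - c)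
      rw [smul_eq_mul, norm_mul, Real.norm_eq_abs, abs_abs, abs_of_nonneg (hpos t ht), norm_inv,
        Real.norm_of_nonneg (by linarith), ← div_eq_mul_inv, div_le_one (by linarith)]
      exact hle t ht)
  simp only [one_mul, Measure.real, Real.volume_Icc] at h2
  rw [ENNReal.toReal_ofReal (by linarith)] at h2
  exact (le_abs_self _).trans h2

/-- If `y' ≥ E (firstHit (y - c))`, the clock runs at least as fast as time along `y - c`. -/
theorem le_clock_comp (h : IsCriticalCurve θ₀ E Y) {y y' : ℝ → ℝ} {a b c : ℝ} (hab : a ≤ b)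
    (hy : ∀ t ∈ Icc a b, HasDerivWithinAt y (y' t) (Icc a b) t)
    (hm : StrictMonoOn y (Icc a b))
    (hle : ∀ t ∈ Icc a b, E (firstHit θ₀ Y (y t - c)) ≤ y' t) :
    b - a ≤ clock θ₀ E Y (y b - c) - clock θ₀ E Y (y a - c) := by
  have hc : ContinuousOn y (Icc a b) := fun t ht => (hy t ht).continuousWithinAt
  have him : y '' Icc a b = Icc (y a) (y b) := by
    refine Subset.antisymm ?_ (intermediate_value_Icc hab hc)
    rintro _ ⟨t, ht, rfl⟩
    exact ⟨hm.monotoneOn (left_mem_Icc.2 hab) ht ht.1, hm.monotoneOn ht (right_mem_Icc.2 hab) ht.2⟩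
  have hyab : y a ≤ y b := hm.monotoneOn (left_mem_Icc.2 hab) (right_mem_Icc.2 hab) hab
  have h1 := integral_image_eq_integral_abs_deriv_smul measurableSet_Icc hy hm.injOn
    (fun x => (E (firstHit θ₀ Y (x - c)))⁻¹)
  have hanti : Antitone fun x => (E (firstHit θ₀ Y (x - c)))⁻¹ := fun x x' hx =>
    h.antitone_inv_speed (by linarith)
  have hint : IntegrableOn (fun x => (E (firstHit θ₀ Y (x - c)))⁻¹) (y '' Icc a b) := by
    rw [him]
    exact (hanti.antitoneOn _).integrableOn_isCompact isCompact_Icc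
  have hint' := (integrableOn_image_iff_integrableOn_abs_deriv_smul measurableSet_Icc hy
    hm.injOn _).1 hint
  rw [h.clock_sub, ← intervalIntegral.integral_comp_sub_right
    (fun x => (E (firstHit θ₀ Y x))⁻¹) c, intervalIntegral.integral_of_le hyab,
    ← integral_Icc_eq_integral_Ioc, ← him, h1]
  have h2 := setIntegral_mono_on (μ := volume) (f := fun _ => (1 : ℝ)) (s := Icc a b)
    (by simp [integrableOn_const_iff]) hint' measurableSet_Icc (by
      intro t ht
      have h3 := h.one_le_speed (y t - c)
      have h4 := hle t ht
      rw [smul_eq_mul, abs_of_nonneg (by linarith), ← div_eq_mul_inv, le_div_iff₀ (by linarith)]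
      linarith)
  simpa [Measure.real, ENNReal.toReal_ofReal (sub_nonneg.2 hab)] using h2

end IsCriticalCurve

theorem le_sub_of_le_derivWithin {f f' : ℝ → ℝ} {a b C x y : ℝ}
    (hf : ∀ t ∈ Icc a b, HasDerivWithinAt f (f' t) (Icc a b) t)
    (hx : x ∈ Icc a b) (hy : y ∈ Icc a b) (hxy : x ≤ y) (hC : ∀ t ∈ Icc x y, C ≤ f' t) :
    C * (y - x) ≤ f y - f x := by
  have hsub : Icc x y ⊆ Icc a b := Icc_subset_Icc hx.1 hy.2
  have hd : ∀ t ∈ interior (Icc x y), HasDerivAt f (f' t) t := fun t ht =>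
    (hf t (hsub (interior_subset ht))).hasDerivAt
      (mem_of_superset (mem_interior_iff_mem_nhds.1 ht) hsub)
  exact (convex_Icc x y).mul_sub_le_image_sub_of_le_deriv
    (fun t ht => (hf t (hsub ht)).continuousWithinAt.mono hsub)
    (fun t ht => (hd t ht).differentiableAt.differentiableWithinAt)
    (fun t ht => (hd t ht).deriv ▸ hC t (interior_subset ht))
    x (left_mem_Icc.2 hxy) y (right_mem_Icc.2 hxy) hxy

theorem sub_le_of_derivWithin_le {f f' : ℝ → ℝ} {a b C x y : ℝ}
    (hf : ∀ t ∈ Icc a b, HasDerivWithinAt f (f' t) (Icc a b) t)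
    (hx : x ∈ Icc a b) (hy : y ∈ Icc a b) (hxy : x ≤ y) (hC : ∀ t ∈ Icc x y, f' t ≤ C) :
    f y - f x ≤ C * (y - x) := by
  have := le_sub_of_le_derivWithin (f := -f) (f' := -f') (C := -C)
    (fun t ht => (hf t ht).neg) hx hy hxy (fun t ht => neg_le_neg (hC t ht))
  simp only [Pi.neg_apply] at this
  linarith

/-- The rate `k` of a fast variable is activated by the critical curve `y = Y θ`: it vanishes
below the curve and is bounded away from zero at a positive distance above it. -/
structure IsActivatedAbove (θ₀ : ℝ) (Y : ℝ → ℝ) (k : ℝ → ℝ → ℝ) : Prop where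
  nonneg : ∀ θ y, 0 ≤ k θ y
  zero : ∀ θ y, y ≤ Y θ → k θ y = 0
  pos : ∀ A δ, 0 < δ → ∃ c > 0, ∀ θ ∈ Icc θ₀ A, ∀ y, Y θ + δ ≤ y → c ≤ k θ y

/-- Solutions on `[0, T]` of the slow–fast system `y' = E θ`, `ε θ' = k θ y`. -/
structure IsSlowFast (θ₀ ε : ℝ) (E : ℝ → ℝ) (k : ℝ → ℝ → ℝ) (T : ℝ) (y θ : ℝ → ℝ) : Prop where
  slow_init : y 0 = 0
  fast_init : θ 0 = θ₀
  slow : ∀ t ∈ Icc 0 T, HasDerivWithinAt y (E (θ t)) (Icc 0 T) t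
  fast : ∀ t ∈ Icc 0 T, HasDerivWithinAt θ (ε⁻¹ * k (θ t) (y t)) (Icc 0 T) t

namespace IsSlowFast

variable {θ₀ ε T : ℝ} {E Y : ℝ → ℝ} {k : ℝ → ℝ → ℝ} {y θ : ℝ → ℝ}

theorem fast_mono (hs : IsSlowFast θ₀ ε E k T y θ) (hk : IsActivatedAbove θ₀ Y k) (hε : 0 < ε)
    {a b : ℝ} (ha : a ∈ Icc 0 T) (hb : b ∈ Icc 0 T) (hab : a ≤ b) : θ a ≤ θ b := by
  have := le_sub_of_le_derivWithin (C := 0) hs.fast ha hb hab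
    (fun t _ => mul_nonneg (inv_pos.2 hε).le (hk.nonneg _ _))
  linarith

theorem init_le (hs : IsSlowFast θ₀ ε E k T y θ) (hk : IsActivatedAbove θ₀ Y k) (hε : 0 < ε)
    {t : ℝ} (ht : t ∈ Icc 0 T) : θ₀ ≤ θ t :=
  hs.fast_init ▸ hs.fast_mono hk hε ⟨le_rfl, ht.1.trans ht.2⟩ ht ht.1

theorem sub_le_slow (hs : IsSlowFast θ₀ ε E k T y θ) (hC : IsCriticalCurve θ₀ E Y)
    (hk : IsActivatedAbove θ₀ Y k) (hε : 0 < ε)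
    {a b : ℝ} (ha : a ∈ Icc 0 T) (hb : b ∈ Icc 0 T) (hab : a ≤ b) : b - a ≤ y b - y a := by
  have := le_sub_of_le_derivWithin (C := 1) hs.slow ha hb hab
    (fun t ht => hC.one_le (hs.init_le hk hε ⟨ha.1.trans ht.1, ht.2.trans hb.2⟩))
  linarith

theorem strictMonoOn_slow (hs : IsSlowFast θ₀ ε E k T y θ) (hC : IsCriticalCurve θ₀ E Y)
    (hk : IsActivatedAbove θ₀ Y k) (hε : 0 < ε) : StrictMonoOn y (Icc 0 T) := by
  intro a ha b hb hab
  have := hs.sub_le_slow hC hk hε ha hb hab.le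
  linarith

theorem le_slow (hs : IsSlowFast θ₀ ε E k T y θ) (hC : IsCriticalCurve θ₀ E Y)
    (hk : IsActivatedAbove θ₀ Y k) (hε : 0 < ε) {t : ℝ} (ht : t ∈ Icc 0 T) : t ≤ y t := by
  have := hs.sub_le_slow hC hk hε ⟨le_rfl, ht.1.trans ht.2⟩ ht ht.1
  rw [hs.slow_init] at this
  linarith

/-- The fast variable cannot cross the first value where the curve reaches the current level of
the slow variable, since it is at rest there at all earlier times. -/
theorem fast_le (hs : IsSlowFast θ₀ ε E k T y θ) (hC : IsCriticalCurve θ₀ E Y)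
    (hk : IsActivatedAbove θ₀ Y k) (hε : 0 < ε) {t : ℝ} (ht : t ∈ Icc 0 T) :
    θ t ≤ firstHit θ₀ Y (y t) := by
  set m := firstHit θ₀ Y (y t) with hm
  have hsub : Icc 0 t ⊆ Icc 0 T := Icc_subset_Icc le_rfl ht.2
  have hyc : ContinuousOn y (Icc 0 T) := fun τ hτ => (hs.slow τ hτ).continuousWithinAt
  have hθc : ContinuousOn θ (Icc 0 T) := fun τ hτ => (hs.fast τ hτ).continuousWithinAt
  have hcl : IsClosed ({τ | θ τ ≤ m} ∩ Icc 0 t) := by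
    rw [inter_comm]
    exact (hθc.mono hsub).preimage_isClosed_of_isClosed isClosed_Icc isClosed_Iic
  refine hcl.Icc_subset_of_forall_exists_gt ?_ ?_ (right_mem_Icc.2 ht.1)
  · simpa [hs.fast_init] using (hC.firstHit_mem (y t)).1
  rintro x ⟨hx, hx0, hxt⟩ b hb
  have hxT : x ∈ Icc 0 T := ⟨hx0, hxt.le.trans ht.2⟩
  have hright : 𝓝[>] x ≤ 𝓝[Icc 0 T] x :=
    nhdsWithin_le_of_mem (Icc_mem_nhdsGT_of_mem ⟨hx0, hxt.trans_le ht.2⟩)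
  rcases (show θ x ≤ m from hx).lt_or_eq with h | h
  · have h1 : ∀ᶠ τ in 𝓝[>] x, θ τ < m := ((hθc x hxT).eventually_lt_const h).filter_mono hright
    obtain ⟨τ, h2, h3⟩ := (h1.and (Ioc_mem_nhdsGT hb)).exists
    exact ⟨τ, h2.le, h3⟩
  · -- at `x` the slow variable is strictly below the curve, so `θ` is constant right after `x`
    have h0 : y x < Y (θ x) := by
      rw [h]
      exact (hs.strictMonoOn_slow hC hk hε hxT ht hxt).trans_le (hC.firstHit_mem (y t)).2
    have h1 : ∀ᶠ τ in 𝓝[>] x, y τ < Y (θ τ) :=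
      ((hyc x hxT).eventually_lt (hC.cont_curve.continuousAt.comp_continuousWithinAt (hθc x hxT))
        h0).filter_mono hright
    obtain ⟨c, hc, hcs⟩ := mem_nhdsGT_iff_exists_Ioc_subset.1 h1
    refine ⟨min (min b c) T, ?_, ?_, (min_le_left _ _).trans (min_le_left _ _)⟩
    · have hlt : x < min (min b c) T := lt_min (lt_min hb hc) (hxt.trans_le ht.2)
      have h2 := sub_le_of_derivWithin_le (C := 0) hs.fast hxT
        (show min (min b c) T ∈ Icc 0 T from ⟨hx0.trans hlt.le, min_le_right _ _⟩) hlt.le (by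
          intro τ hτ
          rcases hτ.1.eq_or_lt with rfl | h3
          · rw [hk.zero _ _ h0.le, mul_zero]
          · rw [hk.zero _ _ (show y τ < Y (θ τ) from hcs ⟨h3, hτ.2.trans
              ((min_le_left _ _).trans (min_le_right _ _))⟩).le, mul_zero])
      rw [h] at h2
      simp only [mem_ofPred_eq]
      linarith
    · exact lt_min (lt_min hb hc) (hxt.trans_le ht.2)

theorem clock_le (hs : IsSlowFast θ₀ ε E k T y θ) (hC : IsCriticalCurve θ₀ E Y)
    (hk : IsActivatedAbove θ₀ Y k) (hε : 0 < ε) {t : ℝ} (ht : t ∈ Icc 0 T) :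
    clock θ₀ E Y (y t) ≤ t := by
  have hsub : Icc 0 t ⊆ Icc 0 T := Icc_subset_Icc le_rfl ht.2
  have := hC.clock_comp_le (c := 0) ht.1 (fun τ hτ => (hs.slow τ (hsub hτ)).mono hsub)
    (fun τ hτ => by linarith [hC.one_le (hs.init_le hk hε (hsub hτ))])
    ((hs.strictMonoOn_slow hC hk hε).mono hsub)
    (fun τ hτ => by simpa using hC.mono (hs.fast_le hC hk hε (hsub hτ)))
  simpa [hs.slow_init, IsCriticalCurve.clock_zero] using this

end IsSlowFast

/-- For small `ε` the fast variable has reached the first hitting value of a slightly lower level: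
otherwise the system would have spent a fixed time above the critical curve, where `θ` moves at
speed of order `1 / ε`. -/
theorem IsCriticalCurve.exists_firstHit_le_fast {θ₀ : ℝ} {E Y : ℝ → ℝ} {k : ℝ → ℝ → ℝ}
    (hC : IsCriticalCurve θ₀ E Y) (hk : IsActivatedAbove θ₀ Y k) {T δ : ℝ} (hT : 0 ≤ T)
    (hδ : 0 < δ) :
    ∃ ε₀ > 0, ∀ ε, 0 < ε → ε < ε₀ → ∀ y θ, IsSlowFast θ₀ ε E k T y θ → ∀ t ∈ Icc 0 T,
      2 * δ ≤ y t → firstHit θ₀ Y (y t - 2 * δ) ≤ θ t := by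
  obtain ⟨A, -, hA⟩ := hC.exists_clock_eq hT
  set M := firstHit θ₀ Y A with hM
  set B := E M with hB
  have hB1 : 1 ≤ B := hC.one_le_speed A
  have hM0 : θ₀ ≤ M := (hC.firstHit_mem A).1
  obtain ⟨c, hc, hkc⟩ := hk.pos M δ hδ
  -- as `B` bounds the speed of `y`, the system would stay at least `δ` above the curve for the
  -- time `δ / B`, and `θ` would grow by `c / ε * (δ / B)`, more than `M - θ₀ + 1`
  refine ⟨c * (δ / B) / (M - θ₀ + 1), div_pos (by positivity) (by linarith), ?_⟩
  intro ε hε hεε y θ hs t ht hyt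
  by_contra! hlt
  have hyA : ∀ τ ∈ Icc 0 T, y τ ≤ A := by
    intro τ hτ
    have h1 := hs.clock_le hC hk hε hτ
    exact hC.clock_strictMono.le_iff_le.1 (hA ▸ h1.trans hτ.2)
  have hθM : ∀ τ ∈ Icc 0 T, θ τ ≤ M := fun τ hτ =>
    (hs.fast_le hC hk hε hτ).trans (hC.firstHit_mono (hyA τ hτ))
  have hgrow : ∀ τ, 0 ≤ τ → τ ≤ t → y t - y τ ≤ B * (t - τ) := fun τ h0 h1 =>
    sub_le_of_derivWithin_le hs.slow ⟨h0, h1.trans ht.2⟩ ht h1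
      (fun σ hσ => hC.mono (hθM σ ⟨h0.trans hσ.1, hσ.2.trans ht.2⟩))
  have hB0 : 0 < B := by linarith
  have ht1 : 0 ≤ t - δ / B := by
    have h1 := hgrow 0 le_rfl ht.1
    rw [hs.slow_init] at h1
    have : δ / B ≤ t := by
      rw [div_le_iff₀ hB0]
      linarith
    linarith
  have hdB : 0 < δ / B := by positivity
  have hmem : t - δ / B ∈ Icc 0 T := ⟨ht1, by linarith [ht.2]⟩
  have h2 := le_sub_of_le_derivWithin (C := ε⁻¹ * c) hs.fast hmem ht (by linarith) (by
    intro τ hτ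
    have hτT : τ ∈ Icc 0 T := ⟨ht1.trans hτ.1, hτ.2.trans ht.2⟩
    refine mul_le_mul_of_nonneg_left ?_ (inv_pos.2 hε).le
    have h3 := hC.lt_of_lt_firstHit (hs.init_le hk hε hτT)
      ((hs.fast_mono hk hε hτT ht hτ.2).trans_lt hlt)
    have h4 := hgrow τ hτT.1 hτ.2
    have h5 : B * (t - τ) ≤ δ := by
      have : t - τ ≤ δ / B := by linarith [hτ.1]
      rw [le_div_iff₀ hB0] at this
      linarith
    exact hkc _ ⟨hs.init_le hk hε hτT, hθM τ hτT⟩ _ (by linarith))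
  have h3 := hs.init_le hk hε hmem
  have h4 := hθM t ht
  have h5 : M - θ₀ + 1 < ε⁻¹ * c * (δ / B) := by
    rw [lt_div_iff₀ (by linarith)] at hεε
    rw [mul_assoc, inv_mul_eq_div, lt_div_iff₀ hε]
    linarith
  have h6 : t - (t - δ / B) = δ / B := by ring
  rw [h6] at h2
  linarith

/-- The solutions of the slow–fast systems converge, at every time, to an evolution in which the
slow variable is the inverse of the clock and the fast one follows the critical curve. -/
theorem IsCriticalCurve.exists_limit {θ₀ : ℝ} {E Y : ℝ → ℝ} (hC : IsCriticalCurve θ₀ E Y) :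
    ∃ y θ : ℝ → ℝ,
      (∀ t, 0 ≤ t → θ₀ ≤ θ t) ∧ MonotoneOn θ (Ici 0) ∧
      (∀ t, 0 ≤ t → ContinuousWithinAt y (Icc 0 t) t ∧ ContinuousWithinAt θ (Icc 0 t) t) ∧
      (∀ t, 0 ≤ t → t ≤ Y θ₀ → y t = t ∧ θ t = θ₀) ∧
      (∀ t, 0 ≤ t → Y θ₀ < t → Y (θ t) = y t) ∧
      ∀ k, IsActivatedAbove θ₀ Y k → ∀ T, 0 ≤ T → ∀ (ε : ℕ → ℝ) (yε θε : ℕ → ℝ → ℝ),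
        (∀ n, 0 < ε n) → Tendsto ε atTop (𝓝 0) →
        (∀ n, IsSlowFast θ₀ (ε n) E k T (yε n) (θε n)) →
        Tendsto (fun n => yε n T) atTop (𝓝 (y T)) ∧
          Tendsto (fun n => θε n T) atTop (𝓝 (θ T)) := by
  choose! y hy0 hy using fun (t : ℝ) (ht : 0 ≤ t) => hC.exists_clock_eq ht
  have hmono : ∀ a b, 0 ≤ a → a ≤ b → y a ≤ y b := by
    intro a b ha hab
    rw [← hC.clock_strictMono.le_iff_le, hy a ha, hy b (ha.trans hab)]
    exact hab
  -- the inverse of the clock is locally Lipschitz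
  have hlip : ∀ x b, 0 ≤ b → x ≤ y b →
      y b - x ≤ E (firstHit θ₀ Y (y b)) * (b - clock θ₀ E Y x) := by
    intro x b hb hxb
    have h1 := hC.le_clock_sub hxb
    have h2 := hC.one_le_speed (y b)
    rw [hy b hb, ← div_eq_mul_inv, div_le_iff₀ (by linarith)] at h1
    linarith
  have hcont : ∀ t, 0 ≤ t → ContinuousWithinAt y (Icc 0 t) t := by
    intro t ht
    have h1 : Tendsto (fun s => y t - E (firstHit θ₀ Y (y t)) * (t - s)) (𝓝[Icc 0 t] t)
        (𝓝 (y t)) := by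
      have : Continuous fun s => y t - E (firstHit θ₀ Y (y t)) * (t - s) := by fun_prop
      simpa using (this.tendsto t).mono_left nhdsWithin_le_nhds
    refine tendsto_of_tendsto_of_tendsto_of_le_of_le' h1 tendsto_const_nhds ?_ ?_
    · filter_upwards [self_mem_nhdsWithin] with s hs
      have h2 := hlip (y s) t ht (hmono s t hs.1 hs.2)
      rw [hy s hs.1] at h2
      linarith
    · filter_upwards [self_mem_nhdsWithin] with s hs
      exact hmono s t hs.1 hs.2
  refine ⟨y, fun t => firstHit θ₀ Y (y t), fun t _ => (hC.firstHit_mem _).1,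
    fun a ha b _ hab => hC.firstHit_mono (hmono a b ha hab), fun t ht => ⟨hcont t ht, ?_⟩, ?_, ?_,
    ?_⟩
  · refine tendsto_order.2 ⟨fun a ha => ?_, fun a ha => ?_⟩
    · obtain ⟨b, hb, hab⟩ := hC.exists_lt_firstHit ha
      filter_upwards [(hcont t ht).eventually_const_lt hb] with s hs
      exact hab _ hs.le
    · filter_upwards [self_mem_nhdsWithin] with s hs
      exact (hC.firstHit_mono (hmono s t hs.1 hs.2)).trans_lt ha
  · intro t ht htY
    have h1 : clock θ₀ E Y t = t := by
      refine le_antisymm ?_ ?_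
      · have := hC.clock_sub_le ht
        rw [clock_zero] at this
        linarith
      · have := hC.le_clock_sub ht
        rw [hC.firstHit_eq_init htY, hC.init, clock_zero] at this
        linarith
    have h2 : y t = t := hC.clock_strictMono.injective ((hy t ht).trans h1.symm)
    exact ⟨h2, by simpa only [h2] using hC.firstHit_eq_init htY⟩
  · intro t ht htY
    refine hC.curve_firstHit (htY.trans_le ?_)
    have h1 := hC.clock_sub_le (hy0 t ht)
    rw [clock_zero, hy t ht] at h1
    linarith
  intro k hk T hT ε yε θε hε hε0 hs
  have hTT : T ∈ Icc 0 T := right_mem_Icc.2 hT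
  have hup : ∀ n, yε n T ≤ y T := fun n => by
    rw [← hC.clock_strictMono.le_iff_le, hy T hT]
    exact (hs n).clock_le hC hk (hε n) hTT
  rcases hT.eq_or_lt with rfl | hTpos
  · have h0 : y 0 = 0 := hC.clock_strictMono.injective ((hy 0 le_rfl).trans clock_zero.symm)
    have h1 : firstHit θ₀ Y (y 0) = θ₀ := by
      obtain ⟨c, hc, hb⟩ := hC.bound
      have h1 := hb θ₀
      rw [hC.init] at h1
      exact hC.firstHit_eq_init (by rw [h0]; linarith)
    simp only [(hs _).slow_init, (hs _).fast_init, h0]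
    rw [h0] at h1
    simp [h1]
  set B := E (firstHit θ₀ Y (y T)) with hB
  have hB1 : 1 ≤ B := hC.one_le_speed _
  -- from time `2 * δ` on, the slow variable lowered by `2 * δ` moves at least as fast as the limit
  have hlow : ∀ δ, 0 < δ → 2 * δ ≤ T → ∀ᶠ n in atTop,
      y T - 2 * δ * B ≤ yε n T ∧ firstHit θ₀ Y (yε n T - 2 * δ) ≤ θε n T := by
    intro δ hδ hδT
    obtain ⟨ε₀, hε₀, hcat⟩ := hC.exists_firstHit_le_fast hk hT hδ
    filter_upwards [hε0.eventually_lt_const hε₀] with n hn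
    have hcat' := hcat (ε n) (hε n) hn _ _ (hs n)
    have hsub : Icc (2 * δ) T ⊆ Icc 0 T := Icc_subset_Icc (by linarith) le_rfl
    have hys : ∀ t ∈ Icc (2 * δ) T, 2 * δ ≤ yε n t := fun t ht =>
      ht.1.trans ((hs n).le_slow hC hk (hε n) (hsub ht))
    have h1 := hC.le_clock_comp (c := 2 * δ) hδT
      (fun τ hτ => ((hs n).slow τ (hsub hτ)).mono hsub)
      (((hs n).strictMonoOn_slow hC hk (hε n)).mono hsub)
      (fun τ hτ => hC.mono (hcat' τ (hsub hτ) (hys τ hτ)))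
    have h2 : 0 ≤ clock θ₀ E Y (yε n (2 * δ) - 2 * δ) := by
      rw [← clock_zero (θ₀ := θ₀) (E := E) (Y := Y)]
      exact hC.clock_strictMono.monotone (by linarith [hys _ (left_mem_Icc.2 hδT)])
    have h3 := hlip (yε n T - 2 * δ) T hT (by linarith [hup n])
    have h4 : B * (T - clock θ₀ E Y (yε n T - 2 * δ)) ≤ B * (2 * δ) :=
      mul_le_mul_of_nonneg_left (by linarith) (by linarith)
    exact ⟨by linarith, hcat' T hTT (hys T (right_mem_Icc.2 hδT))⟩
  have hsmall : ∀ x, x < y T → ∃ δ, 0 < δ ∧ 2 * δ ≤ T ∧ x < y T - 2 * δ * B - 2 * δ := by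
    intro x hx
    have h1 : Tendsto (fun δ => y T - 2 * δ * B - 2 * δ) (𝓝[>] 0) (𝓝 (y T)) := by
      have : Continuous fun δ => y T - 2 * δ * B - 2 * δ := by fun_prop
      simpa using (this.tendsto 0).mono_left nhdsWithin_le_nhds
    obtain ⟨δ, h2, h3⟩ := ((h1.eventually_const_lt hx).and
      (Ioc_mem_nhdsGT (show (0 : ℝ) < T / 2 by linarith))).exists
    exact ⟨δ, h3.1, by linarith [h3.2], h2⟩
  constructor
  · refine tendsto_order.2 ⟨fun a ha => ?_, fun a ha => ?_⟩
    · obtain ⟨δ, h1, h2, h3⟩ := hsmall a ha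
      filter_upwards [hlow δ h1 h2] with n hn
      linarith [hn.1]
    · exact Eventually.of_forall fun n => (hup n).trans_lt ha
  · refine tendsto_order.2 ⟨fun a ha => ?_, fun a ha => ?_⟩
    · obtain ⟨b, hb, hab⟩ := hC.exists_lt_firstHit ha
      obtain ⟨δ, h1, h2, h3⟩ := hsmall b hb
      filter_upwards [hlow δ h1 h2] with n hn
      exact (hab _ (by linarith [hn.1])).trans_le hn.2
    · exact Eventually.of_forall fun n => ((hs n).fast_le hC hk (hε n) hTT).trans_lt
        ((hC.firstHit_mono (hup n)).trans_lt ha)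

/-! ### The projection onto the unit ball -/

section Residual

variable {F : Type*} [NormedAddCommGroup F] [InnerProductSpace ℝ F]

/-- The projection onto the closed unit ball. -/
def ballProj (q : F) : F := (max 1 ‖q‖)⁻¹ • q

/-- The residual `q - P q` of the projection `P` onto the closed unit ball. -/
def ballResidual (q : F) : F := (1 - (max 1 ‖q‖)⁻¹) • q

theorem ballResidual_eq (q : F) : ballResidual q = q - ballProj q := by
  simp [ballResidual, ballProj, sub_smul]

theorem norm_ballProj_le (q : F) : ‖ballProj q‖ ≤ 1 := by
  have h : 0 < max 1 ‖q‖ := by positivity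
  rw [ballProj, norm_smul, norm_inv, Real.norm_of_nonneg h.le, inv_mul_eq_div, div_le_one h]
  exact le_max_right _ _

/-- The variational inequality that characterizes the projection. -/
theorem inner_ballResidual_le (q s : F) (hs : ‖s‖ ≤ 1) :
    inner ℝ (q - ballProj q) (s - ballProj q) ≤ 0 := by
  rcases le_total ‖q‖ 1 with h | h
  · simp [ballProj, max_eq_left h]
  · have h0 : ‖q‖ ≠ 0 := by linarith
    have h1 : ‖ballProj q‖ = 1 := by
      rw [ballProj, max_eq_right h, norm_smul, norm_inv, norm_norm, inv_mul_cancel₀ h0]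
    have h2 : q = ‖q‖ • ballProj q := by
      rw [ballProj, max_eq_right h, smul_smul, mul_inv_cancel₀ h0, one_smul]
    have h3 : q - ballProj q = (‖q‖ - 1) • ballProj q := by
      conv_lhs => enter [1]; rw [h2]
      rw [sub_smul, one_smul]
    rw [h3, inner_smul_left, inner_sub_right, real_inner_self_eq_norm_sq, h1]
    have h4 : inner ℝ (ballProj q) s ≤ 1 := by
      refine (real_inner_le_norm _ _).trans ?_
      rw [h1, one_mul]
      exact hs
    simp only [conj_trivial]
    nlinarith

theorem lipschitzWith_ballProj : LipschitzWith 1 (ballProj : F → F) := by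
  refine LipschitzWith.of_dist_le_mul fun a b => ?_
  rw [dist_eq_norm, dist_eq_norm, NNReal.coe_one, one_mul]
  have h1 := inner_ballResidual_le a (ballProj b) (norm_ballProj_le b)
  have h2 := inner_ballResidual_le b (ballProj a) (norm_ballProj_le a)
  have h3 : inner ℝ (a - b) (ballProj a - ballProj b) =
      ‖ballProj a - ballProj b‖ ^ 2 - inner ℝ (a - ballProj a) (ballProj b - ballProj a)
        - inner ℝ (b - ballProj b) (ballProj a - ballProj b) := by
    rw [← real_inner_self_eq_norm_sq]
    simp only [inner_sub_left, inner_sub_right]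
    ring
  have h4 := real_inner_le_norm (a - b) (ballProj a - ballProj b)
  by_contra! h5
  have h6 : 0 < ‖ballProj a - ballProj b‖ := (norm_nonneg _).trans_lt h5
  nlinarith

theorem norm_ballResidual_sub_le (a b : F) : ‖ballResidual a - ballResidual b‖ ≤ 2 * ‖a - b‖ := by
  have h1 := lipschitzWith_ballProj.dist_le_mul a b
  rw [dist_eq_norm, dist_eq_norm, NNReal.coe_one, one_mul] at h1
  calc ‖ballResidual a - ballResidual b‖ = ‖(a - b) - (ballProj a - ballProj b)‖ := by
        rw [ballResidual_eq, ballResidual_eq]; congr 1; abel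
    _ ≤ ‖a - b‖ + ‖ballProj a - ballProj b‖ := norm_sub_le _ _
    _ ≤ 2 * ‖a - b‖ := by linarith

theorem lipschitzWith_ballResidual : LipschitzWith 2 (ballResidual : F → F) :=
  LipschitzWith.of_dist_le_mul fun a b => by
    simpa [dist_eq_norm] using norm_ballResidual_sub_le a b

end Residual

theorem mem_unitBall_iff {d : ℕ} (q : DevR d) : q ∈ unitBall d ↔ ‖q‖ ≤ 1 := by
  rw [← sq_le_one_iff₀ (norm_nonneg q), WithLp.prod_norm_sq_eq_of_L2]
  simp [unitBall]

theorem flowMap_unitBall {d : ℕ} (ε : ℝ) (q : DevR d) :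
    flowMap (unitBall d) ε q = ε⁻¹ • ballResidual q := by
  have hpyth : ∀ s ∈ unitBall d, ‖q - ballProj q‖ ^ 2 + ‖ballProj q - s‖ ^ 2 ≤ ‖q - s‖ ^ 2 := by
    intro s hs
    have h1 := inner_ballResidual_le q s ((mem_unitBall_iff s).1 hs)
    have h2 : q - s = (q - ballProj q) - (s - ballProj q) := by abel
    rw [h2, norm_sub_sq_real (q - ballProj q), norm_sub_rev s]
    linarith
  have hproj : projK (unitBall d) q = ballProj q := by
    have hmem : ballProj q ∈ unitBall d := (mem_unitBall_iff _).2 (norm_ballProj_le q)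
    have hex : ∃ r, r ∈ unitBall d ∧ ∀ s ∈ unitBall d, ‖q - r‖ ≤ ‖q - s‖ :=
      ⟨ballProj q, hmem, fun s hs => by
        rw [← sq_le_sq₀ (norm_nonneg _) (norm_nonneg _)]
        nlinarith [hpyth s hs, sq_nonneg ‖ballProj q - s‖]⟩
    obtain ⟨h1, h2⟩ := Classical.epsilon_spec hex
    have h3 := hpyth _ h1
    have h4 := pow_le_pow_left₀ (norm_nonneg _) (h2 _ hmem) 2
    have h5 : ‖ballProj q - projK (unitBall d) q‖ ^ 2 ≤ 0 := by
      rw [projK]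
      linarith
    have h6 := pow_eq_zero_iff two_ne_zero |>.1 (le_antisymm h5 (sq_nonneg _))
    rw [norm_eq_zero, sub_eq_zero] at h6
    exact h6.symm
  rw [flowMap, hproj, ballResidual_eq]

/-! ### The softening slope -/

/-- The function `-V'` for the softening potential `V`. -/
def softSlope (θ : ℝ) : ℝ := θ / (2 * √(1 + θ ^ 2))

theorem sqrt_one_add_sq_pos (θ : ℝ) : 0 < √(1 + θ ^ 2) := Real.sqrt_pos.2 (by positivity)

theorem hasDerivAt_sqrt_one_add_sq (θ : ℝ) :
    HasDerivAt (fun θ : ℝ => √(1 + θ ^ 2)) (θ / √(1 + θ ^ 2)) θ := by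
  have h1 : HasDerivAt (fun θ : ℝ => 1 + θ ^ 2) (2 * θ) θ := by
    simpa using (hasDerivAt_pow 2 θ).const_add 1
  convert h1.sqrt (by positivity) using 1
  field_simp

theorem deriv_softV (θ : ℝ) : deriv softV θ = - softSlope θ := by
  have h2 : HasDerivAt softV (-(1 / 2 * (θ / √(1 + θ ^ 2)))) θ :=
    ((hasDerivAt_sqrt_one_add_sq θ).const_mul (1 / 2)).const_sub (1 / 2)
  rw [h2.deriv, softSlope]
  have := sqrt_one_add_sq_pos θ
  field_simp

theorem hasDerivAt_softSlope (θ : ℝ) :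
    HasDerivAt softSlope (1 / (2 * √(1 + θ ^ 2) * (1 + θ ^ 2))) θ := by
  have h0 := sqrt_one_add_sq_pos θ
  have h1 := (hasDerivAt_id θ).div ((hasDerivAt_sqrt_one_add_sq θ).const_mul 2) (by positivity)
  refine h1.congr_deriv ?_
  have h2 : √(1 + θ ^ 2) ^ 2 = 1 + θ ^ 2 := Real.sq_sqrt (by positivity)
  simp only [id]
  have h3 : (1 * (2 * √(1 + θ ^ 2)) - θ * (2 * (θ / √(1 + θ ^ 2)))) * √(1 + θ ^ 2) = 2 := by
    field_simp
    rw [h2]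
    ring
  have h4 : 1 * (2 * √(1 + θ ^ 2)) - θ * (2 * (θ / √(1 + θ ^ 2))) = 2 / √(1 + θ ^ 2) := by
    rw [eq_div_iff h0.ne']
    exact h3
  rw [h4, mul_pow, h2]
  field_simp

theorem continuous_softSlope : Continuous softSlope :=
  continuous_iff_continuousAt.2 fun θ => (hasDerivAt_softSlope θ).continuousAt

theorem lipschitzWith_softSlope : LipschitzWith 1 softSlope := by
  refine lipschitzWith_of_nnnorm_deriv_le (fun θ => (hasDerivAt_softSlope θ).differentiableAt)
    fun θ => ?_
  rw [(hasDerivAt_softSlope θ).deriv, ← NNReal.coe_le_coe, coe_nnnorm, NNReal.coe_one]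
  have h0 : 1 ≤ √(1 + θ ^ 2) := Real.one_le_sqrt.2 (by nlinarith [sq_nonneg θ])
  rw [Real.norm_of_nonneg (by positivity), div_le_one (by positivity)]
  nlinarith [sq_nonneg θ]

theorem abs_softSlope_le (θ : ℝ) : |softSlope θ| ≤ 1 / 2 := by
  have h0 := sqrt_one_add_sq_pos θ
  have h1 : |θ| ≤ √(1 + θ ^ 2) := by
    rw [← Real.sqrt_sq_eq_abs]
    exact Real.sqrt_le_sqrt (by linarith)
  rw [softSlope, abs_div, abs_of_pos (show 0 < 2 * √(1 + θ ^ 2) by positivity),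
    div_le_div_iff₀ (by positivity) (by norm_num)]
  linarith

theorem softSlope_pos {θ : ℝ} (h : 0 < θ) : 0 < softSlope θ :=
  div_pos h (mul_pos two_pos (sqrt_one_add_sq_pos θ))

theorem softSlope_sq_le (θ : ℝ) : softSlope θ ^ 2 ≤ 1 / 4 := by
  rw [← sq_abs]
  nlinarith [abs_softSlope_le θ, abs_nonneg (softSlope θ)]

section

variable {μ r θ₀ : ℝ}

theorem elasticLimit_eq (μ r θ : ℝ) :
    elasticLimit μ r θ = 1 / (2 * μ * r) * √(1 - softSlope θ ^ 2) := by
  rw [elasticLimit, deriv_softV, neg_sq]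

theorem continuous_elasticLimit (μ r : ℝ) : Continuous (elasticLimit μ r) := by
  have := continuous_softSlope
  simp only [funext (elasticLimit_eq μ r)]
  fun_prop

theorem elasticLimit_pos_bound (hμ : 0 < μ) (hr : 0 < r) (θ : ℝ) :
    1 / (4 * μ * r) ≤ elasticLimit μ r θ := by
  have h1 : 1 / 2 ≤ √(1 - softSlope θ ^ 2) :=
    Real.le_sqrt_of_sq_le (by linarith [softSlope_sq_le θ])
  rw [elasticLimit_eq]
  calc 1 / (4 * μ * r) = 1 / (2 * μ * r) * (1 / 2) := by field_simp; norm_num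
    _ ≤ _ := mul_le_mul_of_nonneg_left h1 (by positivity)

/-- At the elastic limit the stress lies on the unit sphere. -/
theorem sq_elasticLimit (hμ : 0 < μ) (hr : 0 < r) (θ : ℝ) :
    (2 * μ * r * elasticLimit μ r θ) ^ 2 + softSlope θ ^ 2 = 1 := by
  have h : 2 * μ * r * elasticLimit μ r θ = √(1 - softSlope θ ^ 2) := by
    rw [elasticLimit_eq]
    field_simp
  rw [h, Real.sq_sqrt (by linarith [softSlope_sq_le θ])]
  ring

/-! ### The homogeneous regularized evolution -/

/-- The factor `1 - 1 / max (1, |(σ, ζ)|)` by which a stress `(σ, ζ)` with `|σ| = 2 μ r s` and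
`ζ = -V'(θ)` has to be multiplied to obtain its residual with respect to the unit ball. -/
def overstress (μ r s θ : ℝ) : ℝ := 1 - (max 1 √((2 * μ * r * s) ^ 2 + softSlope θ ^ 2))⁻¹

theorem overstress_nonneg (μ r s θ : ℝ) : 0 ≤ overstress μ r s θ := by
  rw [overstress, sub_nonneg]
  exact inv_le_one_of_one_le₀ (le_max_left _ _)

theorem overstress_le_one (μ r s θ : ℝ) : overstress μ r s θ ≤ 1 := by
  rw [overstress]
  have : 0 ≤ (max 1 √((2 * μ * r * s) ^ 2 + softSlope θ ^ 2))⁻¹ := by positivity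
  linarith

theorem overstress_eq_zero {μ r s θ : ℝ} (h : (2 * μ * r * s) ^ 2 + softSlope θ ^ 2 ≤ 1) :
    overstress μ r s θ = 0 := by
  rw [overstress, max_eq_left (Real.sqrt_le_one.2 h)]
  norm_num

theorem overstress_ge {μ r s θ ρ : ℝ} (hρ : 1 ≤ ρ)
    (h : ρ ^ 2 ≤ (2 * μ * r * s) ^ 2 + softSlope θ ^ 2) : 1 - ρ⁻¹ ≤ overstress μ r s θ := by
  rw [overstress]
  have h1 : ρ ≤ max 1 √((2 * μ * r * s) ^ 2 + softSlope θ ^ 2) :=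
    (Real.le_sqrt_of_sq_le h).trans (le_max_right _ _)
  have h2 := inv_anti₀ (by linarith) h1
  linarith

/-- The homogeneous regularized evolution on `[0, T]`: `s` is the ratio of the elastic strain to the
strain rate, and `θ` the internal variable. -/
structure IsHomogeneous (μ r θ₀ ε T : ℝ) (s θ : ℝ → ℝ) : Prop where
  init_s : s 0 = 0
  init_θ : θ 0 = θ₀
  nonneg : ∀ t ∈ Icc 0 T, 0 ≤ s t
  init_le : ∀ t ∈ Icc 0 T, θ₀ ≤ θ t
  deriv_s : ∀ t ∈ Icc 0 T, HasDerivWithinAt s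
    (1 - ε⁻¹ * (overstress μ r (s t) (θ t) * (2 * μ * s t))) (Icc 0 T) t
  deriv_θ : ∀ t ∈ Icc 0 T, HasDerivWithinAt θ
    (ε⁻¹ * (overstress μ r (s t) (θ t) * softSlope (θ t))) (Icc 0 T) t

/-- In the absence of loading, the elastic strain decays by this factor while the internal variable
grows from `θ₀` to `θ`. The inner `max` continues the function to `θ < θ₀`. -/
def decay (μ θ₀ θ : ℝ) : ℝ := Real.exp (2 * μ * ∫ τ in θ₀..θ, (softSlope (max θ₀ τ))⁻¹)

theorem continuous_inv_softSlope_max (hθ₀ : 0 < θ₀) :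
    Continuous fun τ => (softSlope (max θ₀ τ))⁻¹ :=
  (continuous_softSlope.comp (continuous_const.max continuous_id)).inv₀
    fun _ => (softSlope_pos (hθ₀.trans_le (le_max_left _ _))).ne'

theorem hasDerivAt_decay (μ : ℝ) (hθ₀ : 0 < θ₀) (θ : ℝ) :
    HasDerivAt (decay μ θ₀) (decay μ θ₀ θ * (2 * μ * (softSlope (max θ₀ θ))⁻¹)) θ := by
  have hc := continuous_inv_softSlope_max hθ₀
  exact ((intervalIntegral.integral_hasDerivAt_right (hc.intervalIntegrable _ _)
    (hc.stronglyMeasurableAtFilter _ _) hc.continuousAt).const_mul (2 * μ)).exp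

theorem decay_pos (μ θ₀ θ : ℝ) : 0 < decay μ θ₀ θ := Real.exp_pos _

/-- The critical curve of the example in the variables `(θ, y)`, `y = s * decay θ`, in which the
regularized evolution is a slow–fast system. -/
theorem isCriticalCurve_decay (hμ : 0 < μ) (hr : 0 < r) (hθ₀ : 0 < θ₀) :
    IsCriticalCurve θ₀ (decay μ θ₀) (fun θ => decay μ θ₀ θ * elasticLimit μ r θ) := by
  have hcont : Continuous (decay μ θ₀) :=
    continuous_iff_continuousAt.2 fun θ => (hasDerivAt_decay μ hθ₀ θ).continuousAt
  refine ⟨?_, hcont, by simp [decay], ?_, hcont.mul (continuous_elasticLimit μ r),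
    1 / (4 * μ * r), by positivity, fun θ => ?_⟩
  · refine monotone_of_hasDerivAt_nonneg (hasDerivAt_decay μ hθ₀) fun θ => ?_
    have h1 := softSlope_pos (hθ₀.trans_le (le_max_left θ₀ θ))
    have h2 := decay_pos μ θ₀ θ
    simp only [Pi.zero_apply]
    positivity
  · refine Real.tendsto_exp_atTop.comp ?_
    refine tendsto_atTop_mono' _ (f₁ := fun θ => 2 * μ * (2 * (θ - θ₀))) ?_ ?_
    · filter_upwards [eventually_ge_atTop θ₀] with θ hθ
      refine mul_le_mul_of_nonneg_left ?_ (by positivity)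
      have := intervalIntegral.integral_mono_on hθ
        (intervalIntegrable_const (μ := volume) (c := (2 : ℝ)))
        ((continuous_inv_softSlope_max hθ₀).intervalIntegrable _ _) (fun τ _ => by
          have h1 := softSlope_pos (hθ₀.trans_le (le_max_left θ₀ τ))
          have h2 := (le_abs_self _).trans (abs_softSlope_le (max θ₀ τ))
          rw [le_inv_comm₀ two_pos h1]
          linarith)
      simp only [intervalIntegral.integral_const, smul_eq_mul] at this
      linarith
    · refine Tendsto.const_mul_atTop (by positivity) (Tendsto.const_mul_atTop two_pos ?_)
      exact tendsto_atTop_add_const_right _ _ tendsto_id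
  · rw [mul_comm]
    exact mul_le_mul_of_nonneg_left (elasticLimit_pos_bound hμ hr θ) (decay_pos _ _ _).le

/-- The rate of the internal variable of the example, in the variables `(θ, y)`. The `max` and the
absolute value, inactive along solutions, make it nonnegative everywhere. -/
def fastRate (μ r θ₀ θ y : ℝ) : ℝ :=
  overstress μ r (max 0 (y / decay μ θ₀ θ)) θ * |softSlope θ|

theorem isActivatedAbove_fastRate (hμ : 0 < μ) (hr : 0 < r) (hθ₀ : 0 < θ₀) :
    IsActivatedAbove θ₀ (fun θ => decay μ θ₀ θ * elasticLimit μ r θ) (fastRate μ r θ₀) := by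
  have hG : ∀ θ, 0 < elasticLimit μ r θ := fun θ =>
    lt_of_lt_of_le (by positivity) (elasticLimit_pos_bound hμ hr θ)
  refine ⟨fun θ y => mul_nonneg (overstress_nonneg _ _ _ _) (abs_nonneg _), ?_, ?_⟩
  · intro θ y hy
    have h1 : max 0 (y / decay μ θ₀ θ) ≤ elasticLimit μ r θ := by
      refine max_le (hG θ).le ?_
      rw [div_le_iff₀ (decay_pos _ _ _)]
      linarith
    have h0 : 0 ≤ max 0 (y / decay μ θ₀ θ) := le_max_left _ _
    have h2 : (2 * μ * r * max 0 (y / decay μ θ₀ θ)) ^ 2 ≤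
        (2 * μ * r * elasticLimit μ r θ) ^ 2 := by gcongr
    rw [fastRate, overstress_eq_zero, zero_mul]
    linarith [sq_elasticLimit hμ hr θ]
  · intro A δ hδ
    set B := decay μ θ₀ A with hB
    have hB0 : 0 < B := decay_pos _ _ _
    set ρ := √(1 + (2 * μ * r * (δ / B)) ^ 2) with hρ
    have hρ1 : 1 < ρ := by
      rw [hρ]
      refine Real.lt_sqrt_of_sq_lt ?_
      have : 0 < (2 * μ * r * (δ / B)) ^ 2 := by positivity
      linarith
    refine ⟨(1 - ρ⁻¹) * (θ₀ / (2 * √(1 + A ^ 2))), ?_, ?_⟩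
    · have := inv_lt_one_of_one_lt₀ hρ1
      have h2 := sqrt_one_add_sq_pos A
      exact mul_pos (by linarith) (by positivity)
    intro θ hθ y hy
    have hθpos : 0 < θ := hθ₀.trans_le hθ.1
    have hE := decay_pos μ θ₀ θ
    have h1 : elasticLimit μ r θ + δ / B ≤ y / decay μ θ₀ θ := by
      have h2 : δ / B ≤ δ / decay μ θ₀ θ :=
        div_le_div_of_nonneg_left hδ.le hE ((isCriticalCurve_decay hμ hr hθ₀).mono hθ.2)
      refine (add_le_add_right h2 _).trans ?_
      rw [le_div_iff₀ hE, add_mul, div_mul_cancel₀ _ hE.ne']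
      linarith
    refine mul_le_mul (overstress_ge hρ1.le ?_) ?_ ?_ (overstress_nonneg _ _ _ _)
    · rw [hρ, Real.sq_sqrt (by positivity)]
      have h3 : 2 * μ * r * (elasticLimit μ r θ + δ / B) ≤
          2 * μ * r * max 0 (y / decay μ θ₀ θ) :=
        mul_le_mul_of_nonneg_left (h1.trans (le_max_right _ _)) (by positivity)
      have h4 : 0 < 2 * μ * r * elasticLimit μ r θ := mul_pos (by positivity) (hG θ)
      have h5 : 0 < 2 * μ * r * (δ / B) := by positivity
      have h6 : (2 * μ * r * elasticLimit μ r θ) ^ 2 + (2 * μ * r * (δ / B)) ^ 2 ≤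
          (2 * μ * r * max 0 (y / decay μ θ₀ θ)) ^ 2 := by nlinarith
      linarith [sq_elasticLimit hμ hr θ]
    · rw [abs_of_pos (softSlope_pos hθpos), softSlope]
      have h2 := sqrt_one_add_sq_pos θ
      have h3 : √(1 + θ ^ 2) ≤ √(1 + A ^ 2) := Real.sqrt_le_sqrt (by nlinarith [hθ.2])
      exact div_le_div₀ hθpos.le hθ.1 (by positivity) (by linarith)
    · have h2 := sqrt_one_add_sq_pos A
      positivity

/-- In the variables `(θ, s * decay θ)` the homogeneous evolution is a slow–fast system: the terms
of order `1 / ε` in the derivative of `s * decay θ` cancel. -/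
theorem IsHomogeneous.isSlowFast {ε T : ℝ} {s θ : ℝ → ℝ} (hθ₀ : 0 < θ₀)
    (h : IsHomogeneous μ r θ₀ ε T s θ) :
    IsSlowFast θ₀ ε (decay μ θ₀) (fastRate μ r θ₀) T (fun t => s t * decay μ θ₀ (θ t)) θ := by
  have hk : ∀ t ∈ Icc 0 T, fastRate μ r θ₀ (θ t) (s t * decay μ θ₀ (θ t)) =
      overstress μ r (s t) (θ t) * softSlope (θ t) := fun t ht => by
    rw [fastRate, mul_div_cancel_right₀ _ (decay_pos _ _ _).ne', max_eq_right (h.nonneg t ht),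
      abs_of_pos (softSlope_pos (hθ₀.trans_le (h.init_le t ht)))]
  refine ⟨by simp [h.init_s], h.init_θ, fun t ht => ?_, fun t ht => ?_⟩
  · have h1 := (h.deriv_s t ht).mul
      ((hasDerivAt_decay μ hθ₀ (θ t)).comp_hasDerivWithinAt t (h.deriv_θ t ht))
    refine h1.congr_deriv ?_
    rw [max_eq_right (h.init_le t ht)]
    have := (softSlope_pos (hθ₀.trans_le (h.init_le t ht))).ne'
    field_simp
    simp only [Function.comp_apply]
    ring
  · rw [hk t ht]
    exact h.deriv_θ t ht

/-- A bounded Lipschitz autonomous field on a Banach space has global solutions. -/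
theorem exists_solution_of_lipschitz_of_bounded {X : Type*} [NormedAddCommGroup X]
    [NormedSpace ℝ X] [CompleteSpace X] {f : X → X} {K L : NNReal} (hf : LipschitzWith K f)
    (hL : ∀ x, ‖f x‖ ≤ L) (x₀ : X) {T : ℝ} (hT : 0 ≤ T) :
    ∃ α : ℝ → X, α 0 = x₀ ∧ ∀ t ∈ Icc 0 T, HasDerivWithinAt α (f (α t)) (Icc 0 T) t := by
  have hP : IsPicardLindelof (fun _ => f) (⟨0, left_mem_Icc.2 hT⟩ : Icc 0 T) x₀
      (L * T.toNNReal) 0 L K :=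
    IsPicardLindelof.of_time_independent (fun x _ => hL x) (hf.lipschitzOnWith) (by
      simp [Real.coe_toNNReal T hT, max_eq_left hT])
  exact hP.exists_eq_forall_mem_Icc_hasDerivWithinAt₀

/-- The homogeneous regularized evolution exists. The field is made bounded by clamping `s` to
`[0, T]`, an interval that the solution does not leave. -/
theorem exists_isHomogeneous (hμ : 0 < μ) (hr : 0 < r) (hθ₀ : 0 < θ₀) {ε T : ℝ} (hε : 0 < ε)
    (hT : 0 ≤ T) : ∃ s θ : ℝ → ℝ, IsHomogeneous μ r θ₀ ε T s θ := by
  let c : ℝ → ℝ := fun s => max 0 (min s T)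
  have hc0 : ∀ s, 0 ≤ c s := fun s => le_max_left _ _
  have hcT : ∀ s, c s ≤ T := fun s => max_le hT (min_le_right _ _)
  let q : ℝ × ℝ → WithLp 2 (ℝ × ℝ) := fun v =>
    WithLp.toLp 2 (2 * μ * r * c v.1, |softSlope v.2|)
  let N : ℝ × ℝ → ℝ := fun v => overstress μ r (c v.1) v.2
  let f : ℝ × ℝ → ℝ × ℝ := fun v =>
    (1 - ε⁻¹ * (N v * (2 * μ * c v.1)), ε⁻¹ * (N v * |softSlope v.2|))
  have hq : ∃ K, LipschitzWith K q := by
    have hc : LipschitzWith 1 c := (LipschitzWith.id.min_const T).const_max 0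
    have h1 : LipschitzWith (‖2 * μ * r‖₊ * (1 * 1)) fun v : ℝ × ℝ => (2 * μ * r) • c v.1 :=
      (lipschitzWith_smul (2 * μ * r)).comp (hc.comp LipschitzWith.prod_fst)
    have h2 : LipschitzWith (1 * (1 * 1)) fun v : ℝ × ℝ => ‖softSlope v.2‖ :=
      lipschitzWith_one_norm.comp (lipschitzWith_softSlope.comp LipschitzWith.prod_snd)
    exact ⟨_, (WithLp.prodContinuousLinearEquiv 2 ℝ ℝ ℝ).symm.lipschitz.comp (h1.prodMk h2)⟩
  have hqN : ∀ v, ballResidual (q v) = N v • q v := by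
    intro v
    rw [ballResidual, WithLp.prod_norm_eq_of_L2]
    simp only [N, overstress, q, WithLp.toLp_fst, WithLp.toLp_snd, Real.norm_eq_abs, sq_abs]
  obtain ⟨Kq, hKq⟩ := hq
  -- the field is an affine function of the residual of the stress, and hence Lipschitz
  have hf : ∃ K, LipschitzWith K f := by
    let L : WithLp 2 (ℝ × ℝ) →L[ℝ] ℝ × ℝ :=
      ((-(ε⁻¹ * r⁻¹)) • WithLp.fstL 2 ℝ ℝ ℝ).prod (ε⁻¹ • WithLp.sndL 2 ℝ ℝ ℝ)
    have hfL : f = fun v => ((1 : ℝ), (0 : ℝ)) + L (ballResidual (q v)) := by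
      funext v
      rw [hqN]
      refine Prod.ext ?_ ?_
      · simp only [f, L, q, ContinuousLinearMap.prod_apply, _root_.smul_apply, WithLp.toLp_fst,
          WithLp.fstL_apply, WithLp.sndL_apply, WithLp.smul_fst, WithLp.smul_snd, smul_eq_mul,
          Prod.fst_add]
        field_simp
        ring
      · simp [f, L, q]
        ring
    rw [hfL]
    exact ⟨_, (LipschitzWith.const ((1 : ℝ), (0 : ℝ))).add
      (L.lipschitz.comp (lipschitzWith_ballResidual.comp hKq))⟩
  obtain ⟨K, hK⟩ := hf
  have hN0 : ∀ v, 0 ≤ N v := fun v => overstress_nonneg _ _ _ _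
  have hN1 : ∀ v, N v ≤ 1 := fun v => overstress_le_one _ _ _ _
  have hfb : ∀ v, ‖f v‖ ≤ 1 + ε⁻¹ * (2 * μ * T) + ε⁻¹ := by
    intro v
    have hε' : 0 < ε⁻¹ := inv_pos.2 hε
    have h1 : N v * (2 * μ * c v.1) ≤ 1 * (2 * μ * T) :=
      mul_le_mul (hN1 v) (mul_le_mul_of_nonneg_left (hcT _) (by positivity))
        (mul_nonneg (by positivity) (hc0 _)) zero_le_one
    have h2 : 0 ≤ N v * (2 * μ * c v.1) := mul_nonneg (hN0 v) (mul_nonneg (by positivity) (hc0 _))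
    have h3 : N v * |softSlope v.2| ≤ 1 * 1 :=
      mul_le_mul (hN1 v) (by linarith [abs_softSlope_le v.2]) (abs_nonneg _) zero_le_one
    have h4 : 0 ≤ N v * |softSlope v.2| := mul_nonneg (hN0 v) (abs_nonneg _)
    have h5 : 0 ≤ 2 * μ * T := by positivity
    refine max_le ?_ ?_
    · simp only [f, Real.norm_eq_abs, abs_le]
      constructor <;> nlinarith
    · simp only [f, Real.norm_eq_abs, abs_le]
      constructor <;> nlinarith
  have hL0 : 0 ≤ 1 + ε⁻¹ * (2 * μ * T) + ε⁻¹ := by positivity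
  obtain ⟨α, hα0, hα⟩ := exists_solution_of_lipschitz_of_bounded (L := ⟨_, hL0⟩) hK hfb
    ((0 : ℝ), θ₀) hT
  have hd1 : ∀ t ∈ Icc 0 T, HasDerivWithinAt (fun t => (α t).1) (f (α t)).1 (Icc 0 T) t :=
    fun t ht => (ContinuousLinearMap.fst ℝ ℝ ℝ).hasFDerivAt.comp_hasDerivWithinAt t (hα t ht)
  have hd2 : ∀ t ∈ Icc 0 T, HasDerivWithinAt (fun t => (α t).2) (f (α t)).2 (Icc 0 T) t :=
    fun t ht => (ContinuousLinearMap.snd ℝ ℝ ℝ).hasFDerivAt.comp_hasDerivWithinAt t (hα t ht)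
  have h0T : (0 : ℝ) ∈ Icc 0 T := left_mem_Icc.2 hT
  have hε' : 0 < ε⁻¹ := inv_pos.2 hε
  have hθ : ∀ t ∈ Icc 0 T, θ₀ ≤ (α t).2 := by
    intro t ht
    have := le_sub_of_le_derivWithin (C := 0) hd2 h0T ht ht.1
      (fun t _ => mul_nonneg hε'.le (mul_nonneg (hN0 _) (abs_nonneg _)))
    rw [hα0] at this
    linarith
  have hsT : ∀ t ∈ Icc 0 T, (α t).1 ≤ T := by
    intro t ht
    have := sub_le_of_derivWithin_le (C := 1) hd1 h0T ht ht.1 (fun t _ => by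
      have : 0 ≤ ε⁻¹ * (N (α t) * (2 * μ * c (α t).1)) :=
        mul_nonneg hε'.le (mul_nonneg (hN0 _) (mul_nonneg (by positivity) (hc0 _)))
      simp only [f]
      linarith)
    rw [hα0] at this
    linarith [ht.2]
  -- the clamping is inactive: for `s < 0` the clamped stress is interior and there is no flow
  have hcs : ∀ t ∈ Icc 0 T, N (α t) * (2 * μ * c (α t).1) = N (α t) * (2 * μ * (α t).1) := by
    intro t ht
    rcases le_total 0 (α t).1 with h | h
    · simp only [c, min_eq_left (hsT t ht), max_eq_right h]
    · have hc : c (α t).1 = 0 := by simp only [c, min_eq_left (hsT t ht), max_eq_left h]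
      have : N (α t) = 0 := overstress_eq_zero (by
        rw [hc]
        linarith [softSlope_sq_le (α t).2])
      rw [this, zero_mul, zero_mul]
  have habs : ∀ t ∈ Icc 0 T, |softSlope (α t).2| = softSlope (α t).2 := fun t ht =>
    abs_of_pos (softSlope_pos (hθ₀.trans_le (hθ t ht)))
  -- `s * decay θ` has the derivative `decay θ` and is therefore nondecreasing
  have hs0 : ∀ t ∈ Icc 0 T, 0 ≤ (α t).1 := by
    intro t ht
    have h1 := le_sub_of_le_derivWithin (C := 0)
      (fun t ht => (hd1 t ht).mul ((hasDerivAt_decay μ hθ₀ (α t).2).comp_hasDerivWithinAt t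
        (hd2 t ht))) h0T ht ht.1 (fun τ hτ => by
        have hτT : τ ∈ Icc 0 T := ⟨hτ.1, hτ.2.trans ht.2⟩
        have h2 := (softSlope_pos (hθ₀.trans_le (hθ τ hτT))).ne'
        refine (decay_pos μ θ₀ (α τ).2).le.trans_eq ?_
        simp only [f, Function.comp_apply, hcs τ hτT, habs τ hτT, max_eq_right (hθ τ hτT)]
        field_simp
        ring)
    simp only [Pi.mul_apply, Function.comp_apply, hα0, zero_mul, sub_zero] at h1
    exact nonneg_of_mul_nonneg_left h1 (decay_pos _ _ _)
  have hcc : ∀ t ∈ Icc 0 T, c (α t).1 = (α t).1 := fun t ht => by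
    simp only [c, min_eq_left (hsT t ht), max_eq_right (hs0 t ht)]
  refine ⟨fun t => (α t).1, fun t => (α t).2, by simp [hα0], by simp [hα0], hs0, hθ, ?_, ?_⟩
  · intro t ht
    have := hd1 t ht
    simp only [f, N, hcc t ht] at this
    exact this
  · intro t ht
    have := hd2 t ht
    simp only [f, N, hcc t ht, habs t ht] at this
    exact this

end

/-! ### Sobolev functions on a bounded open set -/

section Sobolev

variable {d : ℕ} {Ω : Set (Pt d)}

theorem isFiniteMeasure_volOn (hb : Bornology.IsBounded Ω) : IsFiniteMeasure (volOn Ω) :=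
  isFiniteMeasure_restrict.2 hb.measure_lt_top.ne

theorem IsTest.comp_apply {ι : Type*} [Fintype ι] {φ : Pt d → EuclideanSpace ℝ ι}
    (h : IsTest Ω φ) (i : ι) : IsTest Ω fun x => φ x i where
  smooth := (EuclideanSpace.proj (𝕜 := ℝ) i).contDiff.comp h.smooth
  compact := h.compact.comp_left (g := fun v : EuclideanSpace ℝ ι => v i) rfl
  support := (closure_mono (Function.support_comp_subset
    (g := fun v : EuclideanSpace ℝ ι => v i) rfl φ)).trans h.support

theorem IsTest.smul_const {F : Type*} [NormedAddCommGroup F] [NormedSpace ℝ F] {g : Pt d → ℝ}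
    (h : IsTest Ω g) (A : F) : IsTest Ω fun x => g x • A where
  smooth := h.smooth.smul contDiff_const
  compact := h.compact.smul_right (f' := fun _ => A)
  support := (tsupport_smul_subset_left g _).trans h.support

theorem IsTest.sq {g : Pt d → ℝ} (h : IsTest Ω g) : IsTest Ω fun x => g x ^ 2 where
  smooth := h.smooth.pow 2
  compact := h.compact.comp_left (g := fun v : ℝ => v ^ 2) (by simp)
  support := (closure_mono (Function.support_comp_subset
    (g := fun v : ℝ => v ^ 2) (by simp) g)).trans h.support

theorem fderiv_comp_apply {ι : Type*} [Fintype ι] {φ : Pt d → EuclideanSpace ℝ ι}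
    (h : IsTest Ω φ) (i : ι) (x v : Pt d) :
    fderiv ℝ (fun x => φ x i) x v = fderiv ℝ φ x v i := by
  have h1 : HasFDerivAt φ (fderiv ℝ φ x) x :=
    (h.smooth.differentiable (by simp)).differentiableAt.hasFDerivAt
  have h2 := (EuclideanSpace.proj (𝕜 := ℝ) i).hasFDerivAt.comp x h1
  exact DFunLike.congr_fun h2.fderiv v

/-- Integration by parts against a test function. -/
theorem setIntegral_mul_fderiv {f g : Pt d → ℝ} (hf : ContDiff ℝ ((⊤ : ℕ∞) : WithTop ℕ∞) f)
    (hg : IsTest Ω g) (v : Pt d) :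
    ∫ x in Ω, f x * fderiv ℝ g x v = - ∫ x in Ω, fderiv ℝ f x v * g x := by
  have hg' : Continuous fun x => fderiv ℝ g x v :=
    (hg.smooth.continuous_fderiv (by simp)).clm_apply continuous_const
  have hf' : Continuous fun x => fderiv ℝ f x v :=
    (hf.continuous_fderiv (by simp)).clm_apply continuous_const
  have hgs : HasCompactSupport fun x => fderiv ℝ g x v := hg.compact.fderiv_apply ℝ v
  have h0 : ∀ x, x ∉ Ω → g x = 0 := fun x hx =>
    image_eq_zero_of_notMem_tsupport fun h => hx (hg.support h)
  have h0' : ∀ x, x ∉ Ω → fderiv ℝ g x v = 0 := fun x hx => by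
    rw [fderiv_of_notMem_tsupport (𝕜 := ℝ) fun h => hx (hg.support h)]
    rfl
  rw [setIntegral_eq_integral_of_forall_compl_eq_zero (fun x hx => by rw [h0' x hx, mul_zero]),
    setIntegral_eq_integral_of_forall_compl_eq_zero (fun x hx => by rw [h0 x hx, mul_zero])]
  refine integral_mul_fderiv_eq_neg_fderiv_mul_of_integrable ?_ ?_ ?_
    (fun x _ => (hf.differentiable (by simp)).differentiableAt)
    (fun x _ => (hg.smooth.differentiable (by simp)).differentiableAt)
  · exact (hf'.mul hg.smooth.continuous).integrable_of_hasCompactSupport hg.compact.mul_left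
  · exact (hf.continuous.mul hg').integrable_of_hasCompactSupport hgs.mul_left
  · exact (hf.continuous.mul hg.smooth.continuous).integrable_of_hasCompactSupport
      hg.compact.mul_left

theorem contDiff_coord (i : Fin d) : ContDiff ℝ ((⊤ : ℕ∞) : WithTop ℕ∞) fun x : Pt d => x i :=
  (EuclideanSpace.proj (𝕜 := ℝ) i).contDiff

theorem fderiv_coord (i : Fin d) (x v : Pt d) : fderiv ℝ (fun x : Pt d => x i) x v = v i :=
  DFunLike.congr_fun (EuclideanSpace.proj (𝕜 := ℝ) i).hasFDerivAt.fderiv v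

theorem setIntegral_fderiv_eq_zero {g : Pt d → ℝ} (hg : IsTest Ω g) (v : Pt d) :
    ∫ x in Ω, fderiv ℝ g x v = 0 := by
  simpa using setIntegral_mul_fderiv (f := fun _ => (1 : ℝ)) contDiff_const hg v

/-- The weak gradient of the restriction of a linear map is its matrix. -/
theorem snd_ae_eq_of_fst_linear (ho : IsOpen Ω) (hb : Bornology.IsBounded Ω) (A : Mat d) (t : ℝ)
    (v : H1 Ω) (hv : v.1.fst =ᵐ[volOn Ω] fun x => t • mulPt A x) :
    v.1.snd =ᵐ[volOn Ω] fun _ => t • A := by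
  have := isFiniteMeasure_volOn hb
  have hcomp : ∀ ij : Fin d × Fin d, ∀ᵐ x ∂volOn Ω, v.1.snd x ij - t * A ij = 0 := by
    rintro ⟨i, j⟩
    have hmem : MemLp (fun x => v.1.snd x (i, j)) 2 (volOn Ω) :=
      (Lp.memLp v.1.snd).continuousLinearMap_comp (EuclideanSpace.proj (𝕜 := ℝ) (i, j))
    have hint : Integrable (fun x => v.1.snd x (i, j) - t * A (i, j)) (volOn Ω) :=
      (hmem.integrable (by norm_num)).sub (integrable_const _)
    have hloc : LocallyIntegrableOn (fun x => v.1.snd x (i, j) - t * A (i, j)) Ω volume :=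
      IntegrableOn.locallyIntegrableOn hint
    rw [ae_restrict_iff' ho.measurableSet]
    refine ho.ae_eq_zero_of_integral_contDiff_smul_eq_zero hloc fun g hg hgc hgs => ?_
    have htest : IsTest Ω g := ⟨hg, hgc, hgs⟩
    have hφ := htest.smul_const (EuclideanSpace.single (i, j) (1 : ℝ) : Mat d)
    have h1 := v.2 _ hφ
    have hdiv : ∀ x, matDiv (fun x => g x • (EuclideanSpace.single (i, j) (1 : ℝ) : Mat d)) x =
        EuclideanSpace.single i (fderiv ℝ g x (EuclideanSpace.single j 1)) := by
      intro x
      have hd : DifferentiableAt ℝ g x := (hg.differentiable (by simp)).differentiableAt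
      ext a
      simp only [matDiv]
      rw [fderiv_smul_const hd]
      by_cases ha : a = i
      · subst ha
        simp [ContinuousLinearMap.smulRight_apply, Prod.ext_iff, Finset.sum_ite_eq']
      · simp [ha, Prod.ext_iff]
    have h2 : ∫ x in Ω, inner ℝ (v.1.fst x)
        (matDiv (fun x => g x • (EuclideanSpace.single (i, j) (1 : ℝ) : Mat d)) x) =
        ∫ x in Ω, (t * ∑ k, A (i, k) * x k) * fderiv ℝ g x (EuclideanSpace.single j 1) := by
      refine integral_congr_ae ?_
      filter_upwards [hv] with x hx
      rw [hdiv, hx]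
      simp [EuclideanSpace.inner_single_right, mulPt, mul_comm]
    have hlin : ContDiff ℝ ((⊤ : ℕ∞) : WithTop ℕ∞) fun x : Pt d => t * ∑ k, A (i, k) * x k :=
      contDiff_const.mul (ContDiff.sum fun k _ => contDiff_const.mul (contDiff_coord k))
    have hder : ∀ x : Pt d, fderiv ℝ (fun x : Pt d => t * ∑ k, A (i, k) * x k) x
        (EuclideanSpace.single j 1) = t * A (i, j) := by
      intro x
      have : HasFDerivAt (fun x : Pt d => t * ∑ k, A (i, k) * x k)
          (t • ∑ k, A (i, k) • (EuclideanSpace.proj k : Pt d →L[ℝ] ℝ)) x :=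
        (HasFDerivAt.fun_sum fun k _ =>
          (EuclideanSpace.proj (𝕜 := ℝ) k).hasFDerivAt.const_mul _).const_mul t
      rw [this.fderiv]
      simp
    rw [h2, setIntegral_mul_fderiv hlin htest] at h1
    simp only [hder] at h1
    have h3 : ∀ x, inner ℝ (v.1.snd x) (g x • (EuclideanSpace.single (i, j) (1 : ℝ) : Mat d)) =
        g x * v.1.snd x (i, j) := fun x => by
      rw [inner_smul_right]
      simp [EuclideanSpace.inner_single_right]
    simp only [h3] at h1
    obtain ⟨C, hC⟩ := hg.continuous.bounded_above_of_compact_support hgc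
    have hi1 : Integrable (fun x => g x * v.1.snd x (i, j)) (volOn Ω) :=
      (hmem.integrable (by norm_num)).bdd_mul hg.continuous.aestronglyMeasurable
        (Eventually.of_forall hC)
    have hi2 : Integrable (fun x => t * A (i, j) * g x) (volOn Ω) :=
      ((hg.continuous.integrable_of_hasCompactSupport hgc).integrableOn).const_mul _
    rw [← setIntegral_eq_integral_of_forall_compl_eq_zero (s := Ω) (fun x hx => by
      rw [image_eq_zero_of_notMem_tsupport fun h => hx (hgs h), zero_smul])]
    have h4 : ∀ x, g x • (v.1.snd x (i, j) - t * A (i, j)) =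
        g x * v.1.snd x (i, j) - t * A (i, j) * g x := fun x => by
      rw [smul_eq_mul]; ring
    simp only [h4]
    rw [integral_sub hi1 hi2]
    linarith
  filter_upwards [ae_all_iff.2 hcomp] with x hx
  ext ij
  simpa using sub_eq_zero.1 (hx ij)

theorem tendsto_integral_inner {α F : Type*} [MeasurableSpace α] {m : Measure α}
    [NormedAddCommGroup F] [InnerProductSpace ℝ F] {f g : α → F} {f' g' : ℕ → α → F}
    (hf : MemLp f 2 m) (hg : MemLp g 2 m) (hf' : ∀ k, MemLp (f' k) 2 m)
    (hg' : ∀ k, MemLp (g' k) 2 m)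
    (h1 : Tendsto (fun k => eLpNorm (fun x => f x - f' k x) 2 m) atTop (𝓝 0))
    (h2 : Tendsto (fun k => eLpNorm (fun x => g x - g' k x) 2 m) atTop (𝓝 0)) :
    Tendsto (fun k => ∫ x, inner ℝ (f' k x) (g' k x) ∂m) atTop
      (𝓝 (∫ x, inner ℝ (f x) (g x) ∂m)) := by
  have key : ∀ {a b : α → F} (ha : MemLp a 2 m) (hb : MemLp b 2 m),
      ∫ x, inner ℝ (a x) (b x) ∂m = inner ℝ (ha.toLp a) (hb.toLp b) := by
    intro a b ha hb
    rw [L2.inner_def]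
    refine integral_congr_ae ?_
    filter_upwards [ha.coeFn_toLp, hb.coeFn_toLp] with x h3 h4
    rw [h3, h4]
  have conv : ∀ {a : α → F} {a' : ℕ → α → F} (ha : MemLp a 2 m) (ha' : ∀ k, MemLp (a' k) 2 m),
      Tendsto (fun k => eLpNorm (fun x => a x - a' k x) 2 m) atTop (𝓝 0) →
      Tendsto (fun k => (ha' k).toLp (a' k)) atTop (𝓝 (ha.toLp a)) := by
    intro a a' ha ha' h
    rw [Lp.tendsto_Lp_iff_tendsto_eLpNorm'' _ _ _ ha]
    refine h.congr fun k => ?_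
    rw [← eLpNorm_neg]
    congr 1
    ext x
    simp
  simp only [key hf hg, key (hf' _) (hg' _)]
  exact (conv hf hf' h1).inner (conv hg hg' h2)

theorem IsTest.memLp_jacobian {φ : Pt d → Pt d} (h : IsTest Ω φ) :
    MemLp (jacobian φ) 2 (volOn Ω) := by
  have hc : Continuous (fderiv ℝ φ) := h.smooth.continuous_fderiv (by simp)
  have h1 : Continuous (jacobian φ) := by
    unfold jacobian
    fun_prop
  have h2 : HasCompactSupport (jacobian φ) := by
    refine (h.compact.fderiv ℝ).mono' (Subset.trans (fun x hx => ?_) subset_closure)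
    contrapose! hx
    have h0 : fderiv ℝ φ x = 0 := by simpa using hx
    simp only [Function.mem_support, not_not]
    ext i
    simp [jacobian, h0]
  exact (h1.memLp_of_hasCompactSupport h2 (μ := volume)).restrict Ω

theorem inner_symPart (S : symMat d) (A : Mat d) :
    inner ℝ S (symPart A) = inner ℝ (S : Mat d) A := by
  have hS : ∀ i j, (S : Mat d) (i, j) = (S : Mat d) (j, i) := S.2
  rw [Submodule.coe_inner, PiLp.inner_apply, PiLp.inner_apply]
  simp only [symPart, Fintype.sum_prod_type, RCLike.inner_apply, conj_trivial]
  have h1 : ∑ i, ∑ j, A (j, i) * (S : Mat d) (i, j) = ∑ i, ∑ j, A (i, j) * (S : Mat d) (i, j) := by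
    rw [Finset.sum_comm]
    simp only [hS]
  have h2 : ∀ i j, (A (i, j) + A (j, i)) / 2 * (S : Mat d) (i, j) =
      1 / 2 * (A (i, j) * (S : Mat d) (i, j)) + 1 / 2 * (A (j, i) * (S : Mat d) (i, j)) := by
    intro i j; ring
  simp only [h2, Finset.sum_add_distrib, ← Finset.mul_sum, h1]
  ring

/-- A constant stress does no work on a displacement that vanishes on the boundary. -/
theorem integral_inner_const_strain (hb : Bornology.IsBounded Ω) (S : symMat d) (v : H1 Ω)
    (hv : VanishesOnBoundary v) : ∫ x in Ω, inner ℝ S (strain v x) = 0 := by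
  have := isFiniteMeasure_volOn hb
  obtain ⟨φ, hφ, -, h2⟩ := hv
  simp only [strain, inner_symPart]
  have hlim := tendsto_integral_inner (m := volOn Ω) (f := fun _ => (S : Mat d))
    (f' := fun _ _ => (S : Mat d)) (g' := fun k => jacobian (φ k))
    (memLp_const _) (Lp.memLp v.1.snd) (fun _ => memLp_const _) (fun k => (hφ k).memLp_jacobian)
    (by simp) h2
  refine tendsto_nhds_unique hlim ?_
  have hzero : ∀ k, ∫ x in Ω, inner ℝ (S : Mat d) (jacobian (φ k) x) = 0 := by
    intro k
    have h3 : ∀ x, inner ℝ (S : Mat d) (jacobian (φ k) x) = ∑ ij : Fin d × Fin d,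
        (S : Mat d) ij * fderiv ℝ (fun x => φ k x ij.1) x (EuclideanSpace.single ij.2 1) := by
      intro x
      rw [PiLp.inner_apply]
      refine Finset.sum_congr rfl fun ij _ => ?_
      rw [fderiv_comp_apply (hφ k)]
      simp [jacobian, mul_comm]
    simp only [h3]
    rw [integral_finsetSum]
    · refine Finset.sum_eq_zero fun ij _ => ?_
      rw [integral_const_mul, setIntegral_fderiv_eq_zero ((hφ k).comp_apply ij.1), mul_zero]
    · intro ij _
      refine Integrable.const_mul (Integrable.integrableOn ?_) _
      exact (((hφ k).comp_apply ij.1).smooth.continuous_fderiv (by simp) |>.clm_apply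
        continuous_const).integrable_of_hasCompactSupport
        (((hφ k).comp_apply ij.1).compact.fderiv_apply ℝ _)
  simp [hzero]

/-- A displacement with zero strain that vanishes on the boundary is zero. For test functions
`∫ φᵢ² = - 2 ∫ xᵢ φᵢ ∂ᵢφᵢ`, and the right-hand side involves only the diagonal of the strain. -/
theorem fst_ae_eq_zero_of_strain (ho : IsOpen Ω) (hb : Bornology.IsBounded Ω) (v : H1 Ω)
    (hv : VanishesOnBoundary v) (h : ∀ᵐ x ∂volOn Ω, strain v x = 0) :
    v.1.fst =ᵐ[volOn Ω] 0 := by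
  have := isFiniteMeasure_volOn hb
  obtain ⟨φ, hφ, h1, h2⟩ := hv
  obtain ⟨R, hR⟩ := hb.exists_norm_le
  have hcomp : ∀ i, ∀ᵐ x ∂volOn Ω, v.1.fst x i = 0 := by
    intro i
    have hcoord : ∀ x : Pt d, |x i| ≤ ‖x‖ := fun x => PiLp.norm_apply_le x i
    have hRae : ∀ᵐ x ∂volOn Ω, ‖x‖ ≤ R := by
      filter_upwards [ae_restrict_mem ho.measurableSet] with x hx using hR x hx
    have hm1 : MemLp (fun x => v.1.fst x i) 2 (volOn Ω) :=
      (Lp.memLp v.1.fst).continuousLinearMap_comp (EuclideanSpace.proj (𝕜 := ℝ) i)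
    have hm2 : MemLp (fun x => v.1.snd x (i, i)) 2 (volOn Ω) :=
      (Lp.memLp v.1.snd).continuousLinearMap_comp (EuclideanSpace.proj (𝕜 := ℝ) (i, i))
    have hmul : ∀ {f : Pt d → ℝ}, MemLp f 2 (volOn Ω) →
        MemLp (fun x : Pt d => x i * f x) 2 (volOn Ω) := by
      intro f hf
      refine hf.of_le_mul (c := R) ((contDiff_coord i).continuous.aestronglyMeasurable.mul hf.1) ?_
      filter_upwards [hRae] with x hx
      rw [norm_mul]
      exact mul_le_mul_of_nonneg_right ((hcoord x).trans hx) (norm_nonneg _)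
    have hφ1 : ∀ k, MemLp (fun x => φ k x i) 2 (volOn Ω) := fun k => ((hφ k).comp_apply i).memLp
    have hφ2 : ∀ k, MemLp (fun x => jacobian (φ k) x (i, i)) 2 (volOn Ω) := fun k =>
      (hφ k).memLp_jacobian.continuousLinearMap_comp (EuclideanSpace.proj (𝕜 := ℝ) (i, i))
    have c1 : Tendsto (fun k => eLpNorm (fun x => v.1.fst x i - φ k x i) 2 (volOn Ω)) atTop
        (𝓝 0) := by
      refine tendsto_of_tendsto_of_tendsto_of_le_of_le tendsto_const_nhds h1 (fun _ => zero_le)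
        fun k => ?_
      exact eLpNorm_mono fun x => PiLp.norm_apply_le (v.1.fst x - φ k x) i
    have c2 : Tendsto (fun k => eLpNorm (fun x => v.1.snd x (i, i) - jacobian (φ k) x (i, i)) 2
        (volOn Ω)) atTop (𝓝 0) := by
      refine tendsto_of_tendsto_of_tendsto_of_le_of_le tendsto_const_nhds h2 (fun _ => zero_le)
        fun k => ?_
      exact eLpNorm_mono fun x => PiLp.norm_apply_le (v.1.snd x - jacobian (φ k) x) (i, i)
    have c3 : Tendsto (fun k => eLpNorm (fun x : Pt d => x i * v.1.fst x i - x i * φ k x i) 2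
        (volOn Ω)) atTop (𝓝 0) := by
      have h3 : Tendsto (fun k => ENNReal.ofReal R *
          eLpNorm (fun x => v.1.fst x i - φ k x i) 2 (volOn Ω)) atTop (𝓝 0) := by
        simpa using ENNReal.Tendsto.const_mul c1 (Or.inr ENNReal.ofReal_ne_top)
      refine tendsto_of_tendsto_of_tendsto_of_le_of_le tendsto_const_nhds h3 (fun _ => zero_le)
        fun k => ?_
      refine eLpNorm_le_mul_eLpNorm_of_ae_le_mul ?_ 2
      filter_upwards [hRae] with x hx
      rw [← mul_sub, norm_mul]
      exact mul_le_mul_of_nonneg_right ((hcoord x).trans hx) (norm_nonneg _)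
    have l1 := tendsto_integral_inner hm1 hm1 hφ1 hφ1 c1 c1
    have l2 := tendsto_integral_inner (hmul hm1) hm2 (fun k => hmul (hφ1 k)) hφ2 c3 c2
    have hid : ∀ k, ∫ x in Ω, inner ℝ (φ k x i) (φ k x i) =
        -2 * ∫ x in Ω, inner ℝ (x i * φ k x i) (jacobian (φ k) x (i, i)) := by
      intro k
      have hφi := (hφ k).comp_apply i
      have h3 := setIntegral_mul_fderiv (contDiff_coord i) hφi.sq (EuclideanSpace.single i 1)
      have h4 : ∀ x, fderiv ℝ (fun x => φ k x i ^ 2) x (EuclideanSpace.single i 1) =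
          2 * φ k x i * jacobian (φ k) x (i, i) := by
        intro x
        have hd : DifferentiableAt ℝ (fun x => φ k x i) x :=
          (hφi.smooth.differentiable (by simp)).differentiableAt
        rw [fderiv_fun_pow 2 hd]
        simp [fderiv_comp_apply (hφ k), jacobian]
      simp only [fderiv_coord, h4] at h3
      rw [← integral_const_mul]
      have h5 : ∫ x in Ω, φ k x i ^ 2 =
          -∫ x in Ω, x i * (2 * φ k x i * jacobian (φ k) x (i, i)) := by
        rw [h3]
        simp
      rw [← integral_neg] at h5
      calc _ = ∫ x in Ω, φ k x i ^ 2 := by simp [sq]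
        _ = _ := h5
        _ = _ := integral_congr_ae (Eventually.of_forall fun x => by simp; ring)
    simp only [hid] at l1
    have h3 := tendsto_nhds_unique l1 (l2.const_mul (-2))
    have h4 : ∫ x in Ω, inner ℝ (x i * v.1.fst x i) (v.1.snd x (i, i)) = 0 := by
      refine integral_eq_zero_of_ae ?_
      filter_upwards [h] with x hx
      have : (strain v x : Mat d) (i, i) = 0 := by rw [hx]; rfl
      have h5 : v.1.snd x (i, i) = 0 := by simpa [strain, symPart] using this
      simp [h5]
    rw [h4, mul_zero, integral_eq_zero_iff_of_nonneg (fun x => by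
      simpa using sq_nonneg _) (hm1.integrable_sq.congr (Eventually.of_forall fun x => by
      simp [sq]))] at h3
    filter_upwards [h3] with x hx
    simpa using hx
  filter_upwards [ae_all_iff.2 hcomp] with x hx
  ext i
  simpa using hx i

end Sobolev

/-! ### The elasticity tensor -/

section Tensor

variable {d : ℕ}

theorem inner_devToSym_dev (A B : symMat d) :
    inner ℝ (devToSym (dev A)) B = inner ℝ (dev A) (dev B) := by
  rw [Submodule.coe_inner, Submodule.coe_inner]
  exact (Submodule.inner_orthogonalProjectionOnto_eq_of_mem_left (dev A) (B : Mat d)).symm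

theorem inner_dev_left (A : symMat d) (B : devMat d) :
    inner ℝ (dev A) B = inner ℝ A (devToSym B) := by
  rw [Submodule.coe_inner, Submodule.coe_inner]
  exact Submodule.inner_orthogonalProjectionOnto_eq_of_mem_right B (A : Mat d)

theorem inner_idMat (A : symMat d) : inner ℝ (idMat d) A = tr (A : Mat d) := by
  rw [Submodule.coe_inner, PiLp.inner_apply, Fintype.sum_prod_type]
  simp [idMat, tr]

theorem tr_devToSym (B : devMat d) : tr (devToSym B : Mat d) = 0 := B.2.2

theorem dev_add (A B : symMat d) : dev (A + B) = dev A + dev B := by simp [dev]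

theorem dev_smul (c : ℝ) (A : symMat d) : dev (c • A) = c • dev A := by simp [dev]

theorem dev_devToSym (B : devMat d) : dev (devToSym B) = B :=
  Submodule.orthogonalProjectionOnto_mem_subspace_eq_self B

theorem dev_idMat : dev (idMat d) = 0 := by
  refine ext_inner_right ℝ fun B => ?_
  rw [inner_dev_left, inner_idMat, tr_devToSym, inner_zero_left]

theorem tr_add (A B : Mat d) : tr (A + B) = tr A + tr B := by simp [tr, Finset.sum_add_distrib]

theorem tr_smul (c : ℝ) (A : Mat d) : tr (c • A) = c * tr A := by simp [tr, Finset.mul_sum]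

theorem eq_zero_of_dev_of_tr {A : symMat d} (h1 : dev A = 0) (h2 : tr (A : Mat d) = 0) : A = 0 := by
  have h3 : devToSym ⟨(A : Mat d), A.2, h2⟩ = A := rfl
  rw [← h3, dev_devToSym] at h1
  rw [← h3, h1]
  rfl

/-- The elasticity tensor as a continuous linear map. -/
def isotropicCLM (d : ℕ) (μ κ : ℝ) : symMat d →L[ℝ] symMat d :=
  LinearMap.toContinuousLinearMap
    { toFun := isotropicTensor d μ κ
      map_add' := fun A B => by
        have h : ∀ B C : devMat d, devToSym (B + C) = devToSym B + devToSym C := fun _ _ => rfl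
        simp only [isotropicTensor, dev_add, h, Submodule.coe_add, tr_add]
        module
      map_smul' := fun c A => by
        have h : ∀ B : devMat d, devToSym (c • B) = c • devToSym B := fun _ => rfl
        simp only [isotropicTensor, dev_smul, h, Submodule.coe_smul, tr_smul, RingHom.id_apply]
        module }

theorem isotropicCLM_apply (μ κ : ℝ) (A : symMat d) :
    isotropicCLM d μ κ A = isotropicTensor d μ κ A := rfl

theorem dev_isotropicTensor (μ κ : ℝ) (A : symMat d) :
    dev (isotropicTensor d μ κ A) = (2 * μ) • dev A := by
  rw [isotropicTensor, dev_add, dev_smul, dev_smul, dev_devToSym, dev_idMat, smul_zero, add_zero]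

theorem inner_isotropicTensor (μ κ : ℝ) (A : symMat d) (B : devMat d) :
    inner ℝ (isotropicTensor d μ κ A) (A + devToSym B) =
      2 * μ * ‖dev A‖ ^ 2 + κ * tr (A : Mat d) ^ 2 + 2 * μ * inner ℝ (dev A) B := by
  have hsmul : ∀ (c : ℝ) (C D : symMat d), inner ℝ (c • C) D = c * inner ℝ C D :=
    fun c C D => real_inner_smul_left C D c
  rw [isotropicTensor, inner_add_left, hsmul, hsmul, inner_devToSym_dev,
    inner_idMat, dev_add, dev_devToSym, inner_add_right, real_inner_self_eq_norm_sq,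
    Submodule.coe_add, tr_add, tr_devToSym]
  ring

end Tensor

/-! ### Uniqueness for the regularized problem -/

theorem norm_sq_Lp_two {α F : Type*} [MeasurableSpace α] {m : Measure α} [NormedAddCommGroup F]
    [InnerProductSpace ℝ F] (f : Lp F 2 m) : ‖f‖ ^ 2 = ∫ x, ‖f x‖ ^ 2 ∂m := by
  rw [← real_inner_self_eq_norm_sq, L2.inner_def]
  simp only [real_inner_self_eq_norm_sq]

theorem integrable_norm_sq_Lp_two {α F : Type*} [MeasurableSpace α] {m : Measure α}
    [NormedAddCommGroup F] [InnerProductSpace ℝ F] (f : Lp F 2 m) :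
    Integrable (fun x => ‖f x‖ ^ 2) m := by
  simpa only [real_inner_self_eq_norm_sq] using L2.integrable_inner (𝕜 := ℝ) f f

/-- Grönwall's lemma for two primitives whose densities they control. -/
theorem eq_zero_of_primitive_of_norm_le {X Z : Type*} [NormedAddCommGroup X] [NormedSpace ℝ X]
    [NormedAddCommGroup Z] [NormedSpace ℝ Z] {f f' : ℝ → X} {g g' : ℝ → Z} {T C : ℝ} (hT : 0 ≤ T)
    (hf' : IntegrableOn f' (Icc 0 T)) (hg' : IntegrableOn g' (Icc 0 T))
    (hf : ∀ t ∈ Icc 0 T, f t = ∫ τ in (0 : ℝ)..t, f' τ)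
    (hg : ∀ t ∈ Icc 0 T, g t = ∫ τ in (0 : ℝ)..t, g' τ)
    (hfb : ∀ᵐ t ∂(volume.restrict (Ioi (0 : ℝ))), t ≤ T → ‖f' t‖ ≤ C * (‖f t‖ + ‖g t‖))
    (hgb : ∀ᵐ t ∂(volume.restrict (Ioi (0 : ℝ))), t ≤ T → ‖g' t‖ ≤ C * (‖f t‖ + ‖g t‖)) :
    ∀ t ∈ Icc 0 T, f t = 0 ∧ g t = 0 := by
  have hu : uIcc 0 T = Icc 0 T := uIcc_of_le hT
  have hfc : ContinuousOn f (Icc 0 T) := by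
    have := intervalIntegral.continuousOn_primitive_interval (μ := volume) (hu.symm ▸ hf')
    rw [hu] at this
    exact this.congr hf
  have hgc : ContinuousOn g (Icc 0 T) := by
    have := intervalIntegral.continuousOn_primitive_interval (μ := volume) (hu.symm ▸ hg')
    rw [hu] at this
    exact this.congr hg
  set n : ℝ → ℝ := IccExtend hT (fun t => ‖f t‖ + ‖g t‖) with hn
  have hnc : Continuous n := by
    refine Continuous.Icc_extend' ?_
    exact (hfc.norm.add hgc.norm).domRestrict
  have hnt : ∀ t ∈ Icc 0 T, n t = ‖f t‖ + ‖g t‖ := fun t ht => IccExtend_of_mem hT _ ht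
  have hn0 : ∀ t, 0 ≤ n t := fun t => by
    simp only [hn, IccExtend, Function.comp_apply]
    positivity
  have hbound : ∀ t ∈ Icc 0 T, n t ≤ 2 * C * ∫ τ in (0 : ℝ)..t, n τ := by
    intro t ht
    have hle : ∀ {a : ℝ → ℝ},
        (∀ᵐ t ∂(volume.restrict (Ioi (0 : ℝ))), t ≤ T → a t ≤ C * (‖f t‖ + ‖g t‖)) →
        ∀ᵐ τ, τ ∈ Ioc 0 t → a τ ≤ C * n τ := by
      intro a hb
      rw [ae_restrict_iff' measurableSet_Ioi] at hb
      filter_upwards [hb] with τ h1 h2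
      rw [hnt τ ⟨h2.1.le, h2.2.trans ht.2⟩]
      exact h1 h2.1 (h2.2.trans ht.2)
    have hi := (hnc.const_mul C).intervalIntegrable (μ := volume) 0 t
    have h1 := intervalIntegral.norm_integral_le_of_norm_le ht.1 (hle hfb) hi
    have h2 := intervalIntegral.norm_integral_le_of_norm_le ht.1 (hle hgb) hi
    rw [← hf t ht, intervalIntegral.integral_const_mul] at h1
    rw [← hg t ht, intervalIntegral.integral_const_mul] at h2
    rw [hnt t ht]
    linarith
  have hF : ∀ t, HasDerivAt (fun t => ∫ τ in (0 : ℝ)..t, n τ) (n t) t := fun t =>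
    hnc.integral_hasStrictDerivAt 0 t |>.hasDerivAt
  have hgron := norm_le_gronwallBound_of_norm_deriv_right_le (f := fun t => ∫ τ in (0 : ℝ)..t, n τ)
    (f' := n) (δ := 0) (K := 2 * C) (ε := 0) (a := 0) (b := T)
    (fun t _ => (hF t).continuousAt.continuousWithinAt) (fun t _ => (hF t).hasDerivWithinAt)
    (by simp) (fun t ht => by
      rw [Real.norm_of_nonneg (hn0 t), Real.norm_of_nonneg
        (intervalIntegral.integral_nonneg ht.1 fun τ _ => hn0 τ), add_zero]
      exact hbound t ⟨ht.1, ht.2.le⟩)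
  intro t ht
  have h1 := hgron t ht
  rw [gronwallBound_ε0_δ0, norm_le_zero_iff] at h1
  have h2 := hbound t ht
  rw [h1, mul_zero, hnt t ht] at h2
  have h3 := norm_nonneg (f t)
  have h4 := norm_nonneg (g t)
  exact ⟨norm_eq_zero.1 (by linarith), norm_eq_zero.1 (by linarith)⟩

section Regularized

variable {d : ℕ} {Ω : Set (Pt d)} {μ κ : ℝ}

/-- The energy estimate: testing the difference of two equilibrium equations with the difference of
the displacements controls the elastic strain by the plastic strain. -/
theorem energy_estimate (hb : Bornology.IsBounded Ω) (hμ : 0 < μ)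
    (η : Lp (symMat d) 2 (volOn Ω)) (π : Lp (devMat d) 2 (volOn Ω)) (S : symMat d) (v : H1 Ω)
    (hv : VanishesOnBoundary v)
    (hadd : ∀ᵐ x ∂volOn Ω, strain v x = η x + devToSym (π x))
    (heq : IsEquilibrated Ω fun x => isotropicTensor d μ κ (η x + S)) :
    Integrable (fun x => ‖dev (η x)‖ ^ 2) (volOn Ω) ∧
    Integrable (fun x => tr (η x : Mat d) ^ 2) (volOn Ω) ∧
    ∫ x in Ω, (μ * ‖dev (η x)‖ ^ 2 + κ * tr (η x : Mat d) ^ 2) ≤ μ * ∫ x in Ω, ‖π x‖ ^ 2 := by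
  have := isFiniteMeasure_volOn hb
  let devL : symMat d →L[ℝ] devMat d := (devMat d).orthogonalProjectionOnto ∘L (symMat d).subtypeL
  have hdev : MemLp (fun x => dev (η x)) 2 (volOn Ω) := devL.comp_memLp' (Lp.memLp η)
  have htr : MemLp (fun x => tr (η x : Mat d)) 2 (volOn Ω) := by
    have := (innerSL ℝ (idMat d)).comp_memLp' (Lp.memLp η)
    exact this.ae_eq (Eventually.of_forall fun x => inner_idMat (η x))
  have hint1 : Integrable (fun x => ‖dev (η x)‖ ^ 2) (volOn Ω) := by
    simpa using hdev.integrable_norm_pow (p := 2) (by norm_num)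
  have hint2 : Integrable (fun x => tr (η x : Mat d) ^ 2) (volOn Ω) := htr.integrable_sq
  refine ⟨hint1, hint2, ?_⟩
  have hpi := integrable_norm_sq_Lp_two π
  have hdp : Integrable (fun x => inner ℝ (dev (η x)) (π x)) (volOn Ω) := by
    have := L2.integrable_inner (𝕜 := ℝ) (hdev.toLp _) π
    refine this.congr ?_
    filter_upwards [hdev.coeFn_toLp] with x hx
    rw [hx]
  -- the work of the stress difference on the displacement vanishes
  have hwork : ∫ x in Ω, inner ℝ (isotropicTensor d μ κ (η x)) (η x + devToSym (π x)) = 0 := by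
    have h1 := heq.2 v hv
    have h2 := integral_inner_const_strain hb (isotropicTensor d μ κ S) v hv
    have hpt : ∀ᵐ x ∂volOn Ω, inner ℝ (isotropicTensor d μ κ (η x)) (η x + devToSym (π x)) =
        inner ℝ (isotropicTensor d μ κ (η x + S)) (strain v x) -
          inner ℝ (isotropicTensor d μ κ S) (strain v x) := by
      filter_upwards [hadd] with x hx
      rw [hx, ← inner_sub_left, ← isotropicCLM_apply, ← isotropicCLM_apply, ← isotropicCLM_apply,
        map_add, add_sub_cancel_right]
    have hstr : MemLp (strain v) 2 (volOn Ω) := by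
      have h3 : MemLp (fun x => devToSym (π x)) 2 (volOn Ω) :=
        (Lp.memLp π).of_le (by
          have hc : Continuous (devToSym : devMat d → symMat d) :=
            Continuous.subtype_mk continuous_subtype_val _
          exact hc.comp_aestronglyMeasurable (Lp.memLp π).1)
          (Eventually.of_forall fun x => le_of_eq rfl)
      exact ((Lp.memLp η).add h3).ae_eq (hadd.mono fun x hx => hx.symm)
    have hinner : ∀ {f : Pt d → symMat d}, MemLp f 2 (volOn Ω) →
        Integrable (fun x => inner ℝ (f x) (strain v x)) (volOn Ω) := by
      intro f hf
      have := L2.integrable_inner (𝕜 := ℝ) (hf.toLp _) (hstr.toLp _)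
      refine this.congr ?_
      filter_upwards [hf.coeFn_toLp, hstr.coeFn_toLp] with x h3 h4
      rw [h3, h4]
    rw [integral_congr_ae hpt, integral_sub, h1, h2, sub_zero]
    · exact hinner ((isotropicCLM d μ κ).comp_memLp' ((Lp.memLp η).add (memLp_const S)))
    · exact hinner (memLp_const _)
  simp only [inner_isotropicTensor] at hwork
  rw [← integral_const_mul]
  have hI1 : Integrable (fun x => 2 * μ * ‖dev (η x)‖ ^ 2 + κ * tr (η x : Mat d) ^ 2 +
      2 * μ * inner ℝ (dev (η x)) (π x)) (volOn Ω) :=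
    ((hint1.const_mul _).add (hint2.const_mul _)).add (hdp.const_mul _)
  have hI2 : Integrable (fun x => μ * ‖dev (η x)‖ ^ 2 + κ * tr (η x : Mat d) ^ 2) (volOn Ω) :=
    (hint1.const_mul _).add (hint2.const_mul _)
  have hI3 : Integrable (fun x => μ * ‖π x‖ ^ 2) (volOn Ω) := hpi.const_mul _
  have hmono : ∫ x in Ω, ((μ * ‖dev (η x)‖ ^ 2 + κ * tr (η x : Mat d) ^ 2) - μ * ‖π x‖ ^ 2) ≤
      ∫ x in Ω, (2 * μ * ‖dev (η x)‖ ^ 2 + κ * tr (η x : Mat d) ^ 2 +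
        2 * μ * inner ℝ (dev (η x)) (π x)) := by
    refine integral_mono (hI2.sub hI3) hI1 fun x => ?_
    -- this is `2 ⟨a, b⟩ ≥ - ‖a‖ ^ 2 - ‖b‖ ^ 2`
    have h1 : 0 ≤ ‖dev (η x) + π x‖ ^ 2 := sq_nonneg _
    rw [norm_add_sq_real] at h1
    simp only
    nlinarith
  rw [integral_sub hI2 hI3, hwork] at hmono
  linarith

end Regularized

theorem continuousOn_overstress {μ r : ℝ} {s θ : ℝ → ℝ} {S : Set ℝ} (hs : ContinuousOn s S)
    (hθ : ContinuousOn θ S) : ContinuousOn (fun τ => overstress μ r (s τ) (θ τ)) S := by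
  have h1 := continuous_softSlope
  unfold overstress
  refine continuousOn_const.sub
    (ContinuousOn.inv₀ ?_ fun v _ => (zero_lt_one.trans_le (le_max_left _ _)).ne')
  fun_prop

theorem integral_eq_of_hasDerivWithinAt {a a' : ℝ → ℝ} {T : ℝ} (ha' : ContinuousOn a' (Icc 0 T))
    (ha : ∀ t ∈ Icc 0 T, HasDerivWithinAt a (a' t) (Icc 0 T) t) {t : ℝ} (ht : t ∈ Icc 0 T) :
    a t = a 0 + ∫ τ in (0 : ℝ)..t, a' τ := by
  have hsub : Icc 0 t ⊆ Icc 0 T := Icc_subset_Icc le_rfl ht.2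
  rw [intervalIntegral.integral_eq_sub_of_hasDerivAt_of_le ht.1
    (fun τ hτ => (ha τ (hsub hτ)).continuousWithinAt.mono hsub)
    (fun τ hτ => (ha τ (hsub (Ioo_subset_Icc_self hτ))).hasDerivAt
      (mem_of_superset (Icc_mem_nhds hτ.1 hτ.2) hsub))
    ((ha'.mono hsub).intervalIntegrable_of_Icc ht.1)]
  ring

/-- The difference of a function of class `H¹_loc` and of a primitive that moves along a line. -/
theorem HasH1LocDeriv.sub_primitive {X : Type*} [NormedAddCommGroup X] [NormedSpace ℝ X]
    [CompleteSpace X] {f f' : ℝ → X} (hf : HasH1LocDeriv f f') (L : ℝ →L[ℝ] X) {a a' : ℝ → ℝ}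
    {T : ℝ} (hT : 0 ≤ T) (ha' : ContinuousOn a' (Icc 0 T))
    (ha : ∀ t ∈ Icc 0 T, HasDerivWithinAt a (a' t) (Icc 0 T) t) (h0 : f 0 = L (a 0)) :
    IntegrableOn (fun t => f' t - L (a' t)) (Icc 0 T) ∧
      ∀ t ∈ Icc 0 T, f t - L (a t) = ∫ τ in (0 : ℝ)..t, (f' τ - L (a' τ)) := by
  have hf' : IntegrableOn f' (Icc 0 T) := by
    have h1 : IntegrableOn f' (Icc 0 (T + 1)) :=
      (hf.1 (T + 1) (by linarith)).integrable (by norm_num)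
    exact h1.mono_set (Icc_subset_Icc le_rfl (by linarith))
  have hai : Integrable a' (volume.restrict (Icc 0 T)) := ha'.integrableOn_Icc
  refine ⟨hf'.sub (L.integrable_comp hai), fun t ht => ?_⟩
  have hsub : uIcc 0 t ⊆ Icc 0 T := by
    rw [uIcc_of_le ht.1]
    exact Icc_subset_Icc le_rfl ht.2
  have hi1 : IntervalIntegrable f' volume 0 t := (hf'.mono_set hsub).intervalIntegrable
  have hi2 : IntervalIntegrable a' volume 0 t := (IntegrableOn.mono_set hai hsub).intervalIntegrable
  have hi3 : IntervalIntegrable (fun τ => L (a' τ)) volume 0 t :=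
    (IntegrableOn.mono_set (L.integrable_comp hai : IntegrableOn _ _) hsub).intervalIntegrable
  rw [intervalIntegral.integral_sub hi1 hi3, L.intervalIntegral_comp_comm hi2, hf.2 t ht.1,
    integral_eq_of_hasDerivWithinAt ha' ha ht, map_add, h0]
  abel

theorem IsHomogeneous.continuousOn_rates {μ r θ₀ ε T : ℝ} {s θ : ℝ → ℝ}
    (hs : IsHomogeneous μ r θ₀ ε T s θ) :
    ContinuousOn (fun τ => ε⁻¹ * (overstress μ r (s τ) (θ τ) * (2 * μ * s τ))) (Icc 0 T) ∧
      ContinuousOn (fun τ => ε⁻¹ * (overstress μ r (s τ) (θ τ) * softSlope (θ τ))) (Icc 0 T) := by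
  have hscont : ContinuousOn s (Icc 0 T) := fun τ hτ => (hs.deriv_s τ hτ).continuousWithinAt
  have hθcont : ContinuousOn θ (Icc 0 T) := fun τ hτ => (hs.deriv_θ τ hτ).continuousWithinAt
  have hover := continuousOn_overstress (μ := μ) (r := r) hscont hθcont
  have hslope : ContinuousOn (fun τ => softSlope (θ τ)) (Icc 0 T) :=
    continuous_softSlope.comp_continuousOn' hθcont
  constructor
  · exact (hover.mul (hscont.const_mul (2 * μ))).const_mul ε⁻¹
  · exact (hover.mul hslope).const_mul ε⁻¹

section Regularized

variable {d : ℕ} {Ω : Set (Pt d)} {μ κ r : ℝ}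

theorem flowMap_homogeneous {ε s θ : ℝ} {ξ : devMat d} (hξ : ‖ξ‖ = r) :
    flowMap (unitBall d) ε (WithLp.toLp 2 ((2 * μ * s) • ξ, softSlope θ)) =
      WithLp.toLp 2 ((ε⁻¹ * (overstress μ r s θ * (2 * μ * s))) • ξ,
        ε⁻¹ * (overstress μ r s θ * softSlope θ)) := by
  rw [flowMap_unitBall, ballResidual, WithLp.prod_norm_eq_of_L2]
  have h1 : ‖(2 * μ * s) • ξ‖ ^ 2 + ‖softSlope θ‖ ^ 2 = (2 * μ * r * s) ^ 2 + softSlope θ ^ 2 := by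
    rw [norm_smul, hξ, mul_pow, Real.norm_eq_abs, Real.norm_eq_abs, sq_abs, sq_abs]
    ring
  simp only [WithLp.toLp_fst, WithLp.toLp_snd, h1]
  rw [← overstress, ← WithLp.toLp_smul, ← WithLp.toLp_smul]
  simp only [Prod.smul_mk, smul_smul, smul_eq_mul]

/-- The flow rule is Lipschitz in `L²`: the rates of `p` and `z` differ from those of the
homogeneous evolution by at most the differences of `p` and `z` themselves. -/
theorem flow_estimate [IsFiniteMeasure (volOn Ω)] {ε s θ : ℝ} (hε : 0 < ε) (hμ : 0 < μ)
    {ξ : devMat d} (hξ : ‖ξ‖ = r)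
    {e η : Lp (symMat d) 2 (volOn Ω)} {p' π : Lp (devMat d) 2 (volOn Ω)}
    {z z' : Lp ℝ 2 (volOn Ω)}
    (hη : ∀ᵐ x ∂volOn Ω, e x = η x + s • devToSym ξ)
    (hint : Integrable (fun x => ‖dev (η x)‖ ^ 2) (volOn Ω))
    (hest : ∫ x in Ω, ‖dev (η x)‖ ^ 2 ≤ ‖π‖ ^ 2)
    (hflow : ∀ᵐ x ∂volOn Ω, (WithLp.toLp 2 (p' x, z' x) : DevR d) = flowMap (unitBall d) ε
      (WithLp.toLp 2 (dev (isotropicTensor d μ κ (e x)), - deriv softV (z x)))) :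
    ‖p' - Lp.constL 2 (volOn Ω) ℝ ((ε⁻¹ * (overstress μ r s θ * (2 * μ * s))) • ξ)‖ ≤
        2 * ε⁻¹ * (2 * μ + 1) * (‖π‖ + ‖z - Lp.constL 2 (volOn Ω) ℝ θ‖) ∧
      ‖z' - Lp.constL 2 (volOn Ω) ℝ (ε⁻¹ * (overstress μ r s θ * softSlope θ))‖ ≤
        2 * ε⁻¹ * (2 * μ + 1) * (‖π‖ + ‖z - Lp.constL 2 (volOn Ω) ℝ θ‖) := by
  set P' := (ε⁻¹ * (overstress μ r s θ * (2 * μ * s))) • ξ with hP'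
  set Z' := ε⁻¹ * (overstress μ r s θ * softSlope θ) with hZ'
  set δp := p' - Lp.constL 2 (volOn Ω) ℝ P' with hδp
  set δz := z' - Lp.constL 2 (volOn Ω) ℝ Z' with hδz
  set ζ := z - Lp.constL 2 (volOn Ω) ℝ θ with hζ
  have hε' : 0 < ε⁻¹ := inv_pos.2 hε
  have hpt : ∀ᵐ x ∂volOn Ω, ‖δp x‖ ^ 2 + ‖δz x‖ ^ 2 ≤
      (2 * ε⁻¹) ^ 2 * ((2 * μ) ^ 2 * ‖dev (η x)‖ ^ 2 + ‖ζ x‖ ^ 2) := by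
    filter_upwards [hη, hflow, Lp.coeFn_sub p' (Lp.constL 2 (volOn Ω) ℝ P'),
      Lp.coeFn_sub z' (Lp.constL 2 (volOn Ω) ℝ Z'), Lp.coeFn_sub z (Lp.constL 2 (volOn Ω) ℝ θ),
      Lp.coeFn_const (p := 2) (μ := volOn Ω) P', Lp.coeFn_const (p := 2) (μ := volOn Ω) Z',
      Lp.coeFn_const (p := 2) (μ := volOn Ω) θ] with x h1 h2 h3 h4 h5 h6 h7 h8
    have e3 : δp x = p' x - P' := by
      rw [h3, Pi.sub_apply]; congr 1
    have e4 : δz x = z' x - Z' := by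
      rw [h4, Pi.sub_apply]; congr 1
    have e5 : ζ x = z x - θ := by
      rw [h5, Pi.sub_apply]; congr 1
    have hq1 : dev (isotropicTensor d μ κ (e x)) - (2 * μ * s) • ξ = (2 * μ) • dev (η x) := by
      rw [dev_isotropicTensor, h1, dev_add, dev_smul, dev_devToSym]
      module
    have h9 := flowMap_homogeneous (μ := μ) (ε := ε) (s := s) (θ := θ) hξ
    have h10 : ‖(WithLp.toLp 2 (p' x, z' x) : DevR d) - WithLp.toLp 2 (P', Z')‖ ≤
        2 * ε⁻¹ *
          ‖(WithLp.toLp 2 ((2 * μ) • dev (η x), softSlope (z x) - softSlope θ) : DevR d)‖ := by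
      rw [h2, hP', hZ', ← h9, flowMap_unitBall, flowMap_unitBall, ← smul_sub, norm_smul,
        Real.norm_of_nonneg hε'.le, ← hq1, deriv_softV, neg_neg]
      have h11 := norm_ballResidual_sub_le
        (WithLp.toLp 2 (dev (isotropicTensor d μ κ (e x)), softSlope (z x)) : DevR d)
        (WithLp.toLp 2 ((2 * μ * s) • ξ, softSlope θ))
      have h12 := mul_le_mul_of_nonneg_left h11 hε'.le
      rw [← mul_assoc, mul_comm ε⁻¹ 2] at h12
      exact h12
    have h12 := pow_le_pow_left₀ (norm_nonneg _) h10 2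
    rw [mul_pow, ← WithLp.toLp_sub, Prod.mk_sub_mk, WithLp.prod_norm_sq_eq_of_L2,
      WithLp.prod_norm_sq_eq_of_L2] at h12
    simp only [WithLp.toLp_fst, WithLp.toLp_snd] at h12
    rw [e3, e4, e5]
    refine h12.trans (mul_le_mul_of_nonneg_left ?_ (sq_nonneg _))
    have h13 := lipschitzWith_softSlope.dist_le_mul (z x) θ
    rw [dist_eq_norm, dist_eq_norm, NNReal.coe_one, one_mul] at h13
    rw [norm_smul, mul_pow, Real.norm_eq_abs (2 * μ), sq_abs]
    gcongr
  have hmain : ‖δp‖ ^ 2 + ‖δz‖ ^ 2 ≤ (2 * ε⁻¹) ^ 2 * ((2 * μ) ^ 2 * ‖π‖ ^ 2 + ‖ζ‖ ^ 2) := by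
    have hi1 := integrable_norm_sq_Lp_two δp
    have hi2 := integrable_norm_sq_Lp_two δz
    have hi3 := integrable_norm_sq_Lp_two ζ
    have h1 := integral_mono_ae (hi1.add hi2) (((hint.const_mul ((2 * μ) ^ 2)).add hi3).const_mul
      ((2 * ε⁻¹) ^ 2)) hpt
    simp only [Pi.add_apply] at h1
    rw [integral_add hi1 hi2, integral_const_mul, integral_add (hint.const_mul _) hi3,
      integral_const_mul, ← norm_sq_Lp_two, ← norm_sq_Lp_two, ← norm_sq_Lp_two] at h1
    refine h1.trans (mul_le_mul_of_nonneg_left ?_ (sq_nonneg _))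
    gcongr
  have hC : (2 * ε⁻¹) ^ 2 * ((2 * μ) ^ 2 * ‖π‖ ^ 2 + ‖ζ‖ ^ 2) ≤
      (2 * ε⁻¹ * (2 * μ + 1) * (‖π‖ + ‖ζ‖)) ^ 2 := by
    rw [mul_assoc (2 * ε⁻¹), mul_pow (2 * ε⁻¹)]
    refine mul_le_mul_of_nonneg_left ?_ (sq_nonneg _)
    rw [← mul_pow]
    have h1 : 0 ≤ 2 * μ * ‖π‖ := by positivity
    have h2 : 0 ≤ ‖ζ‖ := norm_nonneg ζ
    have h3 : 0 ≤ ‖π‖ := norm_nonneg π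
    have h4 : 2 * μ * ‖π‖ + ‖ζ‖ ≤ (2 * μ + 1) * (‖π‖ + ‖ζ‖) := by nlinarith
    calc (2 * μ * ‖π‖) ^ 2 + ‖ζ‖ ^ 2 ≤ (2 * μ * ‖π‖ + ‖ζ‖) ^ 2 := by nlinarith
      _ ≤ _ := by gcongr
  have hpos : 0 ≤ 2 * ε⁻¹ * (2 * μ + 1) * (‖π‖ + ‖ζ‖) := by positivity
  exact ⟨abs_le_of_sq_le_sq' (by nlinarith [sq_nonneg ‖δz‖]) hpos |>.2,
    abs_le_of_sq_le_sq' (by nlinarith [sq_nonneg ‖δp‖]) hpos |>.2⟩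

theorem strain_sub_ae_eq (ho : IsOpen Ω) (hb : Bornology.IsBounded Ω) {t : ℝ} {ξ₀ : Mat d}
    {v w : H1 Ω} (hw : w.1.fst =ᵐ[volOn Ω] fun x => t • mulPt ξ₀ x) :
    ∀ᵐ x ∂volOn Ω, strain (v - w) x = strain v x - t • symPart ξ₀ := by
  filter_upwards [snd_ae_eq_of_fst_linear ho hb ξ₀ t w hw, Lp.coeFn_sub v.1.snd w.1.snd]
    with x h2 h3
  have h9 : (v - w).1.snd x = v.1.snd x - t • ξ₀ := by
    rw [← h2]
    exact h3
  rw [strain, strain, h9]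
  ext ij
  simp only [symPart, Submodule.coe_sub, Submodule.coe_smul, PiLp.sub_apply,
    PiLp.smul_apply, smul_eq_mul]
  ring

theorem coeFn_constL [IsFiniteMeasure (volOn Ω)] {F : Type*} [NormedAddCommGroup F]
    [NormedSpace ℝ F] (c : F) : Lp.constL 2 (volOn Ω) ℝ c =ᵐ[volOn Ω] fun _ => c :=
  Lp.coeFn_const (p := 2) (μ := volOn Ω) c

theorem coeFn_sub_constL [IsFiniteMeasure (volOn Ω)] {F : Type*} [NormedAddCommGroup F]
    [NormedSpace ℝ F] (f : Lp F 2 (volOn Ω)) (c : F) :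
    ∀ᵐ x ∂volOn Ω, (f - Lp.constL 2 (volOn Ω) ℝ c) x = f x - c := by
  filter_upwards [Lp.coeFn_sub f (Lp.constL 2 (volOn Ω) ℝ c), coeFn_constL (Ω := Ω) c] with x h1 h2
  rw [h1, Pi.sub_apply, h2]

/-- The energy estimate for the difference of a solution of the regularized problem and a
homogeneous state. -/
theorem IsRegularizedSolution.energy_estimate [IsFiniteMeasure (volOn Ω)] (ho : IsOpen Ω)
    (hb : Bornology.IsBounded Ω) (hμ : 0 < μ) {ε : ℝ} {ξ₀ : Mat d} {ξ : devMat d}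
    (hξ₀ : symPart ξ₀ = devToSym ξ)
    {w : ℝ → H1 Ω} (hw : ∀ t, 0 ≤ t → (w t).1.fst =ᵐ[volOn Ω] fun x => t • mulPt ξ₀ x)
    {z₀ : Lp ℝ 2 (volOn Ω)}
    {u : ℝ → H1 Ω} {e : ℝ → Lp (symMat d) 2 (volOn Ω)} {p : ℝ → Lp (devMat d) 2 (volOn Ω)}
    {z : ℝ → Lp ℝ 2 (volOn Ω)}
    (h : IsRegularizedSolution Ω (isotropicTensor d μ κ) (unitBall d) softV ε w 0 0 0 z₀ u e p z)
    {t : ℝ} (ht : 0 < t) (s : ℝ) (η : Lp (symMat d) 2 (volOn Ω)) (π : Lp (devMat d) 2 (volOn Ω))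
    (hη : η = e t - Lp.constL 2 (volOn Ω) ℝ (s • devToSym ξ))
    (hπ : π = p t - Lp.constL 2 (volOn Ω) ℝ ((t - s) • ξ)) :
    (∀ᵐ x ∂volOn Ω, strain (u t - w t) x = η x + devToSym (π x)) ∧
    Integrable (fun x => ‖dev (η x)‖ ^ 2) (volOn Ω) ∧
    Integrable (fun x => tr (η x : Mat d) ^ 2) (volOn Ω) ∧
    ∫ x in Ω, (μ * ‖dev (η x)‖ ^ 2 + κ * tr (η x : Mat d) ^ 2) ≤ μ * ∫ x in Ω, ‖π x‖ ^ 2 := by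
  have hadd : ∀ᵐ x ∂volOn Ω, strain (u t - w t) x = η x + devToSym (π x) := by
    rw [hη, hπ]
    filter_upwards [h.additive t ht, strain_sub_ae_eq ho hb (v := u t) (hw t ht.le),
      coeFn_sub_constL (e t) (s • devToSym ξ), coeFn_sub_constL (p t) ((t - s) • ξ)]
      with x h1 h2 h3 h4
    have h9 : ∀ B C : devMat d, devToSym (B - C) = devToSym B - devToSym C := fun _ _ => rfl
    have h10 : ∀ (a : ℝ) (B : devMat d), devToSym (a • B) = a • devToSym B := fun _ _ => rfl
    rw [h2, h1, h3, h4, hξ₀, h9, h10]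
    module
  have h2 : ∀ᵐ x ∂volOn Ω, η x + s • devToSym ξ = e t x := by
    rw [hη]
    filter_upwards [coeFn_sub_constL (e t) (s • devToSym ξ)] with x h3
    rw [h3, sub_add_cancel]
  refine ⟨hadd, Softening.energy_estimate hb hμ η π (s • devToSym ξ) (u t - w t)
    (h.boundary t ht) hadd ?_⟩
  have h1 := h.equilibrium t ht
  refine ⟨fun φ hφ => ?_, fun v hv => ?_⟩
  · rw [← h1.1 φ hφ]
    refine integral_congr_ae ?_
    filter_upwards [h2] with x hx
    rw [hx]
  · rw [← h1.2 v hv]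
    refine integral_congr_ae ?_
    filter_upwards [h2] with x hx
    rw [hx]

/-- At almost every time, the rates of a solution of the regularized problem differ from those of
a homogeneous state at most by a multiple of the distance of the plastic strain and of the
internal variable from that state. -/
theorem IsRegularizedSolution.norm_rate_sub_le [IsFiniteMeasure (volOn Ω)] (ho : IsOpen Ω)
    (hb : Bornology.IsBounded Ω) (hμ : 0 < μ) (hκ : 0 < κ) {ε : ℝ} (hε : 0 < ε)
    {ξ₀ : Mat d} {ξ : devMat d} (hξ₀ : symPart ξ₀ = devToSym ξ) (hξ : ‖ξ‖ = r)
    {w : ℝ → H1 Ω} (hw : ∀ t, 0 ≤ t → (w t).1.fst =ᵐ[volOn Ω] fun x => t • mulPt ξ₀ x)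
    {z₀ : Lp ℝ 2 (volOn Ω)}
    {u : ℝ → H1 Ω} {e : ℝ → Lp (symMat d) 2 (volOn Ω)} {p : ℝ → Lp (devMat d) 2 (volOn Ω)}
    {z : ℝ → Lp ℝ 2 (volOn Ω)}
    (h : IsRegularizedSolution Ω (isotropicTensor d μ κ) (unitBall d) softV ε w 0 0 0 z₀ u e p z)
    {τ : ℝ} (hτ : 0 < τ) (s θ : ℝ) {δp : Lp (devMat d) 2 (volOn Ω)} {δz : Lp ℝ 2 (volOn Ω)}
    (hflow : ∀ᵐ x ∂volOn Ω, (WithLp.toLp 2 (δp x, δz x) : DevR d) =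
      flowMap (unitBall d) ε
        (WithLp.toLp 2 (dev (isotropicTensor d μ κ (e τ x)), - deriv softV (z τ x)))) :
    ‖δp - Lp.constL 2 (volOn Ω) ℝ ((ε⁻¹ * (overstress μ r s θ * (2 * μ * s))) • ξ)‖ ≤
        2 * ε⁻¹ * (2 * μ + 1) * (‖p τ - Lp.constL 2 (volOn Ω) ℝ ((τ - s) • ξ)‖ +
          ‖z τ - Lp.constL 2 (volOn Ω) ℝ θ‖) ∧
      ‖δz - Lp.constL 2 (volOn Ω) ℝ (ε⁻¹ * (overstress μ r s θ * softSlope θ))‖ ≤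
        2 * ε⁻¹ * (2 * μ + 1) * (‖p τ - Lp.constL 2 (volOn Ω) ℝ ((τ - s) • ξ)‖ +
          ‖z τ - Lp.constL 2 (volOn Ω) ℝ θ‖) := by
  obtain ⟨η, hη⟩ : ∃ η, η = e τ - Lp.constL 2 (volOn Ω) ℝ (s • devToSym ξ) := ⟨_, rfl⟩
  obtain ⟨-, h3, h4, h5⟩ := h.energy_estimate ho hb hμ hξ₀ hw hτ s η _ hη rfl
  refine flow_estimate (η := η) hε hμ hξ ?_ h3 ?_ hflow
  · rw [hη]
    filter_upwards [coeFn_sub_constL (e τ) (s • devToSym ξ)] with x h6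
    rw [h6, sub_add_cancel]
  · rw [norm_sq_Lp_two]
    rw [integral_add (h3.const_mul _) (h4.const_mul _), integral_const_mul,
      integral_const_mul] at h5
    have h6 := mul_nonneg hκ.le (integral_nonneg (μ := volOn Ω) fun x => sq_nonneg
      (tr (η x : Mat d)))
    exact le_of_mul_le_mul_left (by linarith) hμ

/-- In a solution of the regularized problem with boundary datum `t ξ₀ x`, the plastic strain and
the internal variable are those of the homogeneous evolution, by Grönwall's lemma. -/
theorem IsRegularizedSolution.sub_constL_eq_zero [IsFiniteMeasure (volOn Ω)] (ho : IsOpen Ω)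
    (hb : Bornology.IsBounded Ω)
    (hμ : 0 < μ) (hκ : 0 < κ) {θ₀ ε T : ℝ} (hε : 0 < ε) (hT : 0 ≤ T)
    {ξ₀ : Mat d} {ξ : devMat d} (hξ₀ : symPart ξ₀ = devToSym ξ) (hξ : ‖ξ‖ = r)
    {w : ℝ → H1 Ω} (hw : ∀ t, 0 ≤ t → (w t).1.fst =ᵐ[volOn Ω] fun x => t • mulPt ξ₀ x)
    {z₀ : Lp ℝ 2 (volOn Ω)} (hz₀ : z₀ =ᵐ[volOn Ω] fun _ => θ₀)
    {u : ℝ → H1 Ω} {e : ℝ → Lp (symMat d) 2 (volOn Ω)} {p : ℝ → Lp (devMat d) 2 (volOn Ω)}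
    {z : ℝ → Lp ℝ 2 (volOn Ω)}
    (h : IsRegularizedSolution Ω (isotropicTensor d μ κ) (unitBall d) softV ε w 0 0 0 z₀ u e p z)
    {s θ : ℝ → ℝ} (hs : IsHomogeneous μ r θ₀ ε T s θ) {t : ℝ} (ht : t ∈ Icc 0 T) :
    p t - Lp.constL 2 (volOn Ω) ℝ ((t - s t) • ξ) = 0 ∧
      z t - Lp.constL 2 (volOn Ω) ℝ (θ t) = 0 := by
  obtain ⟨-, -, hp0, hz0⟩ := h.initial
  obtain ⟨p', z', hp', hz', hflow⟩ := h.flow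
  obtain ⟨L, hL⟩ : ∃ L : ℝ →L[ℝ] Lp (devMat d) 2 (volOn Ω),
      ∀ a, L a = Lp.constL 2 (volOn Ω) ℝ (a • ξ) :=
    ⟨(Lp.constL 2 (volOn Ω) ℝ).comp (ContinuousLinearMap.toSpanSingleton ℝ ξ), fun _ => rfl⟩
  obtain ⟨M, hM⟩ : ∃ M : ℝ →L[ℝ] Lp ℝ 2 (volOn Ω), ∀ a, M a = Lp.constL 2 (volOn Ω) ℝ a :=
    ⟨Lp.constL 2 (volOn Ω) ℝ, fun _ => rfl⟩
  obtain ⟨hP'c, hZ'c⟩ := hs.continuousOn_rates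
  obtain ⟨hpi, hpe⟩ := hp'.sub_primitive L (a := fun τ => τ - s τ) hT hP'c
    (fun τ hτ => ((hasDerivWithinAt_id τ _).sub (hs.deriv_s τ hτ)).congr_deriv (by ring))
    (by rw [hp0, hs.init_s, sub_zero, map_zero])
  obtain ⟨hzi, hze⟩ := hz'.sub_primitive M (a := θ) hT hZ'c hs.deriv_θ (by
      rw [hz0, hs.init_θ, hM]
      exact Lp.ext (hz₀.trans (coeFn_constL θ₀).symm))
  have hest := (hflow.and (self_mem_ae_restrict measurableSet_Ioi)).mono fun τ h1 =>
    h.norm_rate_sub_le ho hb hμ hκ hε hξ₀ hξ hw h1.2 (s τ) (θ τ) h1.1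
  simp only [← hL, ← hM] at hest ⊢
  exact eq_zero_of_primitive_of_norm_le hT hpi hzi hpe hze
    (hest.mono fun τ h1 _ => h1.1) (hest.mono fun τ h1 _ => h1.2) t ht

/-- Every solution of the regularized problem with boundary datum `t ξ₀ x` is homogeneous. -/
theorem IsRegularizedSolution.eq_homogeneous (ho : IsOpen Ω) (hb : Bornology.IsBounded Ω)
    (hμ : 0 < μ) (hκ : 0 < κ) {θ₀ ε T : ℝ} (hε : 0 < ε) (hT : 0 ≤ T)
    {ξ₀ : Mat d} {ξ : devMat d} (hξ₀ : symPart ξ₀ = devToSym ξ) (hξ : ‖ξ‖ = r)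
    {w : ℝ → H1 Ω} (hw : ∀ t, 0 ≤ t → (w t).1.fst =ᵐ[volOn Ω] fun x => t • mulPt ξ₀ x)
    {z₀ : Lp ℝ 2 (volOn Ω)} (hz₀ : z₀ =ᵐ[volOn Ω] fun _ => θ₀)
    {u : ℝ → H1 Ω} {e : ℝ → Lp (symMat d) 2 (volOn Ω)} {p : ℝ → Lp (devMat d) 2 (volOn Ω)}
    {z : ℝ → Lp ℝ 2 (volOn Ω)}
    (h : IsRegularizedSolution Ω (isotropicTensor d μ κ) (unitBall d) softV ε w 0 0 0 z₀ u e p z)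
    {s θ : ℝ → ℝ} (hs : IsHomogeneous μ r θ₀ ε T s θ) {t : ℝ} (ht : t ∈ Icc 0 T) :
    ((u t).1.fst =ᵐ[volOn Ω] fun x => t • mulPt ξ₀ x) ∧
      (e t =ᵐ[volOn Ω] fun _ => s t • symPart ξ₀) ∧
      (p t =ᵐ[volOn Ω] fun _ => (t - s t) • ξ) ∧
      (z t =ᵐ[volOn Ω] fun _ => θ t) := by
  have := isFiniteMeasure_volOn hb
  obtain ⟨hu0, he0, -, -⟩ := h.initial
  have hzero := h.sub_constL_eq_zero ho hb hμ hκ hε hT hξ₀ hξ hw hz₀ hs ht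
  have hp : p t =ᵐ[volOn Ω] fun _ => (t - s t) • ξ := by
    rw [sub_eq_zero.1 hzero.1]
    exact coeFn_constL _
  have hz : z t =ᵐ[volOn Ω] fun _ => θ t := by
    rw [sub_eq_zero.1 hzero.2]
    exact coeFn_constL _
  rcases ht.1.eq_or_lt with rfl | htpos
  · refine ⟨?_, ?_, hp, hz⟩
    · rw [hu0]
      filter_upwards [Lp.coeFn_zero (Pt d) 2 (volOn Ω)] with x hx
      simpa using hx
    · rw [he0, hs.init_s]
      filter_upwards [Lp.coeFn_zero (symMat d) 2 (volOn Ω)] with x hx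
      simpa using hx
  -- the energy estimate then gives the elastic strain, and the strain gives the displacement
  obtain ⟨η, hη⟩ : ∃ η, η = e t - Lp.constL 2 (volOn Ω) ℝ (s t • devToSym ξ) := ⟨_, rfl⟩
  obtain ⟨hadd, h3, h4, h5⟩ := h.energy_estimate ho hb hμ hξ₀ hw htpos (s t) η _ hη rfl
  have hη0 : ∀ᵐ x ∂volOn Ω, η x = 0 := by
    rw [← norm_sq_Lp_two, hzero.1, Lp.norm_zero] at h5
    have h6 : ∀ x, 0 ≤ μ * ‖dev (η x)‖ ^ 2 +
        κ * tr (η x : Mat d) ^ 2 := fun x => by positivity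
    have h7 := (integral_eq_zero_iff_of_nonneg h6 ((h3.const_mul _).add (h4.const_mul _))).1
      (le_antisymm (by simpa using h5) (integral_nonneg h6))
    filter_upwards [h7] with x hx
    simp only [Pi.zero_apply] at hx
    have h8 : 0 ≤ μ * ‖dev (η x)‖ ^ 2 := by positivity
    have h9 : 0 ≤ κ * tr (η x : Mat d) ^ 2 := by positivity
    have h10 : μ * ‖dev (η x)‖ ^ 2 = 0 := by linarith
    have h11 : κ * tr (η x : Mat d) ^ 2 = 0 := by linarith
    refine eq_zero_of_dev_of_tr ?_ ?_
    · simpa [hμ.ne'] using h10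
    · simpa [hκ.ne'] using h11
  refine ⟨?_, ?_, hp, hz⟩
  · have h6 := fst_ae_eq_zero_of_strain ho hb (u t - w t) (h.boundary t htpos) (by
      filter_upwards [hadd, hη0, Lp.coeFn_zero (devMat d) 2 (volOn Ω)] with x h7 h8 h9
      rw [h7, h8, hzero.1, h9, zero_add]
      rfl)
    filter_upwards [h6, Lp.coeFn_sub (u t).1.fst (w t).1.fst, hw t ht.1] with x h7 h8 h9
    rw [← h9]
    refine sub_eq_zero.1 ?_
    rw [← Pi.sub_apply, ← h8]
    exact h7
  · filter_upwards [hη0, coeFn_sub_constL (e t) (s t • devToSym ξ)] with x h6 h7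
    rw [hη, h7] at h6
    rw [hξ₀]
    exact sub_eq_zero.1 h6

end Regularized

/-! ### The limit of the homogeneous evolutions -/

/-- The homogeneous regularized evolutions converge as `ε → 0`. -/
theorem exists_homogeneous_limit {μ r θ₀ : ℝ} (hμ : 0 < μ) (hr : 0 < r) (hθ₀ : 0 < θ₀) :
    ∃ s θ : ℝ → ℝ,
      (∀ t, 0 ≤ t → s t ≤ t ∧ θ₀ ≤ θ t) ∧ MonotoneOn θ (Ici 0) ∧
      (∀ t, 0 ≤ t → ContinuousWithinAt s (Icc 0 t) t ∧ ContinuousWithinAt θ (Icc 0 t) t) ∧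
      (∀ t, 0 ≤ t → t ≤ elasticLimit μ r θ₀ → s t = t ∧ θ t = θ₀) ∧
      (∀ t, elasticLimit μ r θ₀ < t → s t = elasticLimit μ r (θ t)) ∧
      ∀ T, 0 ≤ T → ∀ (ε : ℕ → ℝ) (sε θε : ℕ → ℝ → ℝ),
        (∀ n, 0 < ε n) → Tendsto ε atTop (𝓝 0) →
        (∀ n, IsHomogeneous μ r θ₀ (ε n) T (sε n) (θε n)) →
        Tendsto (fun n => sε n T) atTop (𝓝 (s T)) ∧
          Tendsto (fun n => θε n T) atTop (𝓝 (θ T)) := by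
  have hC := isCriticalCurve_decay hμ hr hθ₀
  obtain ⟨y, θ, hθ, hmono, hcont, helastic, hplastic, hlim⟩ := hC.exists_limit
  have hpos : ∀ θ, decay μ θ₀ θ ≠ 0 := fun θ => (decay_pos μ θ₀ θ).ne'
  have hY : decay μ θ₀ θ₀ * elasticLimit μ r θ₀ = elasticLimit μ r θ₀ := by
    rw [hC.init, one_mul]
  have hlim' : ∀ T, 0 ≤ T → ∀ (ε : ℕ → ℝ) (sε θε : ℕ → ℝ → ℝ),
      (∀ n, 0 < ε n) → Tendsto ε atTop (𝓝 0) →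
      (∀ n, IsHomogeneous μ r θ₀ (ε n) T (sε n) (θε n)) →
      Tendsto (fun n => sε n T) atTop (𝓝 (y T / decay μ θ₀ (θ T))) ∧
        Tendsto (fun n => θε n T) atTop (𝓝 (θ T)) := by
    intro T hT ε sε θε hε hε0 h
    obtain ⟨h1, h2⟩ := hlim _ (isActivatedAbove_fastRate hμ hr hθ₀) T hT ε _ θε hε hε0
      fun n => (h n).isSlowFast hθ₀
    refine ⟨?_, h2⟩
    have h3 := h1.div ((hC.cont.tendsto (θ T)).comp h2) (hpos _)
    refine h3.congr fun n => ?_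
    simp only [Pi.div_apply, Function.comp_apply]
    rw [mul_div_cancel_right₀ _ (hpos _)]
  refine ⟨fun t => y t / decay μ θ₀ (θ t), θ, fun t ht => ⟨?_, hθ t ht⟩, hmono, fun t ht => ?_,
    fun t ht hle => ?_, fun t hlt => ?_, hlim'⟩
  · have hε : ∀ n : ℕ, (0 : ℝ) < 1 / (n + 1) := fun n => by positivity
    choose sε θε h using fun n : ℕ => exists_isHomogeneous hμ hr hθ₀ (hε n) ht
    refine le_of_tendsto' (hlim' t ht _ sε θε hε tendsto_one_div_add_atTop_nhds_zero_nat h).1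
      fun n => ?_
    have h1 := sub_le_of_derivWithin_le (C := 1) (h n).deriv_s (left_mem_Icc.2 ht)
      (right_mem_Icc.2 ht) ht fun τ hτ => by
        have h2 := (h n).nonneg τ hτ
        have h3 := overstress_nonneg μ r (sε n τ) (θε n τ)
        have h4 := hε n
        rw [sub_le_self_iff]
        positivity
    rw [(h n).init_s] at h1
    linarith
  · obtain ⟨h1, h2⟩ := hcont t ht
    exact ⟨h1.div (hC.cont.continuousAt.comp_continuousWithinAt h2) (hpos _), h2⟩
  · obtain ⟨h1, h2⟩ := helastic t ht (by rwa [hY])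
    exact ⟨by simp only [h1, h2, hC.init, div_one], h2⟩
  · have h0 : 0 ≤ elasticLimit μ r θ₀ := by
      rw [elasticLimit]
      positivity
    have h1 := hplastic t (h0.trans hlt.le) (by rwa [hY])
    simp only at h1 ⊢
    rw [← h1, mul_div_cancel_left₀ _ (hpos _)]

/-! ### Generalized Young measures of constant functions -/

section Delta

variable {d : ℕ} {Ω : Set (Pt d)}

theorem ae_leb_of_ae {P : Pt d → Prop} (h : ∀ᵐ x ∂volOn Ω, P x) : ∀ᵐ x : closure Ω ∂leb Ω, P x := by
  have he : MeasurableEmbedding (Subtype.val : closure Ω → Pt d) :=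
    MeasurableEmbedding.subtype_coe isClosed_closure.measurableSet
  rw [← he.ae_map_iff (p := P), leb, he.map_comap]
  exact ae_restrict_of_ae h

theorem isFiniteMeasure_leb (hb : Bornology.IsBounded Ω) : IsFiniteMeasure (leb Ω) := by
  have := isFiniteMeasure_volOn hb
  have he : MeasurableEmbedding (Subtype.val : closure Ω → Pt d) :=
    MeasurableEmbedding.subtype_coe isClosed_closure.measurableSet
  refine ⟨?_⟩
  rw [leb, he.comap_apply]
  exact measure_lt_top _ _

/-- The generalized Young measure of a constant function depends continuously on the constant. -/
theorem continuous_deltaPairing_const {F : Type*} [NormedAddCommGroup F] [NormedSpace ℝ F]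
    (hb : Bornology.IsBounded Ω) [FirstCountableTopology F] [LocallyCompactSpace F] (f : Chom Ω F) :
    Continuous fun c : F => deltaPairing (leb Ω) (fun _ => c) (fun _ => 1) f := by
  have := isFiniteMeasure_leb hb
  have : CompactSpace (closure Ω) := isCompact_iff_compactSpace.1 hb.isCompact_closure
  have h1 : Continuous (Function.uncurry fun (c : F) (x : closure Ω) => f.1 (x, c, 1)) := by
    unfold Function.uncurry
    fun_prop
  have := continuous_parametric_integral_of_continuous (μ := leb Ω) (s := univ) h1 isCompact_univ
  simpa only [deltaPairing, Measure.restrict_univ] using this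

theorem ae_eq_of_forall_integral_inner_eq {α F : Type*} [MeasurableSpace α] {m : Measure α}
    [NormedAddCommGroup F] [InnerProductSpace ℝ F] [CompleteSpace F] [IsFiniteMeasure m]
    {f g : α → F}
    (hf : Integrable f m) (hg : Integrable g m)
    (h : ∀ φ : α → F, MemLp φ ⊤ m → ∫ x, inner ℝ (f x) (φ x) ∂m = ∫ x, inner ℝ (g x) (φ x) ∂m) :
    f =ᵐ[m] g := by
  refine hf.ae_eq_of_forall_setIntegral_eq f g hg fun S hS _ => ext_inner_right ℝ fun c => ?_
  have key : ∀ {k : α → F}, Integrable k m →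
      inner ℝ (∫ x in S, k x ∂m) c = ∫ x, inner ℝ (k x) (S.indicator (fun _ => c) x) ∂m := by
    intro k hk
    rw [real_inner_comm, ← integral_inner hk.integrableOn, ← integral_indicator hS]
    refine integral_congr_ae (Eventually.of_forall fun x => ?_)
    by_cases hx : x ∈ S
    · simp [hx, real_inner_comm]
    · simp [hx]
  rw [key hf, key hg]
  exact h _ ((memLp_top_const c).indicator hS)

/-- A set of full measure in `[0, ∞)` that contains `0` is dense from the left. -/
theorem neBot_nhdsWithin_of_null_diff {Θ : Set ℝ} (h0 : (0 : ℝ) ∈ Θ)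
    (hΘ : volume (Ici 0 \ Θ) = 0) {t : ℝ} (ht : 0 ≤ t) : (𝓝[Θ ∩ Icc 0 t] t).NeBot := by
  rw [← mem_closure_iff_nhdsWithin_neBot]
  rcases ht.eq_or_lt with rfl | hpos
  · exact subset_closure ⟨h0, left_mem_Icc.2 le_rfl⟩
  rw [Metric.mem_closure_iff]
  intro δ hδ
  have h1 : 0 < volume (Ioo (max 0 (t - δ)) t) := by
    rw [Real.volume_Ioo, ENNReal.ofReal_pos]
    have := max_lt hpos (sub_lt_self t hδ)
    linarith
  have h2 : ¬ Ioo (max 0 (t - δ)) t ⊆ Ici 0 \ Θ := fun h3 =>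
    h1.ne' (measure_mono_null h3 hΘ)
  obtain ⟨τ, hτ, hn⟩ := not_subset.1 h2
  have h3 : 0 < τ := (le_max_left _ _).trans_lt hτ.1
  have h4 : t - δ < τ := (le_max_right _ _).trans_lt hτ.1
  refine ⟨τ, ⟨?_, h3.le, hτ.2.le⟩, ?_⟩
  · by_contra hc
    exact hn ⟨h3.le, hc⟩
  · rw [Real.dist_eq, abs_of_pos (by linarith [hτ.2])]
    linarith

/-- The values of the limit evolution at the times of pointwise convergence. -/
theorem IsApproximableEvolution.exists_times {μ κ r θ₀ : ℝ} (ho : IsOpen Ω)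
    (hb : Bornology.IsBounded Ω)
    (hμ : 0 < μ) (hκ : 0 < κ) (hr : 0 < r) (hθ₀ : 0 < θ₀)
    {ξ₀ : Mat d} {ξ : devMat d} (hξ₀ : symPart ξ₀ = devToSym ξ) (hξ : ‖ξ‖ = r)
    {w : ℝ → H1 Ω} (hw : ∀ t, 0 ≤ t → (w t).1.fst =ᵐ[volOn Ω] fun x => t • mulPt ξ₀ x)
    {z₀ : Lp ℝ 2 (volOn Ω)} (hz₀ : z₀ =ᵐ[volOn Ω] fun _ => θ₀)
    {u : ℝ → BD Ω} {e : ℝ → Lp (symMat d) 2 (volOn Ω)} {ν : SGY Ω (DevR d)}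
    (h : IsApproximableEvolution Ω (isotropicTensor d μ κ) (unitBall d) softV w 0 0 0 z₀ u e ν)
    {s θ : ℝ → ℝ}
    (hlim : ∀ T, 0 ≤ T → ∀ (ε : ℕ → ℝ) (sε θε : ℕ → ℝ → ℝ),
        (∀ n, 0 < ε n) → Tendsto ε atTop (𝓝 0) →
        (∀ n, IsHomogeneous μ r θ₀ (ε n) T (sε n) (θε n)) →
        Tendsto (fun n => sε n T) atTop (𝓝 (s T)) ∧
          Tendsto (fun n => θε n T) atTop (𝓝 (θ T))) :
    ∃ Θ : Set ℝ, Θ ⊆ Ici 0 ∧ 0 ∈ Θ ∧ volume (Ici 0 \ Θ) = 0 ∧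
      (∀ t ∈ Θ, ∀ g : Pt d → Pt d, MemLp g ⊤ (volOn Ω) →
        ∫ x in Ω, inner ℝ ((u t).toLp x) (g x) = t * ∫ x in Ω, inner ℝ (mulPt ξ₀ x) (g x)) ∧
      (∀ t ∈ Θ, ∀ g : Lp (symMat d) 2 (volOn Ω),
        inner ℝ (e t) g = s t * ∫ x in Ω, inner ℝ (symPart ξ₀) (g x)) ∧
      ∀ {m : ℕ} (t : Fin m → ℝ), IsTimes t → (∀ i, t i ∈ Θ) → ∀ f : Chom Ω (Fin m → DevR d),
        (ν.at_times t).toFun f = deltaPairing (leb Ω)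
          (fun _ i => WithLp.toLp 2 ((t i - s (t i)) • ξ, θ (t i))) (fun _ => 1) f := by
  obtain ⟨ε, Θ, uε, eε, pε, zε, hε, hε0, hsub, h0, hnull, hsol, hu, he, hν⟩ := h.approx
  have hhom : ∀ t, 0 ≤ t → ∃ sε θε : ℕ → ℝ → ℝ,
      (∀ n, IsHomogeneous μ r θ₀ (ε n) t (sε n) (θε n)) := fun t ht => by
    choose sε θε h1 using fun n => exists_isHomogeneous hμ hr hθ₀ (hε n) ht
    exact ⟨sε, θε, h1⟩
  choose! sε θε hsθ using hhom
  have hconv := fun t (ht : 0 ≤ t) => hlim t ht ε _ _ hε hε0 (hsθ t ht)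
  have heq := fun t (ht : 0 ≤ t) n => (hsol n).eq_homogeneous ho hb hμ hκ (hε n) ht hξ₀ hξ hw hz₀
    (hsθ t ht n) (right_mem_Icc.2 ht)
  refine ⟨Θ, hsub, h0, hnull, fun t ht g hg => ?_, fun t ht g => ?_, fun t ht hΘ f => ?_⟩
  · obtain ⟨U, hU, hUlim⟩ := hu t ht
    refine tendsto_nhds_unique (hUlim.1 g hg) (tendsto_const_nhds.congr fun k => ?_)
    rw [← integral_const_mul]
    refine integral_congr_ae ?_
    filter_upwards [hU k, (heq t (hsub ht) k).1] with x h1 h2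
    rw [h1, h2, real_inner_smul_left]
  · refine tendsto_nhds_unique (he t ht g) ?_
    refine ((hconv t (hsub ht)).1.mul_const _).congr fun k => ?_
    rw [L2.inner_def, ← integral_const_mul]
    refine integral_congr_ae ?_
    filter_upwards [(heq t (hsub ht) k).2.1] with x h1
    rw [h1]
    exact (real_inner_smul_left _ _ _).symm
  · refine tendsto_nhds_unique (hν t ht hΘ f) ?_
    have h1 : Tendsto (fun k i => (WithLp.toLp 2 ((t i - sε (t i) k (t i)) • ξ, θε (t i) k (t i)) :
        DevR d)) atTop (𝓝 fun i => WithLp.toLp 2 ((t i - s (t i)) • ξ, θ (t i))) := by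
      refine tendsto_pi_nhds.2 fun i => ?_
      obtain ⟨h2, h3⟩ := hconv (t i) (ht.2 i)
      exact ((WithLp.prod_continuous_toLp 2 _ _).tendsto _).comp
        (((h2.const_sub (t i)).smul_const ξ).prodMk_nhds h3)
    refine (((continuous_deltaPairing_const hb f).tendsto _).comp h1).congr fun k => ?_
    refine integral_congr_ae ?_
    have h2 : ∀ i, ∀ᵐ x ∂volOn Ω, pε k (t i) x = (t i - sε (t i) k (t i)) • ξ ∧
        zε k (t i) x = θε (t i) k (t i) := fun i =>
      (heq (t i) (ht.2 i) k).2.2.1.and (heq (t i) (ht.2 i) k).2.2.2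
    filter_upwards [ae_leb_of_ae (ae_all_iff.2 h2)] with x hx
    simp only [hx]

/-- The values of the limit evolution at all times, by left-continuity. -/
theorem IsApproximableEvolution.eq_homogeneous_limit {μ κ r θ₀ : ℝ} (ho : IsOpen Ω)
    (hb : Bornology.IsBounded Ω)
    (hμ : 0 < μ) (hκ : 0 < κ) (hr : 0 < r) (hθ₀ : 0 < θ₀)
    {ξ₀ : Mat d} {ξ : devMat d} (hξ₀ : symPart ξ₀ = devToSym ξ) (hξ : ‖ξ‖ = r)
    {w : ℝ → H1 Ω} (hw : ∀ t, 0 ≤ t → (w t).1.fst =ᵐ[volOn Ω] fun x => t • mulPt ξ₀ x)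
    {z₀ : Lp ℝ 2 (volOn Ω)} (hz₀ : z₀ =ᵐ[volOn Ω] fun _ => θ₀)
    {u : ℝ → BD Ω} {e : ℝ → Lp (symMat d) 2 (volOn Ω)} {ν : SGY Ω (DevR d)}
    (h : IsApproximableEvolution Ω (isotropicTensor d μ κ) (unitBall d) softV w 0 0 0 z₀ u e ν)
    {s θ : ℝ → ℝ}
    (hcont : ∀ t, 0 ≤ t → ContinuousWithinAt s (Icc 0 t) t ∧ ContinuousWithinAt θ (Icc 0 t) t)
    (hlim : ∀ T, 0 ≤ T → ∀ (ε : ℕ → ℝ) (sε θε : ℕ → ℝ → ℝ),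
        (∀ n, 0 < ε n) → Tendsto ε atTop (𝓝 0) →
        (∀ n, IsHomogeneous μ r θ₀ (ε n) T (sε n) (θε n)) →
        Tendsto (fun n => sε n T) atTop (𝓝 (s T)) ∧
          Tendsto (fun n => θε n T) atTop (𝓝 (θ T))) :
    (∀ t, 0 ≤ t → (u t).toLp =ᵐ[volOn Ω] fun x => t • mulPt ξ₀ x) ∧
      (∀ t, 0 ≤ t → e t =ᵐ[volOn Ω] fun _ => s t • symPart ξ₀) ∧
      ∀ {m : ℕ} (t : Fin m → ℝ), IsTimes t → ∀ f : Chom Ω (Fin m → DevR d),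
        (ν.at_times t).toFun f = deltaPairing (leb Ω)
          (fun _ i => WithLp.toLp 2 ((t i - s (t i)) • ξ, θ (t i))) (fun _ => 1) f := by
  have := isFiniteMeasure_volOn hb
  obtain ⟨Θ, hsub, h0, hnull, hu, he, hν⟩ :=
    h.exists_times ho hb hμ hκ hr hθ₀ hξ₀ hξ hw hz₀ hlim
  have hne := fun t (ht : 0 ≤ t) => neBot_nhdsWithin_of_null_diff h0 hnull ht
  have hle : ∀ t, 𝓝[Θ ∩ Icc 0 t] t ≤ 𝓝[Icc 0 t] t := fun t => nhdsWithin_mono _ inter_subset_right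
  have hmem : ∀ t, ∀ᶠ τ in 𝓝[Θ ∩ Icc 0 t] t, τ ∈ Θ := fun t =>
    eventually_mem_nhdsWithin.mono fun τ hτ => hτ.1
  refine ⟨fun t ht => ?_, fun t ht => ?_, fun {m} t ht f => ?_⟩
  · have := hne t ht
    have hi : Integrable (fun x => t • mulPt ξ₀ x) (volOn Ω) :=
      ((memLp_congr_ae (hw t ht)).1 (Lp.memLp (w t).1.fst)).integrable (by norm_num)
    refine ae_eq_of_forall_integral_inner_eq (L1.integrable_coeFn _) hi fun g hg => ?_
    refine tendsto_nhds_unique (((h.left_u t ht).1 g hg).mono_left (hle t)) ?_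
    simp only [real_inner_smul_left, integral_const_mul]
    refine Tendsto.congr' ((hmem t).mono fun τ hτ => (hu τ hτ g hg).symm) ?_
    exact (tendsto_id.mono_left nhdsWithin_le_nhds).mul_const _
  · have := hne t ht
    suffices h1 : e t = Lp.constL 2 (volOn Ω) ℝ (s t • symPart ξ₀) by
      rw [h1]
      exact coeFn_constL _
    refine ext_inner_right ℝ fun g => ?_
    refine tendsto_nhds_unique ((h.left_e t ht g).mono_left (hle t)) ?_
    have h2 : inner ℝ (Lp.constL 2 (volOn Ω) ℝ (s t • symPart ξ₀)) g =
        s t * ∫ x in Ω, inner ℝ (symPart ξ₀) (g x) := by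
      rw [L2.inner_def, ← integral_const_mul]
      refine integral_congr_ae ?_
      filter_upwards [coeFn_constL (Ω := Ω) (s t • symPart ξ₀)] with x hx
      rw [hx]
      exact real_inner_smul_left (symPart ξ₀) (g x) (s t)
    rw [h2]
    refine Tendsto.congr' ((hmem t).mono fun τ hτ => (he τ hτ g).symm) ?_
    exact ((hcont t ht).1.mono_left (hle t)).mul_const _
  · have := fun i => hne (t i) (ht.2 i)
    have hev : ∀ i, Tendsto (fun v : Fin m → ℝ => v i)
        (Filter.pi fun i => 𝓝[Θ ∩ Icc 0 (t i)] (t i)) (𝓝[Θ ∩ Icc 0 (t i)] (t i)) :=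
      fun i => tendsto_eval_pi _ i
    have hΘ : ∀ᶠ v : Fin m → ℝ in Filter.pi fun i => 𝓝[Θ ∩ Icc 0 (t i)] (t i),
        ∀ i, v i ∈ Θ ∩ Icc 0 (t i) :=
      eventually_all.2 fun i => (hev i).eventually eventually_mem_nhdsWithin
    -- near `t` each time exceeds the earlier entries of `t`, which bound the earlier times
    have hmono : ∀ᶠ v : Fin m → ℝ in Filter.pi fun i => 𝓝[Θ ∩ Icc 0 (t i)] (t i),
        ∀ i j, i < j → t i < v j :=
      eventually_all.2 fun i => eventually_all.2 fun j => by
        by_cases hij : i < j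
        · filter_upwards [(hev j).eventually (nhdsWithin_le_nhds (lt_mem_nhds (ht.1 hij)))]
            with v hv _ using hv
        · exact Eventually.of_forall fun v hc => absurd hc hij
    have htimes : ∀ᶠ v : Fin m → ℝ in Filter.pi fun i => 𝓝[Θ ∩ Icc 0 (t i)] (t i), IsTimes v := by
      filter_upwards [hΘ, hmono] with v h1 h2
      exact ⟨fun i j hij => (h1 i).2.2.trans_lt (h2 i j hij), fun i => (h1 i).2.1⟩
    have hleft : Filter.pi (fun i => 𝓝[Θ ∩ Icc 0 (t i)] (t i)) ≤
        𝓝[{v | IsTimes v ∧ ∀ i, v i ≤ t i}] t := by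
      refine le_inf ?_ (le_principal_iff.2 ?_)
      · rw [nhds_pi]
        exact Filter.pi_mono fun i => nhdsWithin_le_nhds
      · filter_upwards [hΘ, htimes] with v h1 h2
        exact ⟨h2, fun i => (h1 i).2.2⟩
    refine tendsto_nhds_unique ((h.left_ν t ht f).mono_left hleft) ?_
    have h1 : Tendsto (fun (v : Fin m → ℝ) i =>
        (WithLp.toLp 2 ((v i - s (v i)) • ξ, θ (v i)) : DevR d))
        (Filter.pi fun i => 𝓝[Θ ∩ Icc 0 (t i)] (t i))
        (𝓝 fun i => WithLp.toLp 2 ((t i - s (t i)) • ξ, θ (t i))) := by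
      refine tendsto_pi_nhds.2 fun i => ?_
      obtain ⟨h2, h3⟩ := hcont (t i) (ht.2 i)
      have h4 := (h2.mono_left (hle (t i))).comp (hev i)
      have h5 := (h3.mono_left (hle (t i))).comp (hev i)
      have h6 := (hev i).mono_right nhdsWithin_le_nhds
      exact ((WithLp.prod_continuous_toLp 2 _ _).tendsto _).comp
        (((h6.sub h4).smul_const ξ).prodMk_nhds h5)
    refine Tendsto.congr' ?_ (((continuous_deltaPairing_const hb f).tendsto _).comp h1)
    filter_upwards [hΘ, htimes] with v h2 h3
    exact (hν v h3 (fun i => (h2 i).1) f).symm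

end Delta

/-! ### Vector measures with constant density -/

theorem withDensityᵥ_const_apply {X F : Type*} [MeasurableSpace X] [NormedAddCommGroup F]
    [NormedSpace ℝ F] [CompleteSpace F] (m : Measure X) [IsFiniteMeasure m] (c : F) {B : Set X}
    (hB : MeasurableSet B) : m.withDensityᵥ (fun _ => c) B = m.real B • c := by
  rw [withDensityᵥ_apply (integrable_const c) hB, setIntegral_const]

theorem variation_withDensityᵥ_const_univ_le {X F : Type*} [MeasurableSpace X]
    [NormedAddCommGroup F] [NormedSpace ℝ F] [CompleteSpace F] (m : Measure X) [IsFiniteMeasure m]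
    (c : F) : (m.withDensityᵥ fun _ => c).variation univ ≤ ENNReal.ofReal (‖c‖ * m.real univ) := by
  have h := VectorMeasure.variation_le_of_forall_enorm_le (μ := m.withDensityᵥ fun _ => c)
    (m := ‖c‖ₑ • m) fun B hB => by
      rw [withDensityᵥ_const_apply m c hB, enorm_smul, Measure.smul_apply, smul_eq_mul, mul_comm,
        Real.enorm_of_nonneg measureReal_nonneg, ofReal_measureReal]
  refine (h univ).trans_eq ?_
  rw [Measure.smul_apply, smul_eq_mul, ENNReal.ofReal_mul (norm_nonneg _), ofReal_norm,
    ofReal_measureReal]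

/-- A multiple of a fixed vector measure, with a bounded measurable coefficient. -/
theorem measureLinftyLoc_smul {X F : Type*} [TopologicalSpace X] [MeasurableSpace X]
    [NormedAddCommGroup F] [InnerProductSpace ℝ F] {P : VectorMeasure X F} {C : ℝ}
    (hP : P.variation univ ≤ ENNReal.ofReal C) {ψ : ℝ → ℝ}
    (hψ : AEMeasurable ψ (volume.restrict (Ici 0))) (hb : ∀ t, 0 ≤ t → 0 ≤ ψ t ∧ ψ t ≤ t) :
    MeasureLinftyLoc fun t => ψ t • P := by
  refine ⟨fun φ => ?_, fun T _ => ⟨T * C, ?_⟩⟩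
  · simp only [VectorMeasure.integral_smul_vectorMeasure, smul_eq_mul]
    exact hψ.mul_const _
  · filter_upwards [ae_restrict_mem measurableSet_Icc] with t ht
    obtain ⟨h1, h2⟩ := hb t ht.1
    rw [VectorMeasure.variation_smul, ENNReal.ofReal_mul (ht.1.trans ht.2)]
    simp only [Measure.smul_apply]
    rw [ENNReal.smul_def, smul_eq_mul]
    refine mul_le_mul' ?_ hP
    rw [← enorm_eq_nnnorm, Real.enorm_of_nonneg h1]
    exact ENNReal.ofReal_le_ofReal (h2.trans ht.2)

end Softening

end

open Softening MeasureTheory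
theorem mainTheorem6 (μ θ₀ r : ℝ) (hμ : 0 < μ) (hθ₀ : 0 < θ₀) (hr : 0 < r) :
    ∃ ψ θ : ℝ → ℝ,
      (∀ t, 0 ≤ t → 0 ≤ ψ t ∧ 0 ≤ θ t) ∧
      (∀ t, 0 ≤ t → t ≤ elasticLimit μ r θ₀ → ψ t = 0 ∧ θ t = θ₀) ∧
      (∀ t, elasticLimit μ r θ₀ < t → ψ t = t - elasticLimit μ r (θ t)) ∧
      ∀ (d : ℕ) (_ : 2 ≤ d) (Ω : Set (Pt d)) (_ : IsLipschitzDomain Ω) (κ : ℝ) (_ : 0 < κ)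
        (ξ₀ : Mat d) (_ : tr ξ₀ = 0) (_ : ‖symPart ξ₀‖ = r)
        (w : ℝ → H1 Ω)
        (_ : ∀ t, 0 ≤ t → (w t).1.fst =ᵐ[volOn Ω] fun x => t • mulPt ξ₀ x)
        (z₀ : Lp ℝ 2 (volOn Ω)) (_ : z₀ =ᵐ[volOn Ω] fun _ => θ₀)
        (u : ℝ → BD Ω) (e : ℝ → Lp (symMat d) 2 (volOn Ω)) (ν : SGY Ω (DevR d)),
        IsApproximableEvolution Ω (isotropicTensor d μ κ) (unitBall d) softV w 0 0 0 z₀ u e ν →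
        ∃ (p : ℝ → VectorMeasure (closure Ω) (devMat d)) (z : ℝ → Lp ℝ 1 (volOn Ω)),
          IsSpatiallyRegular ν p z ∧
          ∀ t, 0 ≤ t →
            ((u t).toLp =ᵐ[volOn Ω] fun x => t • mulPt ξ₀ x) ∧
            (e t =ᵐ[volOn Ω] fun _ => (t - ψ t) • symPart ξ₀) ∧
            (∀ B : Set (closure Ω), MeasurableSet B →
              (p t B : Mat d) = (ψ t * (leb Ω).real B) • (symPart ξ₀ : Mat d)) ∧
            (z t =ᵐ[volOn Ω] fun _ => θ t) := by
  obtain ⟨s, θ, hsθ, hmono, hcont, helastic, hplastic, hlim⟩ :=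
    exists_homogeneous_limit hμ hr hθ₀
  have hlimit_nonneg : ∀ θ, 0 ≤ elasticLimit μ r θ := fun θ => by
    rw [elasticLimit]
    positivity
  have hs0 : ∀ t, 0 ≤ t → 0 ≤ s t := fun t ht => by
    rcases le_or_gt t (elasticLimit μ r θ₀) with h1 | h1
    · rwa [(helastic t ht h1).1]
    · rw [hplastic t h1]
      exact hlimit_nonneg _
  refine ⟨fun t => t - s t, θ, fun t ht => ⟨sub_nonneg.2 (hsθ t ht).1, hθ₀.le.trans (hsθ t ht).2⟩,
    fun t ht hle => ?_, fun t hlt => ?_, ?_⟩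
  · obtain ⟨h1, h2⟩ := helastic t ht hle
    exact ⟨by simp only [h1, sub_self], h2⟩
  · simp only [hplastic t hlt]
  intro d _ Ω hΩ κ hκ ξ₀ htr hnorm w hw z₀ hz₀ u e ν h
  have hb := hΩ.isBounded
  have := isFiniteMeasure_volOn hb
  have := isFiniteMeasure_leb hb
  have htrace : tr (symPart ξ₀ : Mat d) = 0 := by
    rw [← htr]
    simp only [tr, symPart]
    exact Finset.sum_congr rfl fun i _ => by simp
  let ξ : devMat d := ⟨symPart ξ₀, (symPart ξ₀).2, htrace⟩
  have hξ : ‖ξ‖ = r := hnorm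
  obtain ⟨hu, he, hν⟩ := h.eq_homogeneous_limit hΩ.isOpen hb hμ hκ hr hθ₀ (ξ := ξ) rfl hξ hw hz₀
    hcont hlim
  have hθm : AEMeasurable θ (volume.restrict (Ici 0)) :=
    aemeasurable_restrict_of_monotoneOn measurableSet_Ici hmono
  -- `θ` is monotone, and `s` is a function of `t` and `θ t`
  have hsm : AEMeasurable s (volume.restrict (Ici 0)) := by
    have h1 : Measurable fun t =>
        if t ≤ elasticLimit μ r θ₀ then t else elasticLimit μ r (hθm.mk θ t) :=
      Measurable.ite measurableSet_Iic measurable_id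
        ((continuous_elasticLimit μ r).measurable.comp hθm.measurable_mk)
    refine h1.aemeasurable.congr ?_
    filter_upwards [ae_restrict_mem measurableSet_Ici, hθm.ae_eq_mk] with t ht heq
    rw [← heq]
    split_ifs with h2
    · exact (helastic t ht h2).1.symm
    · exact (hplastic t (not_le.1 h2)).symm
  have hz : ∀ t, Lp.constL 1 (volOn Ω) ℝ (θ t) =ᵐ[volOn Ω] fun _ => θ t := fun t =>
    Lp.coeFn_const (p := 1) (μ := volOn Ω) (θ t)
  refine ⟨fun t => (t - s t) • (leb Ω).withDensityᵥ fun _ => ξ,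
    fun t => Lp.constL 1 (volOn Ω) ℝ (θ t), ⟨?_, ?_, ?_⟩, fun t ht =>
    ⟨hu t ht, ?_, fun B hB => ?_, hz t⟩⟩
  · exact measureLinftyLoc_smul (variation_withDensityᵥ_const_univ_le _ _)
      (aemeasurable_id.sub hsm) fun t ht =>
        ⟨sub_nonneg.2 (hsθ t ht).1, sub_le_self _ (hs0 t ht)⟩
  · intro T hT
    refine MemLp.of_bound 
      (C := ‖(Lp.constL 1 (volOn Ω) ℝ : ℝ →L[ℝ] Lp ℝ 1 (volOn Ω))‖ * θ T) ?_ ?_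
    · refine (Lp.constL 1 (volOn Ω) ℝ : ℝ →L[ℝ] Lp ℝ 1
        (volOn Ω)).continuous.comp_aestronglyMeasurable
        ((hθm.mono_measure (Measure.restrict_mono Icc_subset_Ici_self le_rfl)).aestronglyMeasurable)
    · filter_upwards [ae_restrict_mem measurableSet_Icc] with t ht
      refine (ContinuousLinearMap.le_opNorm _ _).trans
        (mul_le_mul_of_nonneg_left ?_ (norm_nonneg _))
      rw [Real.norm_of_nonneg (hθ₀.le.trans (hsθ t ht.1).2)]
      exact hmono ht.1 hT.le ht.2
  · intro m t ht
    refine ⟨(leb Ω).withDensityᵥ fun _ i => WithLp.toLp 2 ((t i - s (t i)) • ξ, θ (t i)),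
      fun B hB i => ?_, leb Ω, _, fun _ => 1, inferInstance, integrable_const _, measurable_const,
      fun _ => zero_le_one, rfl, ?_, hν t ht⟩
    · rw [withDensityᵥ_const_apply _ _ hB, smul_apply,
        withDensityᵥ_const_apply _ _ hB, integral_congr_ae (ae_restrict_of_ae
          (ae_leb_of_ae (P := fun x => Lp.constL 1 (volOn Ω) ℝ (θ (t i)) x = θ (t i))
            (hz (t i)))), setIntegral_const, Pi.smul_apply, ← WithLp.toLp_smul,
        Prod.smul_mk, smul_comm]
    · simp
  · simp only [sub_sub_cancel]
    exact he t ht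
  · rw [smul_apply, withDensityᵥ_const_apply _ _ hB, smul_smul]
    rfl
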